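/- Let $R$ be a unital associative ring which is free as a $\mathbb{Z}$-module. Regard $\mathbb{Q}\otimes_{\mathbb{Z}}R$ as a Lie algebra over $\mathbb{Q}$ via the commutator, and let $U(\mathbb{Q}\otimes R)$ be its universal enveloping algebra, with its usual Hopf algebra structure (elements of $\mathbb{Q}\otimes R$ are primitive); tensor powers of it carry the tensor product Hopf algebra structure. Let $\mathcal{G}_\infty^{\mathbb{Q}}(R)=\bigotimes_{l\ge 1}U(\mathbb{Q}\otimes R)$ (spanned by the pure tensors with almost all factors equal to $1$), and for $r\in\mathbb{Q}\otimes R$ let $T_l(r)\in\mathcal{G}_\infty^{\mathbb{Q}}(R)$ be the element $r$ of the $l$-th tensor factor. For $U\in R$ define $e_n(U)\in\mathcal{G}_\infty^{\mathbb{Q}}(R)$, $n\ge 0$, by $$E_U(t)=\sum_{n\ge 0}e_n(U)t^n=\prod_{l\ge 1}\exp\bigl(T_l(\log(1-(-t)^lU))\bigr),$$ where $T_l$ is applied to each coefficient of a power series. Let $\mathcal{G}_\infty^{\mathbb{Z}}(R)$ be the $\mathbb{Z}$-subalgebra of $\mathcal{G}_\infty^{\mathbb{Q}}(R)$ generated by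 all $e_i(U)$ ($i\ge 0$, $U\in R$), and for $k\ge 0$ let $\mathcal{G}_k^{\mathbb{Z}}(R)$ be the $\mathbb{Z}$-subalgebra generated by the $e_i(U)$ with $i\le k$ and $U\in R$. Then: 1. $\mathcal{G}_\infty^{\mathbb{Z}}(R)$ has a Hopf algebra structure over $\mathbb{Z}$ with $\Delta(E_U(t))=E_U(t)\otimes E_U(t)$, $\varepsilon(E_U(t))=1$ and $S(E_U(t))=E_U(t)^{-1}$ for all $U\in R$, and each $\mathcal{G}_k^{\mathbb{Z}}(R)$ is a Hopf subalgebra of it, that is, it has a Hopf algebra structure for which the inclusion is a morphism of Hopf algebras. 2. For every $k$, $\mathcal{G}_k^{\mathbb{Z}}(R)$ with this Hopf algebra structure is an integral form of the Hopf algebra $U(\mathbb{Q}\otimes R)^{\otimes k}$, the latter being mapped to $\mathcal{G}_\infty^{\mathbb{Q}}(R)$ as the first $k$ tensor factors: $\mathcal{G}_k^{\mathbb{Z}}(R)$ is a free $\mathbb{Z}$-module, and there is an isomorphism of Hopf algebras $\mathbb{Q}\otimes_{\mathbb{Z}}\mathcal{G}_k^{\mathbb{Z}}(R)\cong U(\mathbb{Q}\otimes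 R)^{\otimes k}$ whose composite with the map to $\mathcal{G}_\infty^{\mathbb{Q}}(R)$ is $q\otimes x\mapsto qx$. In particular $\mathcal{G}_1^{\mathbb{Z}}(R)$ is in the same sense an integral form of the Hopf algebra $U(\mathbb{Q}\otimes R)$. 3. For every $\mathbb{Z}$-basis $(b_i)_{i\in I}$ of $R$ with $I$ totally ordered, the PBW monomials $\prod_{i\in I}b_i^{n_i}$ (factors in increasing order, $n_i\ge 0$, almost all $n_i=0$), taken in the first tensor factor $U(\mathbb{Q}\otimes R)$, form a $\mathbb{Z}$-basis of $\mathcal{G}_1^{\mathbb{Z}}(R)$. 4. If $R$ has finite rank over $\mathbb{Z}$, then each $\mathcal{G}_k^{\mathbb{Z}}(R)$ is left and right noetherian. -/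

import Mathlib

open scoped TensorProduct PowerSeries

noncomputable section

/-! ### Hopf algebra structures on a given algebra -/

/-- A Hopf algebra structure on a given (not necessarily commutative) `K`-algebra `A`. -/
structure HopfStructure (K A : Type*) [CommRing K] [Ring A] [Algebra K A] where
  comul : A →ₐ[K] A ⊗[K] A
  counit : A →ₐ[K] K
  antipode : A →ₗ[K] A
  coassoc : (Algebra.TensorProduct.assoc K K K A A A).toAlgHom.comp
      ((Algebra.TensorProduct.map comul (.id K A)).comp comul)
      = (Algebra.TensorProduct.map (.id K A) comul).comp comul
  rTensor_counit : (Algebra.TensorProduct.map counit (.id K A)).comp comul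
      = (Algebra.TensorProduct.lid K A).symm
  lTensor_counit : (Algebra.TensorProduct.map (.id K A) counit).comp comul
      = (Algebra.TensorProduct.rid K K A).symm
  antipode_rTensor : LinearMap.mul' K A ∘ₗ antipode.rTensor A ∘ₗ comul.toLinearMap
      = Algebra.linearMap K A ∘ₗ counit.toLinearMap
  antipode_lTensor : LinearMap.mul' K A ∘ₗ antipode.lTensor A ∘ₗ comul.toLinearMap
      = Algebra.linearMap K A ∘ₗ counit.toLinearMap

/-- The Mathlib Hopf algebra attached to a Hopf structure. -/
abbrev HopfStructure.toHopfAlgebra {K A : Type*} [CommRing K] [Ring A] [Algebra K A]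
    (H : HopfStructure K A) : HopfAlgebra K A where
  toBialgebra := Bialgebra.ofAlgHom H.comul H.counit H.coassoc H.rTensor_counit H.lTensor_counit
  antipode := H.antipode
  mul_antipode_rTensor_comul := H.antipode_rTensor
  mul_antipode_lTensor_comul := H.antipode_lTensor

/-- If `A` is generated by elements that are to be primitive, the Hopf algebra axioms need to be
checked on these generators only. Here `S` is the antipode, as an anti-homomorphism. -/
def HopfStructure.ofPrimitive {K A : Type*} [CommRing K] [Ring A] [Algebra K A]
    (Δ : A →ₐ[K] A ⊗[K] A) (ε : A →ₐ[K] K) (S : A →ₐ[K] Aᵐᵒᵖ) (s : Set A)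
    (hs : Algebra.adjoin K s = ⊤)
    (hΔ : ∀ x ∈ s, Δ x = x ⊗ₜ 1 + 1 ⊗ₜ x) (hε : ∀ x ∈ s, ε x = 0)
    (hS : ∀ x ∈ s, S x = MulOpposite.op (-x)) : HopfStructure K A where
  comul := Δ
  counit := ε
  antipode := (MulOpposite.opLinearEquiv K).symm.toLinearMap ∘ₗ S.toLinearMap
  coassoc := by
    refine AlgHom.ext_of_adjoin_eq_top hs fun x hx => ?_
    simp [hΔ x hx, TensorProduct.add_tmul, TensorProduct.tmul_add, add_assoc,
      Algebra.TensorProduct.one_def]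
  rTensor_counit := by
    refine AlgHom.ext_of_adjoin_eq_top hs fun x hx => ?_
    simp [hΔ x hx, hε x hx]
  lTensor_counit := by
    refine AlgHom.ext_of_adjoin_eq_top hs fun x hx => ?_
    simp [hΔ x hx, hε x hx]
  antipode_rTensor := by
    set T : A →ₗ[K] A := (MulOpposite.opLinearEquiv K).symm.toLinearMap ∘ₗ S.toLinearMap with hT
    have hTmul : ∀ a b, T (a * b) = T b * T a := fun a b => by simp [hT]
    have hT1 : T 1 = 1 := by simp [hT]
    have key1 : ∀ (w : A ⊗[K] A) (b₁ b₂ : A),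
        LinearMap.mul' K A (T.rTensor A (w * (b₁ ⊗ₜ b₂)))
          = T b₁ * LinearMap.mul' K A (T.rTensor A w) * b₂ := by
      intro w b₁ b₂
      induction w using TensorProduct.induction_on with
      | zero => simp
      | tmul x y => simp [hTmul, mul_assoc]
      | add x y hx hy => simp only [add_mul, map_add, hx, hy, mul_add]
    have key : ∀ (w z : A ⊗[K] A) (c : K), LinearMap.mul' K A (T.rTensor A w) = algebraMap K A c →
        LinearMap.mul' K A (T.rTensor A (w * z)) = algebraMap K A c *
          LinearMap.mul' K A (T.rTensor A z) := by
      intro w z c hw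
      induction z using TensorProduct.induction_on with
      | zero => simp
      | tmul x y =>
        rw [key1, hw, ← Algebra.commutes]; simp [mul_assoc]
      | add x y hx hy => simp only [mul_add, map_add, hx, hy]
    ext x
    have hx : x ∈ Algebra.adjoin K s := hs ▸ Algebra.mem_top
    simp only [LinearMap.comp_apply, AlgHom.toLinearMap_apply, Algebra.linearMap_apply]
    induction hx using Algebra.adjoin_induction with
    | mem x hx =>
      simp only [hΔ x hx, hε x hx, map_add, LinearMap.rTensor_tmul, LinearMap.mul'_apply, hT1]
      simp [hT, hS x hx]
    | algebraMap r =>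
      simp [Algebra.TensorProduct.algebraMap_apply, hT]
    | add x y _ _ hx hy => simp only [map_add, hx, hy]
    | mul x y _ _ hx hy => rw [map_mul, key _ _ _ hx, hy, map_mul, map_mul]
  antipode_lTensor := by
    set T : A →ₗ[K] A := (MulOpposite.opLinearEquiv K).symm.toLinearMap ∘ₗ S.toLinearMap with hT
    have hTmul : ∀ a b, T (a * b) = T b * T a := fun a b => by simp [hT]
    have hT1 : T 1 = 1 := by simp [hT]
    have key1 : ∀ (z : A ⊗[K] A) (a₁ a₂ : A),
        LinearMap.mul' K A (T.lTensor A ((a₁ ⊗ₜ a₂) * z))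
          = a₁ * LinearMap.mul' K A (T.lTensor A z) * T a₂ := by
      intro z a₁ a₂
      induction z using TensorProduct.induction_on with
      | zero => simp
      | tmul x y => simp [hTmul, mul_assoc]
      | add x y hx hy => simp only [mul_add, map_add, hx, hy, add_mul]
    have key : ∀ (w z : A ⊗[K] A) (c : K), LinearMap.mul' K A (T.lTensor A z) = algebraMap K A c →
        LinearMap.mul' K A (T.lTensor A (w * z)) =
          LinearMap.mul' K A (T.lTensor A w) * algebraMap K A c := by
      intro w z c hz
      induction w using TensorProduct.induction_on with
      | zero => simp
      | tmul x y =>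
        rw [key1, hz, mul_assoc, Algebra.commutes]; simp [mul_assoc]
      | add x y hx hy => simp only [add_mul, map_add, hx, hy]
    ext x
    have hx : x ∈ Algebra.adjoin K s := hs ▸ Algebra.mem_top
    simp only [LinearMap.comp_apply, AlgHom.toLinearMap_apply, Algebra.linearMap_apply]
    induction hx using Algebra.adjoin_induction with
    | mem x hx =>
      simp only [hΔ x hx, hε x hx, map_add, LinearMap.lTensor_tmul, LinearMap.mul'_apply, hT1]
      simp [hT, hS x hx]
    | algebraMap r =>
      simp [Algebra.TensorProduct.algebraMap_apply, hT]
    | add x y _ _ hx hy => simp only [map_add, hx, hy]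
    | mul x y _ _ hx hy => rw [map_mul, key _ _ _ hy, hx, map_mul, map_mul]

/-! ### The universal enveloping algebra as a Hopf algebra -/

section UEA
variable (K L : Type*) [CommRing K] [LieRing L] [LieAlgebra K L]

attribute [local instance 100] LieRing.ofAssociativeRing

/-- The comultiplication of `U(L)`: elements of `L` are primitive. -/
def ueaComul : UniversalEnvelopingAlgebra K L →ₐ[K]
    UniversalEnvelopingAlgebra K L ⊗[K] UniversalEnvelopingAlgebra K L :=
  UniversalEnvelopingAlgebra.lift K
    { toFun := fun x => UniversalEnvelopingAlgebra.ι K x ⊗ₜ 1 + 1 ⊗ₜ UniversalEnvelopingAlgebra.ι K x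
      map_add' := fun x y => by
        simp only [map_add, TensorProduct.add_tmul, TensorProduct.tmul_add]; abel
      map_smul' := fun c x => by
        simp [TensorProduct.smul_tmul']
      map_lie' := fun {x y} => by
        simp only [LieHom.map_lie, LieRing.of_associative_ring_bracket, add_mul, mul_add,
          Algebra.TensorProduct.tmul_mul_tmul, mul_one, one_mul, TensorProduct.sub_tmul,
          TensorProduct.tmul_sub]
        abel }

/-- The counit of `U(L)`: it vanishes on `L`. -/
def ueaCounit : UniversalEnvelopingAlgebra K L →ₐ[K] K :=
  UniversalEnvelopingAlgebra.lift K (0 : L →ₗ⁅K⁆ K)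

/-- The antipode of `U(L)`, as a homomorphism to the opposite algebra: `x ↦ -x` on `L`. -/
def ueaAntipode : UniversalEnvelopingAlgebra K L →ₐ[K] (UniversalEnvelopingAlgebra K L)ᵐᵒᵖ :=
  UniversalEnvelopingAlgebra.lift K
    { toFun := fun x => MulOpposite.op (-UniversalEnvelopingAlgebra.ι K x)
      map_add' := fun x y => by
        rw [← MulOpposite.op_add, map_add, neg_add]
      map_smul' := fun c x => by
        rw [map_smul, ← smul_neg, MulOpposite.op_smul]; rfl
      map_lie' := fun {x y} => by
        simp only [LieHom.map_lie, LieRing.of_associative_ring_bracket, ← MulOpposite.op_mul,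
          ← MulOpposite.op_sub]
        congr 1
        noncomm_ring }

/-- The canonical map `L → U(L)`, as a linear map. -/
def ueaIota : L →ₗ[K] UniversalEnvelopingAlgebra K L := (UniversalEnvelopingAlgebra.ι K (L := L) :)

theorem uea_adjoin_range_ι :
    Algebra.adjoin K (Set.range (UniversalEnvelopingAlgebra.ι K (L := L))) = ⊤ := by
  let B := Algebra.adjoin K (Set.range (UniversalEnvelopingAlgebra.ι K (L := L)))
  let f : UniversalEnvelopingAlgebra K L →ₐ[K] B := UniversalEnvelopingAlgebra.lift K
    { toFun := fun x => ⟨UniversalEnvelopingAlgebra.ι K x, Algebra.subset_adjoin ⟨x, rfl⟩⟩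
      map_add' := fun x y => by ext; simp
      map_smul' := fun c x => by ext; simp
      map_lie' := fun {x y} => by
        ext; simp [LieRing.of_associative_ring_bracket] }
  have hf : B.val.comp f = .id K _ := by
    ext x
    simp [f]
  refine Algebra.eq_top_iff.2 fun x => ?_
  have := DFunLike.congr_fun hf x
  rw [← AlgHom.id_apply (R := K) x, ← this]
  exact (f x).2

/-- The standard Hopf algebra structure on the universal enveloping algebra. -/
instance ueaHopfAlgebra : HopfAlgebra K (UniversalEnvelopingAlgebra K L) :=
  (HopfStructure.ofPrimitive (ueaComul K L) (ueaCounit K L) (ueaAntipode K L)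
    (Set.range (UniversalEnvelopingAlgebra.ι K)) (uea_adjoin_range_ι K L)
    (by rintro _ ⟨x, rfl⟩; simp [ueaComul])
    (by rintro _ ⟨x, rfl⟩; simp [ueaCounit])
    (by rintro _ ⟨x, rfl⟩; simp [ueaAntipode])).toHopfAlgebra

end UEA

/-! ### Finite tensor powers of the universal enveloping algebra -/

section TensorPower
open PiTensorProduct

/-- The algebra map `x₀ ⊗ ⋯ ⊗ xₖ₋₁ ↦ f₀ x₀ * ⋯ * fₖ₋₁ xₖ₋₁` for pairwise commuting algebra maps. -/
def piLift {K U B : Type*} [CommRing K] [Ring U] [Algebra K U] [Ring B] [Algebra K B] {k : ℕ}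
    (f : Fin k → U →ₐ[K] B) (hf : ∀ i j, i ≠ j → ∀ x y, Commute (f i x) (f j y)) :
    (⨂[K] _ : Fin k, U) →ₐ[K] B :=
  liftAlgHom ((MultilinearMap.mkPiAlgebraFin K k B).compLinearMap fun i => (f i).toLinearMap)
    (by simp [List.ofFn_const])
    (by
      intro x y
      simp only [MultilinearMap.compLinearMap_apply, MultilinearMap.mkPiAlgebraFin_apply,
        AlgHom.toLinearMap_apply, Pi.mul_apply, map_mul]
      induction k with
      | zero => simp
      | succ k ih =>
        have ih' := ih (fun i => f i.succ) (fun i j hij => hf _ _ (by simpa using hij))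
          (fun i => x i.succ) (fun i => y i.succ)
        simp only [List.ofFn_succ, List.prod_cons, ih']
        have hc : Commute (f 0 (y 0)) (List.ofFn fun i : Fin k => f i.succ (x i.succ)).prod := by
          refine Commute.list_prod_right _ _ fun z hz => ?_
          obtain ⟨i, rfl⟩ := (List.mem_ofFn' _ _).1 hz
          exact hf _ _ (Fin.succ_ne_zero i).symm _ _
        simp only [mul_assoc]
        rw [← mul_assoc (f 0 (y 0)), hc.eq, mul_assoc])

theorem piLift_single {K U B : Type*} [CommRing K] [Ring U] [Algebra K U] [Ring B] [Algebra K B]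
    {k : ℕ} (f : Fin k → U →ₐ[K] B) (hf : ∀ i j, i ≠ j → ∀ x y, Commute (f i x) (f j y))
    (i : Fin k) (u : U) : piLift f hf (singleAlgHom i u) = f i u := by
  have h : piLift f hf (singleAlgHom i u)
      = (List.ofFn fun j => f j (Pi.mulSingle (M := fun _ => U) i u j)).prod := by
    simp [piLift]
  rw [h]
  have : (fun j => f j (Pi.mulSingle (M := fun _ => U) i u j))
      = Pi.mulSingle (M := fun _ => B) i (f i u) := by
    ext j
    by_cases hj : j = i
    · subst hj; simp
    · simp [Pi.mulSingle_eq_of_ne hj]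
  rw [this]
  rw [List.ofFn_eq_map, List.prod_map_eq_pow_single i _
    (fun j hj _ => Pi.mulSingle_eq_of_ne (M := fun _ => B) hj _),
    List.count_eq_one_of_mem (List.nodup_finRange k) (List.mem_finRange i)]
  simp

theorem commute_singleAlgHom {κ K U : Type*} [DecidableEq κ] [CommRing K] [Ring U] [Algebra K U]
    {i j : κ} (hij : i ≠ j) (x y : U) :
    Commute (singleAlgHom (R := K) (A := fun _ : κ => U) i x)
      (singleAlgHom (R := K) (A := fun _ : κ => U) j y) :=
  Commute.tprod (Pi.mulSingle_commute (f := fun _ : κ => U) hij x y)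

variable (K L : Type*) [CommRing K] [LieRing L] [LieAlgebra K L]

/-- The `k`-fold tensor power of `U(L)`. -/
abbrev UEATensorPower (k : ℕ) : Type _ := ⨂[K] _ : Fin k, UniversalEnvelopingAlgebra K L

variable {K L}

/-- `1 ⊗ ⋯ ⊗ u ⊗ ⋯ ⊗ 1`, with `u` in position `i`. -/
abbrev ueaSingle {k : ℕ} (i : Fin k) :
    UniversalEnvelopingAlgebra K L →ₐ[K] UEATensorPower K L k :=
  singleAlgHom (R := K) (A := fun _ : Fin k => UniversalEnvelopingAlgebra K L) i

variable (K L)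

/-- The comultiplication of the tensor power: on each tensor factor that of `U(L)`. -/
def tensorPowerComul (k : ℕ) :
    UEATensorPower K L k →ₐ[K] UEATensorPower K L k ⊗[K] UEATensorPower K L k :=
  piLift (fun i => (Algebra.TensorProduct.map (ueaSingle i) (ueaSingle i)).comp (ueaComul K L))
    (by
      intro i j hij x y
      simp only [AlgHom.comp_apply]
      induction ueaComul K L x using TensorProduct.induction_on with
      | zero => simp
      | add a b ha hb => rw [map_add]; exact ha.add_left hb
      | tmul a b =>
        induction ueaComul K L y using TensorProduct.induction_on with
        | zero => simp
        | add c d hc hd => rw [map_add]; exact hc.add_right hd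
        | tmul c d =>
          simp only [Algebra.TensorProduct.map_tmul, Commute, SemiconjBy,
            Algebra.TensorProduct.tmul_mul_tmul]
          rw [(commute_singleAlgHom hij a c).eq, (commute_singleAlgHom hij b d).eq])

/-- The counit of the tensor power. -/
def tensorPowerCounit (k : ℕ) : UEATensorPower K L k →ₐ[K] K :=
  piLift (fun _ => ueaCounit K L) (fun _ _ _ _ _ => Commute.all _ _)

/-- The antipode of the tensor power, as a homomorphism to the opposite algebra. -/
def tensorPowerAntipode (k : ℕ) : UEATensorPower K L k →ₐ[K] (UEATensorPower K L k)ᵐᵒᵖ :=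
  piLift (fun i => (AlgHom.op (ueaSingle i)).comp (ueaAntipode K L))
    (by
      intro i j hij x y
      simp only [AlgHom.comp_apply, AlgHom.op_apply_apply]
      exact (commute_singleAlgHom hij _ _).op)

theorem tensorPower_adjoin (k : ℕ) :
    Algebra.adjoin K (Set.range fun p : Fin k × L =>
      ueaSingle p.1 (UniversalEnvelopingAlgebra.ι K p.2)) = ⊤ := by
  set s := Set.range fun p : Fin k × L => ueaSingle p.1 (UniversalEnvelopingAlgebra.ι K p.2)
  have hmem : ∀ (i : Fin k) u, ueaSingle i u ∈ Algebra.adjoin K s := by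
    intro i u
    have hu : u ∈ Algebra.adjoin K (Set.range (UniversalEnvelopingAlgebra.ι K (L := L))) :=
      uea_adjoin_range_ι K L ▸ Algebra.mem_top
    have h := (Subalgebra.mem_map (f := ueaSingle i)).2 ⟨u, hu, rfl⟩
    rw [AlgHom.map_adjoin] at h
    refine Algebra.adjoin_mono ?_ h
    rintro _ ⟨_, ⟨x, rfl⟩, rfl⟩
    exact ⟨(i, x), rfl⟩
  let f : UEATensorPower K L k →ₐ[K] Algebra.adjoin K s :=
    piLift (fun i => (ueaSingle i).codRestrict _ (hmem i))
      (fun i j hij x y => Subtype.ext (commute_singleAlgHom hij x y).eq)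
  have hf : (Algebra.adjoin K s).val.comp f = AlgHom.id K (UEATensorPower K L k) := by
    refine algHom_ext (R := K) fun i => AlgHom.ext fun u => ?_
    simp only [AlgHom.comp_apply, f]
    erw [piLift_single]
    rfl
  refine Algebra.eq_top_iff.2 fun x => ?_
  have := DFunLike.congr_fun hf x
  rw [← AlgHom.id_apply (R := K) x, ← this]
  exact (f x).2

/-- The tensor product Hopf algebra structure on the `k`-fold tensor power of `U(L)`. -/
instance tensorPowerHopfAlgebra (k : ℕ) : HopfAlgebra K (UEATensorPower K L k) :=
  (HopfStructure.ofPrimitive (tensorPowerComul K L k) (tensorPowerCounit K L k)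
    (tensorPowerAntipode K L k) _ (tensorPower_adjoin K L k)
    (by
      rintro _ ⟨⟨i, x⟩, rfl⟩
      simp only [tensorPowerComul]
      erw [piLift_single]
      simp [ueaComul, -singleAlgHom_apply])
    (by
      rintro _ ⟨⟨i, x⟩, rfl⟩
      simp only [tensorPowerCounit]
      erw [piLift_single]
      simp [ueaCounit])
    (by
      rintro _ ⟨⟨i, x⟩, rfl⟩
      simp only [tensorPowerAntipode]
      erw [piLift_single]
      simp [ueaAntipode, -singleAlgHom_apply])).toHopfAlgebra

end TensorPower

/-! ### The rational algebra `𝒢_∞^ℚ(R)` -/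

section Rational
variable (R : Type*) [Ring R]

/-- The associative `ℚ`-algebra `ℚ ⊗_ℤ R`. -/
def RatExt : Type _ := ℚ ⊗[ℤ] R

instance : Ring (RatExt R) := inferInstanceAs (Ring (ℚ ⊗[ℤ] R))

instance : Algebra ℚ (RatExt R) := inferInstanceAs (Algebra ℚ (ℚ ⊗[ℤ] R))

/-- `ℚ ⊗_ℤ R` is regarded as a Lie algebra through the commutator `[x, y] = x y - y x`. -/
instance : LieRing (RatExt R) := LieRing.ofAssociativeRing

instance : LieAlgebra ℚ (RatExt R) := LieAlgebra.ofAssociativeAlgebra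

/-- The canonical map `R → ℚ ⊗_ℤ R`, `r ↦ 1 ⊗ r`. -/
def ratExtOf : R →+* RatExt R :=
  (Algebra.TensorProduct.includeRight : R →ₐ[ℤ] ℚ ⊗[ℤ] R).toRingHom

/-- The universal enveloping algebra `U(ℚ ⊗_ℤ R)`. -/
abbrev UQ : Type _ := UniversalEnvelopingAlgebra ℚ (RatExt R)

/-- The infinite tensor product `⨂_{l ≥ 1} U(ℚ ⊗ R)`. Mathlib's tensor product over an infinite index
set contains all pure tensors `a₁ ⊗ a₂ ⊗ ⋯`; the infinite tensor product of algebras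
consists of the span of those with `a_l = 1` for all but finitely many `l`, that is, of the
subalgebra generated by the images of the individual tensor factors. -/
def GInfQ : Subalgebra ℚ (⨂[ℚ] _ : ℕ+, UQ R) :=
  ⨆ l : ℕ+, (PiTensorProduct.singleAlgHom (R := ℚ) (A := fun _ : ℕ+ => UQ R) l).range

/-- The inclusion of the `l`-th tensor factor. -/
def factor (l : ℕ+) : UQ R →ₐ[ℚ] GInfQ R :=
  (PiTensorProduct.singleAlgHom (R := ℚ) (A := fun _ : ℕ+ => UQ R) l).codRestrict (GInfQ R)
    (fun u => le_iSup
      (fun l : ℕ+ => (PiTensorProduct.singleAlgHom (R := ℚ) (A := fun _ : ℕ+ => UQ R) l).range)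
      l ⟨u, rfl⟩)

/-- `T_l(r)`: the element `r` of `ℚ ⊗ R` in the `l`-th copy of its enveloping algebra. -/
def tElem (l : ℕ+) : RatExt R →ₗ[ℚ] GInfQ R :=
  (factor R l).toLinearMap ∘ₗ ueaIota ℚ (RatExt R)

/-- The inclusion of the `k`-fold tensor power of `U(ℚ ⊗ R)` into the infinite tensor product, as
the tensor factors with numbers `1, …, k`. -/
def firstFactors (k : ℕ) : UEATensorPower ℚ (RatExt R) k →ₐ[ℚ] GInfQ R :=
  piLift (fun i => factor R (i : ℕ).succPNat)
    (by
      intro i j hij x y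
      have h : (i : ℕ).succPNat ≠ (j : ℕ).succPNat :=
        fun h => hij (Fin.ext (Nat.succPNat_injective h))
      exact Subtype.ext (commute_singleAlgHom h x y).eq)

end Rational

/-! ### The generating functions `E_U(t)` -/

section Series
open PowerSeries

variable {A : Type*} [Ring A] [Algebra ℚ A]

/-- `log f = ∑_{m ≥ 1} (-1)^{m+1} (f - 1)^m / m` for a power series `f` with constant term `1`; the terms
with `m > n` do not contribute to the coefficient of `t^n`. -/
def logSeries (f : A⟦X⟧) : A⟦X⟧ :=
  mk fun n => ∑ m ∈ Finset.Icc 1 n, ((-1) ^ (m + 1) / m : ℚ) • coeff n ((f - 1) ^ m)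

/-- `exp f = ∑_{m ≥ 0} f^m / m!` for a power series `f` with constant term `0`; the terms with `m > n`
do not contribute to the coefficient of `t^n`. -/
def expSeries (f : A⟦X⟧) : A⟦X⟧ :=
  mk fun n => ∑ m ∈ Finset.range (n + 1), ((m.factorial : ℚ)⁻¹) • coeff n (f ^ m)

variable {R : Type*} [Ring R]

/-- `Θ_l(f) = exp(T_l(log f))` for a power series `f` over `ℚ ⊗ R` with constant term `1`, where `T_l` is
applied to each coefficient. -/
def theta (l : ℕ+) (f : (RatExt R)⟦X⟧) : (GInfQ R)⟦X⟧ :=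
  expSeries (mk fun n => tElem R l (coeff n (logSeries f)))

/-- `e_n(U)`, the coefficient of `t^n` in `E_U(t) = ∏_{l ≥ 1} Θ_l(1 - (-t)^l U)`. The `l`-th factor is
`1` modulo `t^l`, so only the factors with `l ≤ n` contribute. -/
def eElem (n : ℕ) (U : R) : GInfQ R :=
  coeff n ((List.range n).map fun i =>
    theta i.succPNat (1 - (-X) ^ (i + 1) * C (ratExtOf R U))).prod

/-- `𝒢_k^ℤ(R)`: the `ℤ`-subalgebra generated by the `e_i(U)` with `i ≤ k` and `U ∈ R`. For `k = ⊤`, where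
all the `e_i(U)` are generators, this is `𝒢_∞^ℤ(R)`. -/
def GZ (R : Type*) [Ring R] (k : ℕ∞) : Subalgebra ℤ (GInfQ R) :=
  Algebra.adjoin ℤ {x | ∃ (i : ℕ) (U : R), (i : ℕ∞) ≤ k ∧ x = eElem i U}

theorem eElem_mem {k : ℕ∞} {i : ℕ} (hi : (i : ℕ∞) ≤ k) (U : R) : eElem i U ∈ GZ R k :=
  Algebra.subset_adjoin ⟨i, U, hi, rfl⟩

theorem GZ_mono {k k' : ℕ∞} (h : k ≤ k') : GZ R k ≤ GZ R k' :=
  Algebra.adjoin_mono fun _ ⟨i, U, hi, hx⟩ => ⟨i, U, hi.trans h, hx⟩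

/-- `e_i(U)` as an element of `𝒢_k^ℤ(R)`, for `i ≤ k`. -/
def eZ (k : ℕ∞) (i : ℕ) (hi : (i : ℕ∞) ≤ k) (U : R) : GZ R k := ⟨eElem i U, eElem_mem hi U⟩

end Series

/-! ### The Hopf algebra structures and integral forms -/

section Main
variable {R : Type*} [Ring R]

/-- `E_U(t)` as a power series over `𝒢_∞^ℤ(R)`. -/
def EZ (U : R) : (GZ R ⊤)⟦X⟧ := PowerSeries.mk fun n => eZ ⊤ n le_top U

/-- The Hopf algebra structure of `𝒢_∞^ℤ(R)`: for all `U ∈ R`, `Δ(E_U(t)) = E_U(t) ⊗ E_U(t)`,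
`ε(E_U(t)) = 1` and `S(E_U(t)) = E_U(t)⁻¹`, coefficient by coefficient. -/
def IsGrouplikeHopf (H : HopfStructure ℤ (GZ R ⊤)) : Prop :=
  ∀ U : R,
    (∀ n, H.comul (eZ ⊤ n le_top U) =
      ∑ p ∈ Finset.HasAntidiagonal.antidiagonal n, eZ ⊤ p.1 le_top U ⊗ₜ[ℤ] eZ ⊤ p.2 le_top U) ∧
    (∀ n, H.counit (eZ ⊤ n le_top U) = if n = 0 then 1 else 0) ∧
    (PowerSeries.mk fun n => H.antipode (eZ ⊤ n le_top U)) * EZ U = 1 ∧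
    EZ U * (PowerSeries.mk fun n => H.antipode (eZ ⊤ n le_top U)) = 1

/-- `Hk` makes `𝒢_k^ℤ(R)` a Hopf subalgebra of `𝒢_∞^ℤ(R)` with the Hopf structure `H`. -/
def IsSubHopf (H : HopfStructure ℤ (GZ R ⊤)) {k : ℕ∞} (Hk : HopfStructure ℤ (GZ R k)) : Prop :=
  let i : GZ R k →ₐ[ℤ] GZ R ⊤ := Subalgebra.inclusion (GZ_mono le_top)
  H.comul.comp i = (Algebra.TensorProduct.map i i).comp Hk.comul ∧
  H.counit.comp i = Hk.counit ∧
  H.antipode ∘ₗ i.toLinearMap = i.toLinearMap ∘ₗ Hk.antipode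

/-- `𝒢_k^ℤ(R)`, with the Hopf structure `Hk`, is an integral form of the Hopf algebra `A`, which is mapped
to `𝒢_∞^ℚ(R)` by `j`: it is a free `ℤ`-module, and extending scalars to `ℚ` gives an isomorphism of
Hopf algebras with `A` that is compatible with the maps to `𝒢_∞^ℚ(R)`. -/
def IsHopfIntegralForm {k : ℕ∞} (Hk : HopfStructure ℤ (GZ R k)) {A : Type*} [Ring A]
    [HopfAlgebra ℚ A] (j : A →ₐ[ℚ] GInfQ R) : Prop :=
  letI := Hk.toHopfAlgebra
  Module.Free ℤ (GZ R k) ∧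
  ∃ Φ : (ℚ ⊗[ℤ] GZ R k) ≃ₐc[ℚ] A,
    (∀ x, Φ (HopfAlgebra.antipode ℚ x) = HopfAlgebra.antipode ℚ (Φ x)) ∧
    ∀ (q : ℚ) (x : GZ R k), j (Φ (q ⊗ₜ x)) = q • (x : GInfQ R)

/-- The PBW monomial `∏ b_i^{n_i}` in `U(ℚ ⊗ R)`, with increasing index `i` from left to right. -/
def pbwMonomial {ι : Type*} [LinearOrder ι] (b : Module.Basis ι ℤ R) (n : ι →₀ ℕ) : UQ R :=
  ((n.support.sort (· ≤ ·)).map fun i =>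
    ueaIota ℚ (RatExt R) (ratExtOf R (b i)) ^ n i).prod

end Main

end

/-! The series E_U(t) are grouplike, and grouplike series over 𝒢_∞^ℚ(R) are rigid. Each T_l(a) is
primitive, and Θ_l(1 - t^l v) is the solution with constant term 1 of a linear differential equation
for t d/dt. Uniqueness of solutions shows that E_U(t) is grouplike. It also shows that evaluating
the l-th tensor factor in ℚ ⊗ R, while augmenting all others, turns E_U(-t) into 1 - t^l U. Two
grouplike series that agree in lower order differ in the next order by a primitive element, and in
characteristic zero a primitive element is determined by these evaluations (`eq_zero_of_gComul`).
Hence an identity between products of factors 1 - t^α W over R, in several variables and up to any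
finite order, lifts to the same identity between products of the series E_W(-t^α)
(`exists_rayProd`).

Two identities then give all the relations that are needed. The product (1 - tU)(1 - tV) is 1 - t(U
+ V) times factors of order at least 2 in t, and (1 - sU)(1 - tV) is (1 - tV)(1 - sU) times factors
1 - s^i t^j W with i, j ≥ 1. Give e_n the weight n^2. A sum of squares of positive numbers is
smaller than the square of their sum, so the lifted identities say that e_n is additive modulo lower
weight (`sElem_add_mem`) and that e_m(U) and e_n(V) commute modulo lower weight
(`sElem_commutator_mem`). Hence the ordered monomials in the e_l(b_i), l ≤ k, span 𝒢_k^ℤ(R).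

These monomials are independent even over ℚ. Indeed e_n(U) is ± T_n(U) plus terms of lower weight,
so they are triangular over the ordered monomials in the T_l(b_i). The latter are independent by
`linearIndependent_orderedMonomial`, which plays the role of the PBW theorem: contracting the
comultiplication with a dual linear form acts on leading terms like a partial derivative. For k = 1
one has e_1(U) = T_1(U), and the basis consists of PBW monomials.

For R of finite rank the associated graded ring of the weight filtration is a quotient of a
polynomial ring over ℤ in finitely many variables, which gives noetherianity
(`isNoetherianRing_of_filtration`). The Hopf structures are restricted from 𝒢_∞^ℚ(R): the integral
subalgebras are stable under the structure maps, and by flatness their tensor squares embed in the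
rational one (`ratSquare_injective`). Over ℚ the e_l and the T_l with l ≤ k generate the same
algebra (`adjoin_tGen`), which is the image of the first k tensor factors. -/

noncomputable section

/-! ### Weight filtrations by words, and spanning by ordered monomials -/

section WordFiltration

variable {K H X : Type*} [CommRing K] [Ring H] [Algebra K H]

/-- The span of the products of generators `g x` of total weight less than `d`. -/
def wordFil (K : Type*) {H X : Type*} [CommRing K] [Ring H] [Algebra K H] (g : X → H) (w : X → ℕ)
    (d : ℕ) : Submodule K H :=
  Submodule.span K {y | ∃ L : List X, (L.map w).sum < d ∧ y = (L.map g).prod}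

theorem list_prod_mem_wordFil {g : X → H} {w : X → ℕ} {d : ℕ} (L : List X)
    (h : (L.map w).sum < d) : (L.map g).prod ∈ wordFil K g w d :=
  Submodule.subset_span ⟨L, h, rfl⟩

theorem mem_wordFil {g : X → H} {w : X → ℕ} {d : ℕ} (x : X) (h : w x < d) :
    g x ∈ wordFil K g w d := by
  simpa using list_prod_mem_wordFil (K := K) (g := g) (w := w) [x] (by simpa using h)

theorem one_mem_wordFil {g : X → H} {w : X → ℕ} {d : ℕ} (h : 0 < d) :
    (1 : H) ∈ wordFil K g w d := by
  simpa using list_prod_mem_wordFil (K := K) (g := g) (w := w) [] (by simpa using h)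

theorem wordFil_mono {g : X → H} {w : X → ℕ} {d e : ℕ} (h : d ≤ e) :
    wordFil K g w d ≤ wordFil K g w e :=
  Submodule.span_mono fun _ ⟨L, hL, hy⟩ => ⟨L, hL.trans_le h, hy⟩

theorem wordFil_zero {g : X → H} {w : X → ℕ} : wordFil K g w 0 = ⊥ := by
  rw [wordFil, Submodule.span_eq_bot]
  rintro x ⟨L, hL, -⟩
  exact absurd hL (Nat.not_lt_zero _)

/-- The index bounds weights strictly: factors of weight at most d - 1 and e - 1 have a product of
weight at most d + e - 2, so the index d + e - 1 suffices. This gain of one is what makes the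
associated graded ring commutative. -/
theorem mul_mem_wordFil {g : X → H} {w : X → ℕ} {d e f : ℕ} (h : d + e ≤ f + 1) {a b : H}
    (ha : a ∈ wordFil K g w d) (hb : b ∈ wordFil K g w e) : a * b ∈ wordFil K g w f := by
  have : wordFil K g w d * wordFil K g w e ≤ wordFil K g w f := by
    rw [wordFil, wordFil, Submodule.span_mul_span, Submodule.span_le]
    rintro _ ⟨_, ⟨L, hL, rfl⟩, _, ⟨M, hM, rfl⟩, rfl⟩
    exact Submodule.subset_span ⟨L ++ M, by simp; omega, by simp⟩
  exact this (Submodule.mul_mem_mul ha hb)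

theorem iUnion_wordFil_mul {g : X → H} {w : X → ℕ} {a b : H}
    (ha : ∃ d, a ∈ wordFil K g w d) (hb : ∃ d, b ∈ wordFil K g w d) :
    ∃ d, a * b ∈ wordFil K g w d :=
  let ⟨d, hd⟩ := ha
  let ⟨e, he⟩ := hb
  ⟨d + e, mul_mem_wordFil (by omega) hd he⟩

theorem exists_mem_wordFil {g : X → H} {w : X → ℕ} {x : H}
    (hx : x ∈ Algebra.adjoin K (Set.range g)) : ∃ d, x ∈ wordFil K g w d := by
  induction hx using Algebra.adjoin_induction with
  | mem x hx =>
    obtain ⟨y, rfl⟩ := hx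
    exact ⟨w y + 1, mem_wordFil y (Nat.lt_succ_self _)⟩
  | algebraMap r =>
    rw [Algebra.algebraMap_eq_smul_one]
    exact ⟨1, Submodule.smul_mem _ _ (one_mem_wordFil one_pos)⟩
  | add x y _ _ hx hy =>
    obtain ⟨d, hd⟩ := hx
    obtain ⟨e, he⟩ := hy
    exact ⟨max d e, add_mem (wordFil_mono (le_max_left _ _) hd) (wordFil_mono (le_max_right _ _) he)⟩
  | mul x y _ _ hx hy => exact iUnion_wordFil_mul hx hy

/-- A permutation is a composite of adjacent transpositions, and each of them costs one commutator,
which lowers the total weight. -/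
theorem list_prod_sub_mem_wordFil_of_perm {g : X → H} {w : X → ℕ}
    (hcomm : ∀ x y, g x * g y - g y * g x ∈ wordFil K g w (w x + w y)) {L M : List X}
    (h : L.Perm M) : (L.map g).prod - (M.map g).prod ∈ wordFil K g w (L.map w).sum := by
  induction h with
  | nil => simp
  | @cons x L M h ih =>
    simp only [List.map_cons, List.prod_cons, List.sum_cons, ← mul_sub]
    exact mul_mem_wordFil (by omega) (mem_wordFil x (Nat.lt_succ_self _)) ih
  | swap x y L =>
    simp only [List.map_cons, List.prod_cons, List.sum_cons, ← mul_assoc, ← sub_mul]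
    exact mul_mem_wordFil (by omega) (hcomm y x) (list_prod_mem_wordFil L (Nat.lt_succ_self _))
  | @trans L M N h _ h1 h2 =>
    rw [← sub_add_sub_cancel]
    refine add_mem h1 ?_
    rwa [(h.map w).sum_eq]

/-- The product of the `x i`, for `i` in a multiset, in increasing order. -/
def orderedMonomial {I : Type*} [LinearOrder I] (x : I → H) (s : Multiset I) : H :=
  ((s.sort (· ≤ ·)).map x).prod

theorem orderedMonomial_coe {I : Type*} [LinearOrder I] (x : I → H) {L : List I}
    (hL : L.Pairwise (· ≤ ·)) : orderedMonomial x (L : Multiset I) = (L.map x).prod := by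
  rw [orderedMonomial]
  congr 2
  refine List.Perm.eq_of_pairwise' (Multiset.pairwise_sort _ _) hL ?_
  rw [← Multiset.coe_eq_coe, Multiset.sort_eq]

theorem orderedMonomial_zero {I : Type*} [LinearOrder I] (x : I → H) :
    orderedMonomial x 0 = 1 := by
  simp [orderedMonomial]

theorem sort_weight {I : Type*} [LinearOrder I] (w : I → ℕ) (s : Multiset I) :
    ((s.sort (· ≤ ·)).map w).sum = (s.map w).sum := by
  conv_rhs => rw [← Multiset.sort_eq s (· ≤ ·)]
  rw [Multiset.map_coe, Multiset.sum_coe]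

/-- Expand each letter into its leading part and an error of lower weight. The product of the
leading parts consists of words in the chosen generators of exactly the same weight, and any term
with an error factor drops in weight. -/
theorem list_prod_mem_span_sup {I : Type*} {g : X → H} {w : X → ℕ} (ξ : I → X)
    (hspan : ∀ y, g y ∈ Submodule.span K (g '' {z | ∃ i, z = ξ i ∧ w z = w y}) ⊔ wordFil K g w (w y))
    (L : List X) : (L.map g).prod ∈
      Submodule.span K {z | ∃ M : List I, (M.map (w ∘ ξ)).sum = (L.map w).sum ∧
        z = (M.map (g ∘ ξ)).prod} ⊔ wordFil K g w (L.map w).sum := by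
  induction L with
  | nil =>
    refine Submodule.mem_sup_left (Submodule.subset_span ⟨[], by simp, by simp⟩)
  | cons y L ih =>
    obtain ⟨a, ha, a', ha', h1⟩ := Submodule.mem_sup.1 (hspan y)
    obtain ⟨b, hb, b', hb', h2⟩ := Submodule.mem_sup.1 ih
    have hb2 : b ∈ wordFil K g w ((L.map w).sum + 1) := by
      refine (Submodule.span_le.2 ?_ : _ ≤ wordFil K g w ((L.map w).sum + 1)) hb
      rintro _ ⟨M, hM, rfl⟩
      rw [← List.map_map]
      exact list_prod_mem_wordFil _ (by rw [List.map_map, hM]; omega)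
    have hy : g y ∈ wordFil K g w (w y + 1) := mem_wordFil y (Nat.lt_succ_self _)
    simp only [List.map_cons, List.prod_cons, List.sum_cons]
    have e : g y * (L.map g).prod = a * b + (a' * b + g y * b') := by
      rw [← h1, ← h2]; noncomm_ring
    rw [e]
    refine Submodule.add_mem_sup ?_ (add_mem (mul_mem_wordFil (by omega) ha' hb2)
      (mul_mem_wordFil (by omega) hy hb'))
    have := Submodule.mul_mem_mul ha hb
    rw [Submodule.span_mul_span] at this
    refine Submodule.span_mono ?_ this
    rintro _ ⟨_, ⟨_, ⟨i, rfl, hi⟩, rfl⟩, _, ⟨M, hM, rfl⟩, rfl⟩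
    refine ⟨i :: M, ?_, by simp⟩
    simp only [List.map_cons, List.sum_cons, hM, Function.comp_apply, hi]

/-- If the generators commute and are combinations of the `g (ξ i)` up to terms of lower weight, then
the ordered monomials in the `g (ξ i)` span the filtration. -/
theorem wordFil_le_span_orderedMonomial {I : Type*} [LinearOrder I] {g : X → H} {w : X → ℕ}
    (ξ : I → X)
    (hcomm : ∀ x y, g x * g y - g y * g x ∈ wordFil K g w (w x + w y))
    (hspan : ∀ y, g y ∈ Submodule.span K (g '' {z | ∃ i, z = ξ i ∧ w z = w y}) ⊔ wordFil K g w (w y))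
    (d : ℕ) : wordFil K g w d ≤ Submodule.span K
      (orderedMonomial (g ∘ ξ) '' {s | (s.map (w ∘ ξ)).sum < d}) := by
  induction d with
  | zero => simp [wordFil_zero]
  | succ d ih =>
    have ih' := ih.trans (Submodule.span_mono (Set.image_mono
      (fun s (hs : (s.map (w ∘ ξ)).sum < d) => hs.trans (Nat.lt_succ_self d))))
    refine Submodule.span_le.2 ?_
    rintro _ ⟨L, hL, rfl⟩
    rcases Nat.lt_succ_iff_lt_or_eq.1 hL with hL | rfl
    · exact ih' (list_prod_mem_wordFil L hL)
    refine (sup_le (Submodule.span_le.2 ?_) ih') (list_prod_mem_span_sup ξ hspan L)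
    rintro _ ⟨M, hM, rfl⟩
    -- Sorting the word changes it only by terms of lower weight, which the induction hypothesis
    -- covers.
    have hp : ((M : Multiset I).sort (· ≤ ·)).Perm M := by
      rw [← Multiset.coe_eq_coe, Multiset.sort_eq]
    have h1 := list_prod_sub_mem_wordFil_of_perm (K := K) hcomm (hp.map ξ)
    rw [List.map_map, List.map_map, List.map_map, (hp.map _).sum_eq, hM] at h1
    have h2 : (M.map (g ∘ ξ)).prod = orderedMonomial (g ∘ ξ) (M : Multiset I)
        - ((((M : Multiset I).sort (· ≤ ·)).map (g ∘ ξ)).prod - (M.map (g ∘ ξ)).prod) := by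
      rw [orderedMonomial]; abel
    rw [h2]
    refine sub_mem (Submodule.subset_span ⟨_, ?_, rfl⟩) (ih' h1)
    show (((M : Multiset I)).map (w ∘ ξ)).sum < _
    rw [Multiset.map_coe, Multiset.sum_coe, hM]
    omega

theorem orderedMonomial_mem_wordFil {I : Type*} [LinearOrder I] {g : X → H} {w : X → ℕ}
    (ξ : I → X) (s : Multiset I) {d : ℕ} (h : (s.map (w ∘ ξ)).sum < d) :
    orderedMonomial (g ∘ ξ) s ∈ wordFil K g w d := by
  rw [orderedMonomial, ← List.map_map]
  exact list_prod_mem_wordFil _ (by rw [List.map_map, sort_weight]; exact h)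

end WordFiltration

/-! ### Ordered monomials in primitive elements: independence without PBW -/

section Primitive

variable {K H I : Type*} [Field K] [Ring H] [Algebra K H] [LinearOrder I]

/-- Contraction of the first tensor factor with a linear form. -/
def contractFst (φ : H →ₗ[K] K) : H ⊗[K] H →ₗ[K] H :=
  (TensorProduct.lid K H).toLinearMap ∘ₗ φ.rTensor H

@[simp]
theorem contractFst_tmul (φ : H →ₗ[K] K) (a b : H) : contractFst φ (a ⊗ₜ b) = φ a • b := by
  simp [contractFst]

theorem contractFst_one_tmul_mul (φ : H →ₗ[K] K) (y : H) (z : H ⊗[K] H) :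
    contractFst φ ((1 ⊗ₜ y) * z) = y * contractFst φ z := by
  induction z using TensorProduct.induction_on with
  | zero => simp
  | tmul a b => simp
  | add a b ha hb => simp only [mul_add, map_add, ha, hb]

variable (Δ : H →ₐ[K] H ⊗[K] H) (x : I → H) (φ : I → H →ₗ[K] K)

/-- Expand the product of the x ⊗ 1 + 1 ⊗ x over the letters. Here A collects the terms with a
single letter in the first tensor factor, r those with at least two. Contracting A with φ i counts
the occurrences of i; sortedness ensures that deleting any of them leaves the same word. -/
theorem exists_comul_word (hΔ : ∀ i, Δ (x i) = x i ⊗ₜ 1 + 1 ⊗ₜ x i)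
    (hφ : ∀ i j, φ i (x j) = if i = j then 1 else 0) (L : List I) (hL : L.Pairwise (· ≤ ·)) :
    ∃ A r : H ⊗[K] H, Δ (L.map x).prod = 1 ⊗ₜ (L.map x).prod + A + r ∧
      (A ∈ Submodule.span K {z | ∃ (a : H) (M : List I), M.Sublist L ∧ M.length + 1 ≤ L.length ∧
        z = a ⊗ₜ (M.map x).prod}) ∧
      (r ∈ Submodule.span K {z | ∃ (a : H) (M : List I), M.Sublist L ∧ M.length + 2 ≤ L.length ∧
        z = a ⊗ₜ (M.map x).prod}) ∧
      ∀ i, contractFst (φ i) A = (L.count i : K) • ((L.erase i).map x).prod := by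
  induction L with
  | nil => exact ⟨0, 0, by simp [Algebra.TensorProduct.one_def], zero_mem _, zero_mem _, by simp⟩
  | cons j L ih =>
    rw [List.pairwise_cons] at hL
    obtain ⟨A, r, h1, hA, hr, h2⟩ := ih hL.2
    refine ⟨x j ⊗ₜ (L.map x).prod + (1 ⊗ₜ x j) * A, (x j ⊗ₜ 1) * (A + r) + (1 ⊗ₜ x j) * r,
      ?_, ?_, ?_, ?_⟩
    · simp only [List.map_cons, List.prod_cons, map_mul, h1, hΔ]
      simp only [add_mul, mul_add, Algebra.TensorProduct.tmul_mul_tmul, one_mul, mul_one]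
      abel
    · refine add_mem (Submodule.subset_span ⟨_, L, List.sublist_cons_self _ _, by simp, rfl⟩) ?_
      have := Submodule.mem_map_of_mem (f := LinearMap.mulLeft K ((1 : H) ⊗ₜ[K] x j)) hA
      rw [Submodule.map_span] at this
      refine Submodule.span_mono ?_ this
      rintro _ ⟨_, ⟨a, M, hM, hl, rfl⟩, rfl⟩
      exact ⟨a, j :: M, hM.cons_cons _, by simpa using hl, by simp⟩
    · refine add_mem ?_ ?_
      · have := Submodule.mem_map_of_mem (f := LinearMap.mulLeft K (x j ⊗ₜ[K] (1 : H)))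
          (add_mem hA (Submodule.span_mono (fun z hz => by
            obtain ⟨a, M, hM, hl, rfl⟩ := hz; exact ⟨a, M, hM, by omega, rfl⟩) hr))
        rw [Submodule.map_span] at this
        refine Submodule.span_mono ?_ this
        rintro _ ⟨_, ⟨a, M, hM, hl, rfl⟩, rfl⟩
        exact ⟨x j * a, M, hM.cons _, by simp; omega, by simp⟩
      · have := Submodule.mem_map_of_mem (f := LinearMap.mulLeft K ((1 : H) ⊗ₜ[K] x j)) hr
        rw [Submodule.map_span] at this
        refine Submodule.span_mono ?_ this
        rintro _ ⟨_, ⟨a, M, hM, hl, rfl⟩, rfl⟩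
        exact ⟨a, j :: M, hM.cons_cons _, by simp; omega, by simp⟩
    · intro i
      rw [map_add, contractFst_tmul, contractFst_one_tmul_mul, h2, hφ]
      by_cases hij : i = j
      · subst hij
        simp only [if_true, List.count_cons_self, List.erase_cons_head, one_smul]
        by_cases hi : i ∈ L
        -- In a sorted word with head i, any further i stands directly behind the head, so erasing
        -- it and putting i in front restores L.
        · have : x i * ((L.erase i).map x).prod = (L.map x).prod := by
            cases L with
            | nil => simp at hi
            | cons k L =>
              have hk : k = i := by
                rcases List.mem_cons.1 hi with h | h
                · exact h.symm
                · exact le_antisymm ((List.pairwise_cons.1 hL.2).1 i h) (hL.1 k (by simp))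
              subst hk; simp
          rw [mul_smul_comm, this]
          push_cast
          rw [add_smul, one_smul, add_comm]
        · simp [List.count_eq_zero_of_not_mem hi]
      · simp [hij, Ne.symm hij]

/-- Modulo monomials that are shorter by at least two letters, contraction with φ i acts as the
partial derivative with respect to x i. The term 1 ⊗ m disappears because φ i kills 1. -/
theorem contractFst_comul_orderedMonomial (hΔ : ∀ i, Δ (x i) = x i ⊗ₜ 1 + 1 ⊗ₜ x i)
    (hφ : ∀ i j, φ i (x j) = if i = j then 1 else 0) (hφ1 : ∀ i, φ i 1 = 0) (i : I)
    (s : Multiset I) : contractFst (φ i) (Δ (orderedMonomial x s))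
      - (s.count i : K) • orderedMonomial x (s.erase i) ∈
      Submodule.span K (orderedMonomial x '' {t | Multiset.card t + 2 ≤ Multiset.card s}) := by
  have hs := Multiset.pairwise_sort s (· ≤ ·)
  obtain ⟨A, r, h1, -, hr, h2⟩ := exists_comul_word Δ x φ hΔ hφ _ hs
  have e1 : orderedMonomial x (s.erase i) = (((s.sort (· ≤ ·)).erase i).map x).prod := by
    rw [← orderedMonomial_coe x (hs.sublist List.erase_sublist), ← Multiset.coe_erase,
      Multiset.sort_eq]
  have e2 : s.count i = (s.sort (· ≤ ·)).count i := by
    conv_lhs => rw [← Multiset.sort_eq s (· ≤ ·)]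
    rw [Multiset.coe_count]
  rw [e1, e2, ← h2]
  rw [show orderedMonomial x s = ((s.sort (· ≤ ·)).map x).prod from rfl]
  rw [h1]
  simp only [map_add, contractFst_tmul, hφ1, zero_smul, zero_add, add_sub_cancel_left]
  have := Submodule.mem_map_of_mem (f := contractFst (φ i)) hr
  rw [Submodule.map_span] at this
  refine (Submodule.span_le.2 ?_) this
  rintro _ ⟨_, ⟨a, M, hM, hl, rfl⟩, rfl⟩
  rw [contractFst_tmul]
  refine Submodule.smul_mem _ _ (Submodule.subset_span ⟨(M : Multiset I), ?_, ?_⟩)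
  · simpa using hl
  · exact orderedMonomial_coe x (hs.sublist hM)

/-- The top coefficients of a combination of ordered monomials are determined by the contractions
of its comultiplication. -/
theorem coeff_eq_zero_of_contract [CharZero K] {d : ℕ} (hΔ : ∀ i, Δ (x i) = x i ⊗ₜ 1 + 1 ⊗ₜ x i)
    (hφ : ∀ i j, φ i (x j) = if i = j then 1 else 0) (hφ1 : ∀ i, φ i 1 = 0)
    (ih : ∀ c : Multiset I →₀ K, (∀ s ∈ c.support, Multiset.card s ≤ d) →
      Finsupp.linearCombination K (orderedMonomial x) c = 0 → c = 0)
    (c : Multiset I →₀ K) (hc : ∀ s ∈ c.support, Multiset.card s ≤ d + 1)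
    (h0 : ∀ i, contractFst (φ i) (Δ (Finsupp.linearCombination K (orderedMonomial x) c)) = 0)
    (s : Multiset I) (hs : Multiset.card s = d + 1) : c s = 0 := by
  obtain ⟨i, hi⟩ := Multiset.card_pos_iff_exists_mem.1 (by omega : 0 < Multiset.card s)
  -- This is the formal partial derivative of c. Its value is a combination of monomials of length
  -- below d, so independence up to length d forces its coefficients in length d to vanish.
  let e : Multiset I →₀ K := c.sum fun t a => Finsupp.single (t.erase i) (a * t.count i)
  have he : Finsupp.linearCombination K (orderedMonomial x) e ∈
      Submodule.span K (orderedMonomial x '' {t | Multiset.card t + 1 ≤ d}) := by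
    have : Finsupp.linearCombination K (orderedMonomial x) e =
        - (contractFst (φ i) (Δ (Finsupp.linearCombination K (orderedMonomial x) c))
          - Finsupp.linearCombination K (orderedMonomial x) e) := by
      rw [h0]; simp
    rw [this]
    refine neg_mem ?_
    rw [Finsupp.linearCombination_apply K c]
    simp only [e, Finsupp.sum, map_sum, map_smul, Finsupp.linearCombination_single, mul_smul]
    rw [← Finset.sum_sub_distrib]
    simp only [← smul_sub]
    refine sum_mem fun t ht => Submodule.smul_mem _ _ ?_
    refine Submodule.span_mono (Set.image_mono ?_)
      (contractFst_comul_orderedMonomial Δ x φ hΔ hφ hφ1 i t)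
    intro u hu
    have hu' : Multiset.card u + 2 ≤ Multiset.card t := hu
    have := hc t ht
    show Multiset.card u + 1 ≤ d
    omega
  rw [Finsupp.mem_span_image_iff_linearCombination] at he
  obtain ⟨f, hf, hfe⟩ := he
  have hef : e - f = 0 := by
    refine ih _ (fun t ht => ?_) (by rw [map_sub, hfe, sub_self])
    rcases Finset.mem_union.1 (Finsupp.support_sub ht) with ht | ht
    · have := Finsupp.support_sum ht
      simp only [Finset.mem_biUnion] at this
      obtain ⟨u, hu, hut⟩ := this
      have hue := Finsupp.support_single_subset hut
      rw [Finset.mem_singleton] at hue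
      have hne : u.count i ≠ 0 := by
        intro h
        simp [h] at hut
      have := hc u hu
      have h2 := Multiset.card_erase_add_one (Multiset.count_ne_zero.1 hne)
      rw [hue]; omega
    · have : Multiset.card t + 1 ≤ d := hf ht
      omega
  have h1 : e (s.erase i) = 0 := by
    rw [sub_eq_zero.1 hef]
    by_contra h
    have : Multiset.card (s.erase i) + 1 ≤ d := hf (Finsupp.mem_support_iff.2 h)
    have h2 := Multiset.card_erase_add_one hi
    omega
  -- Removing i is injective on multisets that contain i, and the others enter e with factor 0. So
  -- only s contributes, and its multiplicity is invertible in characteristic zero.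
  have h3 : e (s.erase i) = c s * s.count i := by
    have : e (s.erase i) = ∑ t ∈ c.support,
        Finsupp.single (t.erase i) (c t * (t.count i : K)) (s.erase i) := by
      simp only [e, Finsupp.sum, Finsupp.finsetSum_apply]
    rw [this, Finset.sum_eq_single s]
    · simp
    · intro t ht hts
      by_cases hit : i ∈ t
      · refine Finsupp.single_eq_of_ne fun h => ?_
        apply hts
        rw [← Multiset.cons_erase hit, ← Multiset.cons_erase hi, h]
      · simp [Multiset.count_eq_zero_of_notMem hit]
    · intro h
      simp [Finsupp.notMem_support_iff.1 h]
  rw [h3] at h1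
  exact (mul_eq_zero.1 h1).resolve_right
    (by exact_mod_cast (Multiset.count_ne_zero.2 hi))

/-- Ordered monomials in primitive elements that are separated by linear forms are linearly independent. -/
theorem linearIndependent_orderedMonomial [CharZero K] [Nontrivial H]
    (hΔ : ∀ i, Δ (x i) = x i ⊗ₜ 1 + 1 ⊗ₜ x i)
    (hφ : ∀ i j, φ i (x j) = if i = j then 1 else 0) (hφ1 : ∀ i, φ i 1 = 0) :
    LinearIndependent K (orderedMonomial x) := by
  have key : ∀ d, ∀ c : Multiset I →₀ K, (∀ s ∈ c.support, Multiset.card s ≤ d) →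
      Finsupp.linearCombination K (orderedMonomial x) c = 0 → c = 0 := by
    intro d
    induction d with
    | zero =>
      intro c hc h0
      have h1 : c = Finsupp.single 0 (c 0) := by
        refine Finsupp.ext fun s => ?_
        by_cases hs : s = 0
        · simp [hs]
        · rw [Finsupp.single_eq_of_ne hs]
          by_contra h
          exact hs (Multiset.card_eq_zero.1 (Nat.le_zero.1 (hc s (Finsupp.mem_support_iff.2 h))))
      rw [h1, Finsupp.linearCombination_single, orderedMonomial_zero, smul_eq_zero] at h0
      rw [h1, h0.resolve_right one_ne_zero, Finsupp.single_zero]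
    | succ d ih =>
      intro c hc h0
      have h1 := coeff_eq_zero_of_contract Δ x φ hΔ hφ hφ1 ih c hc (fun i => by rw [h0]; simp)
      refine ih c (fun s hs => ?_) h0
      have := hc s hs
      by_contra h
      exact Finsupp.mem_support_iff.1 hs (h1 s (by omega))
  rw [linearIndependent_iff]
  intro c h
  exact key (c.support.sup Multiset.card) c (fun s hs => Finset.le_sup (f := Multiset.card) hs) h

/-- A primitive element in the span of the ordered monomials vanishes if the linear forms do. -/
theorem eq_zero_of_primitive [CharZero K] [Nontrivial H]
    (hΔ : ∀ i, Δ (x i) = x i ⊗ₜ 1 + 1 ⊗ₜ x i)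
    (hφ : ∀ i j, φ i (x j) = if i = j then 1 else 0) (hφ1 : ∀ i, φ i 1 = 0)
    (ε : H →ₐ[K] K) {y : H} (hy : y ∈ Submodule.span K (Set.range (orderedMonomial x)))
    (hyΔ : Δ y = y ⊗ₜ 1 + 1 ⊗ₜ y) (hyε : ε y = 0) (hyφ : ∀ i, φ i y = 0) : y = 0 := by
  rw [Finsupp.mem_span_range_iff_exists_finsupp] at hy
  obtain ⟨c, hc⟩ := hy
  have hli := linearIndependent_orderedMonomial Δ x φ hΔ hφ hφ1
  rw [linearIndependent_iff] at hli
  -- The contraction of y ⊗ 1 + 1 ⊗ y is φ i y • 1 + φ i 1 • y, and both coefficients are zero.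
  have hD : ∀ i, contractFst (φ i) (Δ (Finsupp.linearCombination K (orderedMonomial x) c)) = 0 := by
    intro i
    rw [Finsupp.linearCombination_apply, hc, hyΔ]
    simp [hyφ, hφ1]
  -- All partial derivatives vanish, so the coefficients of greatest length do, and descending on
  -- the length leaves only a constant. The counit then excludes the constant.
  have hcard : ∀ s, s ≠ 0 → c s = 0 := by
    have key : ∀ d, (∀ s ∈ c.support, Multiset.card s ≤ d) → ∀ s, s ≠ 0 → c s = 0 := by
      intro d
      induction d with
      | zero =>
        intro h s hs
        by_contra h'
        exact hs (Multiset.card_eq_zero.1 (Nat.le_zero.1 (h s (Finsupp.mem_support_iff.2 h'))))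
      | succ d ih =>
        intro h
        have h1 := coeff_eq_zero_of_contract Δ x φ hΔ hφ hφ1 (fun c _ h => hli c h) c h hD
        refine ih fun s hs => ?_
        have := h s hs
        by_contra h
        exact Finsupp.mem_support_iff.1 hs (h1 s (by omega))
    exact key (c.support.sup Multiset.card) (fun s hs => Finset.le_sup (f := Multiset.card) hs)
  have h1 : c = Finsupp.single 0 (c 0) := by
    refine Finsupp.ext fun s => ?_
    by_cases hs : s = 0
    · simp [hs]
    · rw [Finsupp.single_eq_of_ne hs, hcard s hs]
  have h2 : y = algebraMap K H (c 0) := by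
    rw [← hc, h1]
    simp [orderedMonomial_zero, Algebra.algebraMap_eq_smul_one]
  rw [h2, AlgHom.commutes] at hyε
  have h3 : c 0 = 0 := hyε
  rw [h2, h3, map_zero]

end Primitive

/-! ### Noetherianity of filtered rings -/

section Noetherian

/-- A filtered ring whose associated graded ring is a quotient of a commutative noetherian graded
ring is left noetherian. -/
theorem isNoetherianRing_of_filtration {K P H : Type*} [CommRing K] [CommRing P]
    [Algebra K P] [IsNoetherianRing P] [Ring H]
    (𝒜 : ℕ → Submodule K P) [GradedAlgebra 𝒜] (m : P →+ H) (F : ℕ → AddSubgroup H)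
    (F_zero : F 0 = ⊥) (F_mul : ∀ a b c x y, a + b ≤ c + 1 → x ∈ F a → y ∈ F b → x * y ∈ F c)
    (F_exh : ∀ x, ∃ d, x ∈ F d)
    (m_mem : ∀ d, ∀ p ∈ 𝒜 d, m p ∈ F (d + 1))
    (m_surj : ∀ d, ∀ x ∈ F (d + 1), ∃ p ∈ 𝒜 d, x - m p ∈ F d)
    (m_mul : ∀ d e, ∀ p ∈ 𝒜 d, ∀ q ∈ 𝒜 e, m (p * q) - m p * m q ∈ F (d + e)) :
    IsNoetherianRing H := by
  classical
  refine (isNoetherianRing_iff_ideal_fg H).2 fun J => ?_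
  -- These are the homogeneous lifts to P of the leading symbols of elements of J. Finitely many of
  -- them generate the ideal spanned by L, and the corresponding elements of J will generate J.
  let L : Set P := {p | ∃ d, p ∈ 𝒜 d ∧ ∃ x ∈ J, x - m p ∈ F d}
  have hfg : (Submodule.span P L).FG := IsNoetherian.noetherian _
  obtain ⟨t, htL, ht⟩ := (Submodule.fg_span_iff_fg_span_finset_subset L).1 hfg
  have htL' : ∀ p ∈ t, ∃ d, p ∈ 𝒜 d ∧ ∃ x ∈ J, x - m p ∈ F d := fun p hp => htL hp
  choose! δ hδ ξ hξJ hξ using htL'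
  refine ⟨Finset.image ξ t, le_antisymm (Submodule.span_le.2 ?_) ?_⟩
  · intro x hx
    obtain ⟨p, hp, rfl⟩ := Finset.mem_image.1 hx
    exact hξJ p hp
  have key : ∀ d, ∀ x ∈ J, x ∈ F d → x ∈ Submodule.span H (Finset.image ξ t : Set H) := by
    intro d
    induction d with
    | zero =>
      intro x _ hx
      rw [F_zero, AddSubgroup.mem_bot] at hx
      rw [hx]; exact zero_mem _
    | succ d ih =>
      intro x hxJ hx
      obtain ⟨p, hp, hxp⟩ := m_surj d x hx
      have hpL : p ∈ Submodule.span P (t : Set P) := by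
        rw [← ht]; exact Submodule.subset_span ⟨d, hp, x, hxJ, hxp⟩
      obtain ⟨a, -, ha⟩ := Submodule.mem_span_finset.1 hpL
      -- Since p and the generators q are homogeneous, only the component of degree d - δ q of each
      -- coefficient matters. No such component exists when δ q exceeds d.
      let b : P → P := fun q => if δ q ≤ d then (DirectSum.decompose 𝒜 (a q) (d - δ q) : P) else 0
      have hb : ∀ q, b q ∈ 𝒜 (d - δ q) := by
        intro q
        by_cases h : δ q ≤ d
        · simp only [b, if_pos h]; exact SetLike.coe_mem _
        · simp only [b, if_neg h]; exact zero_mem _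
      have hpb : p = ∑ q ∈ t, b q * q := by
        have h1 : p = (DirectSum.decompose 𝒜 p d : P) := by
          rw [DirectSum.decompose_of_mem_same 𝒜 hp]
        rw [h1, ← ha, DirectSum.decompose_sum, DFinsupp.finsetSum_apply, AddSubmonoidClass.coe_finsetSum]
        refine Finset.sum_congr rfl fun q hq => ?_
        rw [smul_eq_mul]
        by_cases h : δ q ≤ d
        · rw [DirectSum.coe_decompose_mul_of_right_mem_of_le 𝒜 (hδ q hq) h]
          simp only [b, if_pos h]
        · rw [DirectSum.coe_decompose_mul_of_right_mem_of_not_le 𝒜 (hδ q hq) h]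
          simp only [b, if_neg h, zero_mul]
      have hy : ∑ q ∈ t, m (b q) * ξ q ∈ Submodule.span H (Finset.image ξ t : Set H) :=
        sum_mem fun q hq => Submodule.smul_mem _ (m (b q))
          (Submodule.subset_span (Finset.mem_coe.2 (Finset.mem_image_of_mem ξ hq)))
      have hyJ : ∑ q ∈ t, m (b q) * ξ q ∈ J :=
        sum_mem fun q hq => J.mul_mem_left _ (hξJ q hq)
      -- The errors are of three kinds, all in F d: replacing x by m p, the failure of m to be
      -- multiplicative, and replacing ξ q by m q.
      have hsub : x - ∑ q ∈ t, m (b q) * ξ q ∈ F d := by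
        have e : x - ∑ q ∈ t, m (b q) * ξ q = (x - m p) +
            ∑ q ∈ t, ((m (b q * q) - m (b q) * m q) - m (b q) * (ξ q - m q)) := by
          conv_rhs => rw [hpb, map_sum]
          simp only [mul_sub, Finset.sum_sub_distrib]
          abel
        rw [e]
        refine add_mem hxp (sum_mem fun q hq => ?_)
        by_cases h : δ q ≤ d
        · refine sub_mem ?_ (F_mul _ _ _ _ _ (by omega) (m_mem _ _ (hb q)) (hξ q hq))
          have := m_mul _ _ _ (hb q) q (hδ q hq)
          rwa [Nat.sub_add_cancel h] at this
        · simp [b, if_neg h]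
      have := add_mem (ih _ (sub_mem hxJ hyJ) hsub) hy
      rwa [sub_add_cancel] at this
  intro x hx
  obtain ⟨d, hd⟩ := F_exh x
  exact key d x hx hd

end Noetherian

local instance instRingGInfQ (R : Type*) [Ring R] : Ring (GInfQ R) := Subalgebra.toRing (GInfQ R)

local instance instAlgebraGInfQ (R : Type*) [Ring R] : Algebra ℚ (GInfQ R) :=
  Subalgebra.algebra (GInfQ R)

local instance instRingGInfQTensor (R : Type*) [Ring R] : Ring (GInfQ R ⊗[ℚ] GInfQ R) :=
  Algebra.TensorProduct.instRing

/-! ### The universal property of the infinite tensor product -/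

section Universal
open PiTensorProduct

variable {R : Type*} [Ring R] {B : Type*} [Ring B] [Algebra ℚ B]

theorem piLift_tprod {K U B : Type*} [CommRing K] [Ring U] [Algebra K U] [Ring B] [Algebra K B]
    {k : ℕ} (f : Fin k → U →ₐ[K] B) (hf : ∀ i j, i ≠ j → ∀ x y, Commute (f i x) (f j y))
    (x : Fin k → U) : piLift f hf (tprod K x) = (List.ofFn fun i => f i (x i)).prod := by
  simp [piLift]

variable (f : ℕ+ → UQ R →ₐ[ℚ] B) (hf : ∀ i j, i ≠ j → ∀ x y, Commute (f i x) (f j y))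

theorem commute_succPNat {f : ℕ+ → UQ R →ₐ[ℚ] B}
    (hf : ∀ i j, i ≠ j → ∀ x y, Commute (f i x) (f j y)) {N : ℕ}
    (i j : Fin N) (h : i ≠ j) (x y : UQ R) :
    Commute (f (i : ℕ).succPNat x) (f (j : ℕ).succPNat y) :=
  hf _ _ (fun h' => h (Fin.ext (Nat.succPNat_injective h'))) _ _

/-- The product of the images of the first `N` entries. -/
def partialEval (N : ℕ) (x : ℕ+ → UQ R) : B :=
  piLift (fun i : Fin N => f (i : ℕ).succPNat) (commute_succPNat hf)
    (tprod ℚ fun i => x (i : ℕ).succPNat)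

theorem partialEval_eq {N M : ℕ} (h : N ≤ M) (x : ℕ+ → UQ R) (hx : ∀ l : ℕ+, N < l → x l = 1) :
    partialEval f hf M x = partialEval f hf N x := by
  induction M, h using Nat.le_induction with
  | base => rfl
  | succ M hM ih =>
    rw [← ih]
    simp only [partialEval, piLift_tprod]
    rw [List.ofFn_succ_last]
    simp only [List.prod_append, List.prod_singleton, Fin.val_castSucc, Fin.val_last]
    rw [hx _ (by simp; omega), map_one, mul_one]

theorem update_comp_succPNat {N : ℕ} (x : ℕ+ → UQ R) {l : ℕ+} (h : l.natPred < N) (a : UQ R) :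
    (fun i : Fin N => Function.update x l a (i : ℕ).succPNat)
      = Function.update (fun i : Fin N => x (i : ℕ).succPNat) ⟨l.natPred, h⟩ a := by
  ext i
  by_cases hi : i = ⟨l.natPred, h⟩
  · subst hi; simp
  · rw [Function.update_of_ne hi, Function.update_of_ne]
    rintro rfl
    exact hi (Fin.ext (by simp))

open Classical in
/-- The product of the images of the entries of a family with almost all entries `1`. -/
def finiteEval (x : ℕ+ → UQ R) : B :=
  -- Changing one entry does not affect whether almost all entries are 1. Hence the default value 0
  -- on the remaining families is compatible with multilinearity, and the evaluation extends to all
  -- pure tensors.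
  if h : ∃ N : ℕ, ∀ l : ℕ+, N < l → x l = 1 then partialEval f hf h.choose x else 0

theorem finiteEval_eq {N : ℕ} (x : ℕ+ → UQ R) (hx : ∀ l : ℕ+, N < l → x l = 1) :
    finiteEval f hf x = partialEval f hf N x := by
  have h : ∃ N : ℕ, ∀ l : ℕ+, N < l → x l = 1 := ⟨N, hx⟩
  rw [finiteEval, dif_pos h]
  rcases le_total h.choose N with h' | h'
  · exact (partialEval_eq f hf h' x h.choose_spec).symm
  · exact partialEval_eq f hf h' x hx

theorem finiteEval_of_not {x : ℕ+ → UQ R} (h : ¬ ∃ N : ℕ, ∀ l : ℕ+, N < l → x l = 1) :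
    finiteEval f hf x = 0 := by
  rw [finiteEval, dif_neg h]

theorem update_finite (x : ℕ+ → UQ R) (l : ℕ+) (a : UQ R)
    (h : ∃ N : ℕ, ∀ m : ℕ+, N < m → x m = 1) :
    ∃ N : ℕ, ∀ m : ℕ+, N < m → Function.update x l a m = 1 := by
  obtain ⟨N, hN⟩ := h
  refine ⟨max N l, fun m hm => ?_⟩
  rw [Function.update_of_ne, hN _ ((le_max_left _ _).trans_lt hm)]
  rintro rfl
  exact absurd hm (by simp)

theorem update_finite_iff (x : ℕ+ → UQ R) (l : ℕ+) (a : UQ R) :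
    (∃ N : ℕ, ∀ m : ℕ+, N < m → Function.update x l a m = 1) ↔
    ∃ N : ℕ, ∀ m : ℕ+, N < m → x m = 1 :=
  ⟨fun h => by simpa using update_finite _ l (x l) h, update_finite x l a⟩

/-- On a family with almost all entries `1` the evaluation is computed by finitely many entries,
uniformly in a given entry. -/
theorem exists_finiteEval_update (x : ℕ+ → UQ R) (l : ℕ+)
    (h : ∃ N : ℕ, ∀ m : ℕ+, N < m → x m = 1) :
    ∃ (N : ℕ) (i : Fin N), (i : ℕ).succPNat = l ∧ ∀ a, finiteEval f hf (Function.update x l a) =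
      piLift (fun i : Fin N => f (i : ℕ).succPNat) (commute_succPNat hf)
        (tprod ℚ (Function.update (fun i : Fin N => x (i : ℕ).succPNat) i a)) := by
  obtain ⟨N, hN⟩ := h
  have hl : l.natPred < max N l := lt_of_lt_of_le
    (by rw [← PNat.natPred_add_one l]; exact Nat.lt_succ_self _) (le_max_right N (l : ℕ))
  refine ⟨max N l, ⟨l.natPred, hl⟩, by simp, fun a => ?_⟩
  rw [finiteEval_eq f hf (N := max N l), partialEval, update_comp_succPNat x hl]
  intro m hm
  rw [Function.update_of_ne, hN _ ((le_max_left _ _).trans_lt hm)]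
  rintro rfl
  exact absurd hm (by simp)

/-- The evaluation as a multilinear map. -/
def finiteEvalMultilinear : MultilinearMap ℚ (fun _ : ℕ+ => UQ R) B where
  toFun := finiteEval f hf
  map_update_add' := by
    intro inst x l a b
    rw [Subsingleton.elim inst (instDecidableEqPNat)]
    by_cases h : ∃ N : ℕ, ∀ m : ℕ+, N < m → x m = 1
    · obtain ⟨N, i, -, h⟩ := exists_finiteEval_update f hf x l h
      rw [h, h, h, MultilinearMap.map_update_add, map_add]
    · rw [finiteEval_of_not, finiteEval_of_not, finiteEval_of_not, add_zero] <;>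
        rwa [update_finite_iff]
  map_update_smul' := by
    intro inst x l c a
    rw [Subsingleton.elim inst (instDecidableEqPNat)]
    by_cases h : ∃ N : ℕ, ∀ m : ℕ+, N < m → x m = 1
    · obtain ⟨N, i, -, h⟩ := exists_finiteEval_update f hf x l h
      rw [h, h, MultilinearMap.map_update_smul, map_smul]
    · rw [finiteEval_of_not, finiteEval_of_not, smul_zero] <;>
        rwa [update_finite_iff]

/-- Multiplication by an element of one tensor factor changes a single entry of a pure tensor. For
families with almost all entries 1 this is multiplicativity of the finite lift; for all others both
sides are 0. -/
theorem lift_finiteEval_single_mul (l : ℕ+) (u : UQ R) (z : ⨂[ℚ] _ : ℕ+, UQ R) :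
    PiTensorProduct.lift (finiteEvalMultilinear f hf)
      (singleAlgHom (R := ℚ) (A := fun _ : ℕ+ => UQ R) l u * z)
      = f l u * PiTensorProduct.lift (finiteEvalMultilinear f hf) z := by
  induction z using PiTensorProduct.induction_on with
  | add a b ha hb => simp only [mul_add, map_add, ha, hb]
  | smul_tprod c x =>
    rw [mul_smul_comm, map_smul, map_smul, mul_smul_comm]
    congr 1
    have e : singleAlgHom (R := ℚ) (A := fun _ : ℕ+ => UQ R) l u * tprod ℚ x
        = tprod ℚ (Function.update x l (u * x l)) := by
      rw [singleAlgHom_apply, tprod_mul_tprod]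
      congr 1
      ext m
      by_cases hm : m = l
      · subst hm; simp
      · simp [Function.update_of_ne hm, Pi.mulSingle_eq_of_ne hm]
    rw [e, PiTensorProduct.lift.tprod, PiTensorProduct.lift.tprod]
    change finiteEval f hf _ = f l u * finiteEval f hf x
    by_cases h : ∃ N : ℕ, ∀ m : ℕ+, N < m → x m = 1
    · obtain ⟨N, i, rfl, h⟩ := exists_finiteEval_update f hf x l h
      have h1 := h (x (i : ℕ).succPNat)
      rw [Function.update_eq_self] at h1
      rw [h1, h, ← piLift_single (fun i : Fin N => f (i : ℕ).succPNat) (commute_succPNat hf) i u,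
        ← map_mul]
      congr 1
      rw [singleAlgHom_apply, tprod_mul_tprod]
      congr 1
      ext j
      by_cases hj : j = i
      · subst hj; simp
      · simp [Function.update_of_ne hj, Pi.mulSingle_eq_of_ne hj]
    · rw [finiteEval_of_not, finiteEval_of_not, mul_zero]
      · exact h
      · rwa [update_finite_iff]

/-- The elements a that satisfy this for all z form a subalgebra, and it contains each tensor
factor. -/
theorem lift_finiteEval_mul {a : ⨂[ℚ] _ : ℕ+, UQ R} (ha : a ∈ GInfQ R) (z : ⨂[ℚ] _ : ℕ+, UQ R) :
    PiTensorProduct.lift (finiteEvalMultilinear f hf) (a * z)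
      = PiTensorProduct.lift (finiteEvalMultilinear f hf) a
        * PiTensorProduct.lift (finiteEvalMultilinear f hf) z := by
  have h1 : PiTensorProduct.lift (finiteEvalMultilinear f hf) 1 = 1 := by
    rw [PiTensorProduct.one_def, PiTensorProduct.lift.tprod]
    change finiteEval f hf 1 = 1
    rw [finiteEval_eq f hf (N := 0) _ (by simp)]
    simp [partialEval, piLift_tprod]
  let S : Subalgebra ℚ (⨂[ℚ] _ : ℕ+, UQ R) :=
    { carrier := {a | ∀ z, PiTensorProduct.lift (finiteEvalMultilinear f hf) (a * z)
        = PiTensorProduct.lift (finiteEvalMultilinear f hf) a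
          * PiTensorProduct.lift (finiteEvalMultilinear f hf) z}
      mul_mem' := fun {a b} ha hb z => by rw [mul_assoc, ha, hb, ha, mul_assoc]
      add_mem' := fun {a b} ha hb z => by rw [add_mul, map_add, ha, hb, map_add, add_mul]
      algebraMap_mem' := fun r z => by
        rw [Algebra.algebraMap_eq_smul_one, smul_one_mul, map_smul, map_smul, h1, smul_one_mul] }
  have hS : GInfQ R ≤ S := by
    refine iSup_le fun l => ?_
    rintro _ ⟨u, rfl⟩ z
    have h2 := lift_finiteEval_single_mul f hf l u 1
    rw [mul_one, h1, mul_one] at h2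
    exact (lift_finiteEval_single_mul f hf l u z).trans (by rw [← h2]; rfl)
  exact hS ha z

/-- The universal property of the infinite tensor product. -/
def gLift : GInfQ R →ₐ[ℚ] B where
  toFun a := PiTensorProduct.lift (finiteEvalMultilinear f hf) a
  map_one' := by
    rw [OneMemClass.coe_one, PiTensorProduct.one_def, PiTensorProduct.lift.tprod]
    change finiteEval f hf 1 = 1
    rw [finiteEval_eq f hf (N := 0) _ (by simp)]
    simp [partialEval, piLift_tprod]
  map_mul' a b := lift_finiteEval_mul f hf a.2 b
  map_zero' := by simp
  map_add' a b := by simp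
  commutes' r := by
    rw [Algebra.algebraMap_eq_smul_one, Algebra.algebraMap_eq_smul_one]
    change PiTensorProduct.lift (finiteEvalMultilinear f hf) (r • (1 : ⨂[ℚ] _ : ℕ+, UQ R)) = _
    rw [map_smul, PiTensorProduct.one_def, PiTensorProduct.lift.tprod]
    change r • finiteEval f hf 1 = _
    rw [finiteEval_eq f hf (N := 0) _ (by simp)]
    simp [partialEval, piLift_tprod]

@[simp]
theorem gLift_factor (l : ℕ+) (u : UQ R) : gLift f hf (factor R l u) = f l u := by
  have h := lift_finiteEval_single_mul f hf l u 1
  rw [mul_one] at h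
  refine h.trans ?_
  rw [show PiTensorProduct.lift (finiteEvalMultilinear f hf) (1 : ⨂[ℚ] _ : ℕ+, UQ R)
    = gLift f hf 1 from rfl, map_one, mul_one]

end Universal

/-! ### Hopf structure, evaluations and projections of the infinite tensor product -/

section Structure
variable (R : Type*) [Ring R]

theorem gInfQ_adjoin :
    Algebra.adjoin ℚ (Set.range fun p : ℕ+ × RatExt R => tElem R p.1 p.2) = ⊤ := by
  set s := Set.range fun p : ℕ+ × RatExt R => tElem R p.1 p.2
  have hmem : ∀ l u, factor R l u ∈ Algebra.adjoin ℚ s := by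
    intro l u
    have hu : u ∈ Algebra.adjoin ℚ
        (Set.range (UniversalEnvelopingAlgebra.ι ℚ (L := RatExt R))) :=
      uea_adjoin_range_ι ℚ (RatExt R) ▸ Algebra.mem_top
    have h := (Subalgebra.mem_map (f := factor R l)).2 ⟨u, hu, rfl⟩
    rw [AlgHom.map_adjoin] at h
    refine Algebra.adjoin_mono ?_ h
    rintro _ ⟨_, ⟨x, rfl⟩, rfl⟩
    exact ⟨(l, x), rfl⟩
  have h : GInfQ R ≤ (Algebra.adjoin ℚ s).map (GInfQ R).val := by
    refine iSup_le fun l => ?_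
    rintro _ ⟨u, rfl⟩
    exact ⟨factor R l u, hmem l u, rfl⟩
  refine Algebra.eq_top_iff.2 fun x => ?_
  obtain ⟨y, hy, hyx⟩ := h x.2
  rwa [← Subtype.ext hyx]

variable {R}

theorem commute_factor {l m : ℕ+} (h : l ≠ m) (x y : UQ R) :
    Commute (factor R l x) (factor R m y) :=
  Subtype.ext (commute_singleAlgHom h x y).eq

theorem commute_ofId_comp {K U B : Type*} [CommRing K] [Ring U] [Algebra K U] [Ring B] [Algebra K B]
    (φ : U →ₐ[K] K) (x : U) (y : B) : Commute (((Algebra.ofId K B).comp φ) x) y :=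
  Algebra.commutes (φ x) y

theorem commute_map_of_commute {K U B : Type*} [CommRing K] [Ring U] [Algebra K U] [Ring B] [Algebra K B]
    (f g : U →ₐ[K] B) (h : ∀ x y, Commute (f x) (g y)) (z w : U ⊗[K] U) :
    Commute (Algebra.TensorProduct.map f f z) (Algebra.TensorProduct.map g g w) := by
  induction z using TensorProduct.induction_on with
  | zero => simp
  | add a b ha hb => rw [map_add]; exact ha.add_left hb
  | tmul a b =>
    induction w using TensorProduct.induction_on with
    | zero => simp
    | add c d hc hd => rw [map_add]; exact hc.add_right hd
    | tmul c d =>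
      simp only [Algebra.TensorProduct.map_tmul, Commute, SemiconjBy,
        Algebra.TensorProduct.tmul_mul_tmul]
      rw [(h a c).eq, (h b d).eq]

variable (R)

/-- The comultiplication on the `l`-th tensor factor. -/
def factorComul (l : ℕ+) : UQ R →ₐ[ℚ] GInfQ R ⊗[ℚ] GInfQ R :=
  (Algebra.TensorProduct.map (factor R l) (factor R l)).comp (ueaComul ℚ (RatExt R))

theorem commute_factorComul (i j : ℕ+) (h : i ≠ j) (x y : UQ R) :
    Commute (factorComul R i x) (factorComul R j y) :=
  commute_map_of_commute (factor R i) (factor R j) (commute_factor h)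
    (ueaComul ℚ (RatExt R) x) (ueaComul ℚ (RatExt R) y)

/-- The comultiplication of the infinite tensor product. -/
def gComul : GInfQ R →ₐ[ℚ] GInfQ R ⊗[ℚ] GInfQ R :=
  gLift (factorComul R) (commute_factorComul R)

/-- The counit of the infinite tensor product. -/
def gCounit : GInfQ R →ₐ[ℚ] ℚ :=
  gLift (fun _ => ueaCounit ℚ (RatExt R)) (fun _ _ _ _ _ => Commute.all _ _)

/-- The antipode of the infinite tensor product. -/
def gAntipode : GInfQ R →ₐ[ℚ] (GInfQ R)ᵐᵒᵖ :=
  gLift (fun l => (AlgHom.op (factor R l)).comp (ueaAntipode ℚ (RatExt R)))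
    (by
      intro i j h x y
      simp only [AlgHom.comp_apply, AlgHom.op_apply_apply]
      exact (commute_factor h _ _).op)

variable {R}

theorem tElem_def (l : ℕ+) (a : RatExt R) :
    tElem R l a = factor R l (UniversalEnvelopingAlgebra.ι ℚ a) := rfl

@[simp]
theorem gComul_tElem (l : ℕ+) (a : RatExt R) :
    gComul R (tElem R l a) = tElem R l a ⊗ₜ 1 + 1 ⊗ₜ tElem R l a := by
  rw [tElem_def, gComul, gLift_factor, factorComul]
  simp [ueaComul]

@[simp]
theorem gCounit_tElem (l : ℕ+) (a : RatExt R) : gCounit R (tElem R l a) = 0 := by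
  rw [tElem_def, gCounit, gLift_factor]
  simp [ueaCounit]

@[simp]
theorem gAntipode_tElem (l : ℕ+) (a : RatExt R) :
    gAntipode R (tElem R l a) = MulOpposite.op (-tElem R l a) := by
  rw [tElem_def, gAntipode, gLift_factor]
  simp [ueaAntipode]

variable (R)

/-- The Hopf algebra structure of the infinite tensor product. -/
def gHopf : HopfStructure ℚ (GInfQ R) :=
  HopfStructure.ofPrimitive (gComul R) (gCounit R) (gAntipode R) _ (gInfQ_adjoin R)
    (by rintro _ ⟨p, rfl⟩; exact gComul_tElem _ _)
    (by rintro _ ⟨p, rfl⟩; exact gCounit_tElem _ _)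
    (by rintro _ ⟨p, rfl⟩; exact gAntipode_tElem _ _)

section
attribute [local instance 100] LieRing.ofAssociativeRing

/-- The algebra map `U(ℚ ⊗ R) → ℚ ⊗ R` extending the identity. -/
def ueaEval : UQ R →ₐ[ℚ] RatExt R :=
  UniversalEnvelopingAlgebra.lift ℚ (LieHom.id : RatExt R →ₗ⁅ℚ⁆ RatExt R)

theorem ueaEval_ι (a : RatExt R) : ueaEval R (UniversalEnvelopingAlgebra.ι ℚ a) = a := by
  simp [ueaEval]

theorem ueaCounit_ι (a : RatExt R) :
    ueaCounit ℚ (RatExt R) (UniversalEnvelopingAlgebra.ι ℚ a) = 0 := by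
  simp [ueaCounit]

theorem tElem_mul_sub (l : ℕ+) (a b : RatExt R) :
    tElem R l a * tElem R l b - tElem R l b * tElem R l a = tElem R l (a * b - b * a) := by
  have h : UniversalEnvelopingAlgebra.ι ℚ ⁅a, b⁆ = _ :=
    LieHom.map_lie (UniversalEnvelopingAlgebra.ι ℚ) a b
  rw [LieRing.of_associative_ring_bracket, LieRing.of_associative_ring_bracket] at h
  rw [tElem_def, tElem_def, tElem_def, ← map_mul (factor R l), ← map_mul (factor R l),
    ← map_sub (factor R l)]
  exact congrArg (factor R l) h.symm

end

/-- Evaluation of the `l`-th factor, all other factors being augmented. -/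
def gEval (l : ℕ+) : GInfQ R →ₐ[ℚ] RatExt R :=
  gLift (fun m => if m = l then ueaEval R else (Algebra.ofId ℚ (RatExt R)).comp (ueaCounit ℚ _))
    (by
      intro i j h x y
      by_cases hi : i = l
      · have hj : j ≠ l := fun hj => h (hi.trans hj.symm)
        simp only [if_neg hj]
        exact (commute_ofId_comp _ _ _).symm
      · simp only [if_neg hi]
        exact commute_ofId_comp _ _ _)

theorem gEval_tElem (l m : ℕ+) (a : RatExt R) :
    gEval R l (tElem R m a) = if m = l then a else 0 := by
  rw [tElem_def, gEval, gLift_factor]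
  split_ifs
  · exact ueaEval_ι R a
  · rw [AlgHom.comp_apply, ueaCounit_ι, map_zero]

/-- The projection to the first factor. -/
def gFst : GInfQ R →ₐ[ℚ] UQ R :=
  gLift (fun m => if m = 1 then AlgHom.id ℚ _ else (Algebra.ofId ℚ _).comp (ueaCounit ℚ _))
    (by
      intro i j h x y
      by_cases hi : i = 1
      · have hj : j ≠ 1 := fun hj => h (hi.trans hj.symm)
        simp only [if_neg hj]
        exact (commute_ofId_comp _ _ _).symm
      · simp only [if_neg hi]
        exact commute_ofId_comp _ _ _)

theorem factor_one_injective : Function.Injective (factor R 1) :=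
  Function.LeftInverse.injective (g := gFst R) fun u => by
    rw [gFst, gLift_factor]; simp

/-- The projection to the first `k` factors. -/
def gTrunc (k : ℕ) : GInfQ R →ₐ[ℚ] UEATensorPower ℚ (RatExt R) k :=
  gLift (fun m => if h : m.natPred < k then ueaSingle ⟨m.natPred, h⟩ else
      (Algebra.ofId ℚ _).comp (ueaCounit ℚ _))
    (by
      intro i j h x y
      by_cases hi : i.natPred < k
      · by_cases hj : j.natPred < k
        · simp only [dif_pos hi, dif_pos hj]
          exact commute_singleAlgHom (fun h' => h (PNat.natPred_injective (Fin.mk.inj_iff.1 h'))) _ _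
        · simp only [dif_neg hj]
          exact (commute_ofId_comp _ _ _).symm
      · simp only [dif_neg hi]
        exact commute_ofId_comp _ _ _)

theorem firstFactors_single (k : ℕ) (i : Fin k) (u : UQ R) :
    firstFactors R k (ueaSingle i u) = factor R (i : ℕ).succPNat u := by
  rw [firstFactors]
  erw [piLift_single]

theorem firstFactors_injective (k : ℕ) : Function.Injective (firstFactors R k) := by
  have h : (gTrunc R k).comp (firstFactors R k) = AlgHom.id ℚ _ := by
    refine AlgHom.ext_of_adjoin_eq_top (tensorPower_adjoin ℚ (RatExt R) k) ?_
    rintro _ ⟨⟨i, x⟩, rfl⟩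
    simp only [AlgHom.comp_apply, AlgHom.id_apply]
    rw [firstFactors_single, gTrunc, gLift_factor]
    simp
  exact Function.LeftInverse.injective (g := gTrunc R k) fun u => DFunLike.congr_fun h u

end Structure

/-! ### Ordered monomials in the T_l(b_i) -/

section RationalPBW
variable {R : Type*} [Ring R]

/-- The `ℚ`-basis of `ℚ ⊗ R` given by a `ℤ`-basis of `R`. -/
def ratBasis {ι : Type*} (b : Module.Basis ι ℤ R) : Module.Basis ι ℚ (RatExt R) :=
  Algebra.TensorProduct.basis ℚ b

theorem ratBasis_apply {ι : Type*} (b : Module.Basis ι ℤ R) (i : ι) :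
    ratBasis b i = ratExtOf R (b i) :=
  Algebra.TensorProduct.basis_apply b i

/-- The family of generators `T_l(a)`, with `l` in a given set of tensor factors. -/
def tGen {J : Type*} (ℓ : J → ℕ+) (p : J × RatExt R) : GInfQ R := tElem R (ℓ p.1) p.2

/-- The weight of the generators in the `l`-th tensor factor is `l ^ 2`. -/
def sqWeight {J Y : Type*} (ℓ : J → ℕ+) (p : J × Y) : ℕ := (ℓ p.1 : ℕ) ^ 2

theorem commute_tElem {l m : ℕ+} (h : l ≠ m) (a c : RatExt R) :
    tElem R l a * tElem R m c = tElem R m c * tElem R l a :=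
  commute_factor h _ _

/-- Different tensor factors commute. Inside the l-th one the commutator is again a single generator
T_l, whose weight l^2 is less than 2 l^2. -/
theorem tGen_commutator {J : Type*} {ℓ : J → ℕ+} (hℓ : Function.Injective ℓ) (x y : J × RatExt R) :
    tGen ℓ x * tGen ℓ y - tGen ℓ y * tGen ℓ x ∈
      wordFil ℚ (tGen (R := R) ℓ) (sqWeight ℓ) (sqWeight ℓ x + sqWeight ℓ y) := by
  obtain ⟨l, a⟩ := x
  obtain ⟨m, c⟩ := y
  by_cases h : l = m
  · subst h
    have : tGen ℓ (l, a) * tGen ℓ (l, c) - tGen ℓ (l, c) * tGen ℓ (l, a)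
        = tGen ℓ (l, a * c - c * a) := tElem_mul_sub R _ _ _
    rw [this]
    refine mem_wordFil _ ?_
    have : 0 < (ℓ l : ℕ) ^ 2 := pow_pos (ℓ l).pos 2
    simp only [sqWeight]
    omega
  · simp only [tGen]
    rw [commute_tElem (fun h' => h (hℓ h')), sub_self]
    exact zero_mem _

variable {ι I J : Type*} (b : Module.Basis ι ℤ R) (jj : I → J) (β : I → ι)

/-- The generators `T_l(b_i)` attached to a basis of `R`. -/
def tIndex (i : I) : J × RatExt R := (jj i, ratBasis b (β i))

theorem tGen_mem_span {ℓ : J → ℕ+} (hsurj : ∀ j i, ∃ k, jj k = j ∧ β k = i) (y : J × RatExt R) :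
    tGen ℓ y ∈ Submodule.span ℚ (tGen ℓ '' {z | ∃ k, z = tIndex b jj β k ∧
      sqWeight ℓ z = sqWeight ℓ y}) := by
  obtain ⟨l, a⟩ := y
  have : tGen ℓ (l, a) = ((ratBasis b).repr a).sum fun i c => c • tGen ℓ (l, ratBasis b i) := by
    simp only [tGen]
    conv_lhs => rw [← (ratBasis b).linearCombination_repr a, Finsupp.linearCombination_apply,
      Finsupp.sum, map_sum]
    simp only [map_smul, Finsupp.sum]
  rw [this]
  refine sum_mem fun i _ => Submodule.smul_mem _ _ (Submodule.subset_span ?_)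
  obtain ⟨k, rfl, rfl⟩ := hsurj l i
  exact ⟨_, ⟨k, rfl, rfl⟩, rfl⟩

theorem wordFil_tGen_le [LinearOrder I] {ℓ : J → ℕ+} (hℓ : Function.Injective ℓ)
    (hsurj : ∀ j i, ∃ k, jj k = j ∧ β k = i) (d : ℕ) :
    wordFil ℚ (tGen (R := R) ℓ) (sqWeight ℓ) d ≤ Submodule.span ℚ
      (orderedMonomial (tGen ℓ ∘ tIndex b jj β) ''
        {s | (s.map (sqWeight ℓ ∘ tIndex b jj β)).sum < d}) :=
  wordFil_le_span_orderedMonomial _ (tGen_commutator hℓ)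
    (fun y => Submodule.mem_sup_left (tGen_mem_span b jj β hsurj y)) d

/-- The linear form dual to `T_l(b_i)`. -/
def tForm (ℓ : J → ℕ+) (i : I) : GInfQ R →ₗ[ℚ] ℚ :=
  (ratBasis b).coord (β i) ∘ₗ ((gEval R (ℓ (jj i))).toLinearMap
    - (Algebra.linearMap ℚ (RatExt R)) ∘ₗ (gCounit R).toLinearMap)

theorem tForm_apply (ℓ : J → ℕ+) (i : I) (x : GInfQ R) : tForm b jj β ℓ i x =
    (ratBasis b).coord (β i) (gEval R (ℓ (jj i)) x - algebraMap ℚ _ (gCounit R x)) := rfl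

/-- Evaluation sends 1 to the unit of ℚ ⊗ R, whose coordinates need not vanish; the counit term in
the form removes them without changing the values on the T_l. -/
theorem tForm_one (ℓ : J → ℕ+) (i : I) : tForm b jj β ℓ i 1 = 0 := by
  simp [tForm_apply]

theorem tForm_tGen [LinearOrder I] {ℓ : J → ℕ+} (hℓ : Function.Injective ℓ)
    (hinj : ∀ k k', jj k = jj k' → β k = β k' → k = k') (i k : I) :
    tForm b jj β ℓ i ((tGen ℓ ∘ tIndex b jj β) k) = if i = k then 1 else 0 := by
  simp only [tForm_apply, Function.comp_apply, tGen, tIndex, gEval_tElem, gCounit_tElem, map_zero,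
    sub_zero]
  classical
  by_cases h : jj k = jj i
  · rw [if_pos (congrArg ℓ h), Module.Basis.coord_apply, Module.Basis.repr_self,
      Finsupp.single_apply]
    refine if_congr ⟨fun h' => (hinj _ _ h h').symm, fun h' => by rw [h']⟩ rfl rfl
  · rw [if_neg fun h' => h (hℓ h'), if_neg fun h' => h (by rw [h']), map_zero]

instance : Nontrivial (GInfQ R) := (gCounit R).toRingHom.domain_nontrivial

/-- This is the injectivity half of PBW. It comes from primitivity of the T_l and from the
evaluations in ℚ ⊗ R, which exist because the Lie algebra is that of an associative algebra. -/
theorem linearIndependent_tGen [LinearOrder I] {ℓ : J → ℕ+} (hℓ : Function.Injective ℓ)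
    (hinj : ∀ k k', jj k = jj k' → β k = β k' → k = k') :
    LinearIndependent ℚ (orderedMonomial (tGen ℓ ∘ tIndex b jj β)) :=
  linearIndependent_orderedMonomial (gComul R) _ (tForm b jj β ℓ)
    (fun _ => gComul_tElem _ _) (tForm_tGen b jj β hℓ hinj) (tForm_one b jj β ℓ)

end RationalPBW

/-! ### Primitive elements are detected by the evaluations -/

section PrimitiveElements
variable {R : Type*} [Ring R]

/-- A primitive element of the infinite tensor product is determined by its images in `ℚ ⊗ R`. -/
theorem eq_zero_of_gComul [Module.Free ℤ R] {y : GInfQ R}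
    (hy : gComul R y = y ⊗ₜ 1 + 1 ⊗ₜ y) (hy0 : gCounit R y = 0)
    (hyl : ∀ l, gEval R l y = 0) : y = 0 := by
  let b := Module.Free.chooseBasis ℤ R
  let _ : LinearOrder (Module.Free.ChooseBasisIndex ℤ R) := IsWellOrder.linearOrder WellOrderingRel
  let jj : ℕ+ ×ₗ Module.Free.ChooseBasisIndex ℤ R → ℕ+ := fun k => (ofLex k).1
  let β : ℕ+ ×ₗ Module.Free.ChooseBasisIndex ℤ R → Module.Free.ChooseBasisIndex ℤ R :=
    fun k => (ofLex k).2
  have hinj : ∀ k k', jj k = jj k' → β k = β k' → k = k' := fun k k' h h' =>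
    ofLex.injective (Prod.ext h h')
  have hid : Function.Injective (id : ℕ+ → ℕ+) := Function.injective_id
  have hy1 : y ∈ Submodule.span ℚ (Set.range (orderedMonomial (tGen id ∘ tIndex b jj β))) := by
    have : y ∈ Algebra.adjoin ℚ (Set.range (tGen (R := R) (id : ℕ+ → ℕ+))) := by
      have h := gInfQ_adjoin R
      have h' : y ∈ (⊤ : Subalgebra ℚ (GInfQ R)) := Algebra.mem_top
      rw [← h] at h'
      exact h'
    obtain ⟨d, hd⟩ := exists_mem_wordFil (w := sqWeight id) this
    exact Submodule.span_mono (Set.image_subset_range _ _)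
      (wordFil_tGen_le b jj β hid (fun j i => ⟨toLex (j, i), rfl, rfl⟩) d hd)
  refine eq_zero_of_primitive (gComul R) (tGen id ∘ tIndex b jj β) (tForm b jj β id)
    (fun _ => gComul_tElem _ _)
    (tForm_tGen b jj β hid hinj) (tForm_one b jj β id)
    (gCounit R) hy1 hy hy0 fun i => ?_
  rw [tForm_apply, hyl, hy0, map_zero, sub_zero, map_zero]

end PrimitiveElements

/-! ### The Euler operator and the differential equation of the exponential -/

section Euler
open PowerSeries

variable {A B : Type*} [Ring A] [Ring B]

/-- The Euler operator `t d/dt` on power series. -/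
def euler : A⟦X⟧ →+ A⟦X⟧ where
  toFun f := mk fun n => n • coeff n f
  map_zero' := by ext; simp
  map_add' f g := by ext; simp

@[simp]
theorem coeff_euler (n : ℕ) (f : A⟦X⟧) : coeff n (euler f) = n • coeff n f := by
  simp [euler]

theorem euler_mul (f g : A⟦X⟧) : euler (f * g) = euler f * g + f * euler g := by
  ext n
  simp only [coeff_euler, map_add, coeff_mul, Finset.smul_sum, ← Finset.sum_add_distrib]
  refine Finset.sum_congr rfl fun p hp => ?_
  rw [← Finset.HasAntidiagonal.mem_antidiagonal.1 hp, add_smul, smul_mul_assoc, mul_smul_comm]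

theorem euler_one : euler (1 : A⟦X⟧) = 0 := by
  ext n
  rw [coeff_euler, coeff_one]
  by_cases h : n = 0 <;> simp [h]

theorem euler_map (φ : A →+* B) (f : A⟦X⟧) : euler (map φ f) = map φ (euler f) := by
  ext n
  simp

theorem euler_pow_of_commute {g : A⟦X⟧} (h : Commute g (euler g)) (m : ℕ) :
    euler (g ^ (m + 1)) = (m + 1) • (euler g * g ^ m) := by
  induction m with
  | zero => simp
  | succ m ih =>
    rw [pow_succ, euler_mul, ih, smul_mul_assoc, mul_assoc, ← pow_succ, (h.pow_left (m + 1)).eq,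
      succ_nsmul _ (m + 1)]

theorem commute_of_coeff {f g : A⟦X⟧} (h : ∀ i j, Commute (coeff i f) (coeff j g)) :
    Commute f g := by
  ext n
  rw [coeff_mul, coeff_mul, ← Finset.Nat.sum_antidiagonal_swap]
  exact Finset.sum_congr rfl fun p _ => (h _ _).eq

theorem coeff_pow_eq_zero {g : A⟦X⟧} (hg : coeff 0 g = 0) {m n : ℕ} (h : n < m) :
    coeff n (g ^ m) = 0 := by
  induction m generalizing n with
  | zero => exact absurd h (Nat.not_lt_zero _)
  | succ m ih =>
    rw [pow_succ', coeff_mul]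
    refine Finset.sum_eq_zero fun p hp => ?_
    rcases Nat.eq_zero_or_pos p.1 with h1 | h1
    · rw [h1, hg, zero_mul]
    · rw [ih (by have := Finset.HasAntidiagonal.mem_antidiagonal.1 hp; omega), mul_zero]

variable [Algebra ℚ A]

/-- A linear differential equation has at most one solution with given constant term. -/
theorem eq_of_euler_eq_mul {G Y Z : A⟦X⟧} (hG : coeff 0 G = 0) (hY : euler Y = G * Y)
    (hZ : euler Z = G * Z) (h0 : coeff 0 Y = coeff 0 Z) : Y = Z := by
  ext n
  induction n using Nat.strong_induction_on with
  | _ n ih =>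
    rcases Nat.eq_zero_or_pos n with rfl | hn
    · exact h0
    -- As G has no constant term, n times the n-th coefficient of a solution involves only its lower
    -- coefficients.
    have key : (n : ℚ) • coeff n Y = (n : ℚ) • coeff n Z := by
      rw [Nat.cast_smul_eq_nsmul, Nat.cast_smul_eq_nsmul, ← coeff_euler, ← coeff_euler, hY, hZ,
        coeff_mul, coeff_mul]
      refine Finset.sum_congr rfl fun p hp => ?_
      rcases Nat.eq_zero_or_pos p.1 with h1 | h1
      · rw [h1, hG, zero_mul, zero_mul]
      · rw [ih p.2 (by have := Finset.HasAntidiagonal.mem_antidiagonal.1 hp; omega)]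
    exact smul_right_injective A (by exact_mod_cast hn.ne' : (n : ℚ) ≠ 0) key

theorem coeff_expSeries {g : A⟦X⟧} (hg : coeff 0 g = 0) {n N : ℕ} (h : n < N) :
    coeff n (expSeries g) = ∑ m ∈ Finset.range N, ((m.factorial : ℚ)⁻¹) • coeff n (g ^ m) := by
  rw [expSeries, coeff_mk]
  refine Finset.sum_subset (Finset.range_mono (by omega)) fun m _ hm => ?_
  rw [coeff_pow_eq_zero hg (by simpa using hm), smul_zero]

theorem coeff_zero_expSeries {g : A⟦X⟧} : coeff 0 (expSeries g) = 1 := by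
  rw [expSeries, coeff_mk]
  simp

/-- Since g commutes with its derivative, the operator takes g^(m+1)/(m+1)! to (t g') g^m/m!.
Commutativity of the coefficients of g is what makes the usual rule valid here. -/
theorem euler_expSeries {g : A⟦X⟧} (hg : coeff 0 g = 0)
    (hc : ∀ i j, Commute (coeff i g) (coeff j g)) :
    euler (expSeries g) = euler g * expSeries g := by
  have hcomm : Commute g (euler g) := commute_of_coeff fun i j => by
    rw [coeff_euler]; exact (hc i j).smul_right j
  ext n
  rcases Nat.eq_zero_or_pos n with rfl | hn
  · rw [coeff_euler, zero_smul, coeff_mul]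
    simp
  rw [coeff_euler, coeff_expSeries hg (Nat.lt_succ_self n), Finset.sum_range_succ', nsmul_add,
    Finset.smul_sum, coeff_mul]
  have h0 : n • (((Nat.factorial 0 : ℚ)⁻¹) • coeff n (g ^ 0)) = 0 := by
    rw [pow_zero, coeff_one, if_neg hn.ne', smul_zero, smul_zero]
  rw [h0, add_zero]
  have h1 : ∀ m, n • ((((m + 1).factorial : ℚ)⁻¹) • coeff n (g ^ (m + 1)))
      = ∑ p ∈ Finset.HasAntidiagonal.antidiagonal n,
        ((m.factorial : ℚ)⁻¹) • (coeff p.1 (euler g) * coeff p.2 (g ^ m)) := by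
    intro m
    rw [smul_comm, ← coeff_euler, euler_pow_of_commute hcomm, map_nsmul, ← Finset.smul_sum,
      ← coeff_mul, ← Nat.cast_smul_eq_nsmul ℚ, smul_smul]
    congr 1
    rw [Nat.factorial_succ]
    have : (m.factorial : ℚ) ≠ 0 := by exact_mod_cast m.factorial_ne_zero
    push_cast
    field_simp
  simp only [h1]
  rw [Finset.sum_comm]
  refine Finset.sum_congr rfl fun p hp => ?_
  rcases Nat.eq_zero_or_pos p.1 with h2 | h2
  · simp [h2]
  -- After the index shift n terms remain; this is enough because p.1 > 0 makes p.2 less than n.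
  · rw [coeff_expSeries hg (n := p.2) (N := n)
      (by have := Finset.HasAntidiagonal.mem_antidiagonal.1 hp; omega), Finset.mul_sum]
    simp only [mul_smul_comm]

end Euler

/-! ### The factors Θ_l: evaluations, counit and comultiplication -/

section Theta
open PowerSeries
variable {R : Type*} [Ring R]

theorem one_sub_neg_X_pow_mul_C {A : Type*} [Ring A] (l : ℕ) (u : A) :
    (1 - (-X) ^ l * C u : A⟦X⟧) = 1 - monomial l ((-1) ^ l * u) := by
  congr 1
  ext n
  rw [neg_pow, mul_assoc, show ((-1 : A⟦X⟧) ^ l) = C ((-1 : A) ^ l) by simp, coeff_C_mul,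
    coeff_monomial, coeff_mul_C, coeff_X_pow]
  split_ifs <;> simp

theorem monomial_pow' {A : Type*} [Ring A] (l : ℕ) (u : A) (m : ℕ) :
    (monomial l u : A⟦X⟧) ^ m = monomial (l * m) (u ^ m) := by
  induction m with
  | zero => simp
  | succ m ih =>
    rw [pow_succ, ih, monomial_mul_monomial, mul_add, mul_one, pow_succ]

/-- The logarithm of `1 - t^l v`. -/
theorem coeff_logSeries {A : Type*} [Ring A] [Algebra ℚ A] (l : ℕ) (hl : 0 < l) (v : A) (n : ℕ) :
    coeff n (logSeries (1 - monomial l v)) =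
      if l ∣ n ∧ 0 < n then (-((n / l : ℕ) : ℚ)⁻¹) • v ^ (n / l) else 0 := by
  rw [logSeries, coeff_mk]
  have h : (1 - monomial l v - 1 : A⟦X⟧) = monomial l (-v) := by rw [map_neg]; abel
  simp only [h, monomial_pow', coeff_monomial]
  split_ifs with hn
  · obtain ⟨⟨m, rfl⟩, hn⟩ := hn
    have hm : 0 < m := Nat.pos_of_ne_zero (by rintro rfl; simp at hn)
    rw [Nat.mul_div_cancel_left m hl, Finset.sum_eq_single m]
    · have e : (-1 : A) ^ m * v ^ m = ((-1 : ℚ) ^ m) • v ^ m := by simp [Algebra.smul_def]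
      rw [if_pos rfl, neg_pow v, e, smul_smul]
      congr 1
      rw [pow_succ, div_mul_eq_mul_div, mul_right_comm, ← mul_pow]
      simp [neg_div]
    · intro j _ hj
      rw [if_neg, smul_zero]
      intro h'
      exact hj (Nat.eq_of_mul_eq_mul_left hl h').symm
    · intro h'
      exact absurd (Finset.mem_Icc.2 ⟨hm, Nat.le_mul_of_pos_left m hl⟩) h'
  · refine Finset.sum_eq_zero fun m hm => ?_
    rw [if_neg, smul_zero]
    rintro rfl
    exact hn ⟨Dvd.intro m rfl, Nat.mul_pos hl (Finset.mem_Icc.1 hm).1⟩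

/-- The derivative of the logarithm is -l times the sum of the v^m t^(lm), m ≥ 1, and multiplying it
by 1 - t^l v telescopes to -l v t^l. -/
theorem euler_logSeries {A : Type*} [Ring A] [Algebra ℚ A] (l : ℕ) (hl : 0 < l) (v : A) :
    euler (1 - monomial l v) = euler (logSeries (1 - monomial l v)) * (1 - monomial l v) := by
  have hD : ∀ n, coeff n (euler (logSeries (1 - monomial l v))) =
      if l ∣ n ∧ 0 < n then (-(l : ℚ)) • v ^ (n / l) else 0 := by
    intro n
    rw [coeff_euler, coeff_logSeries l hl]
    split_ifs with h
    · obtain ⟨⟨m, rfl⟩, hn⟩ := h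
      have hm : m ≠ 0 := by rintro rfl; simp at hn
      rw [Nat.mul_div_cancel_left m hl, ← Nat.cast_smul_eq_nsmul ℚ, smul_smul]
      congr 1
      have : (m : ℚ) ≠ 0 := by exact_mod_cast hm
      push_cast
      field_simp
    · simp
  ext n
  rw [coeff_euler, mul_sub, mul_one, map_sub (coeff n), map_sub (coeff n), hD, coeff_monomial,
    coeff_one]
  have hmul : coeff n (euler (logSeries (1 - monomial l v)) * monomial l v)
      = if l ≤ n then coeff (n - l) (euler (logSeries (1 - monomial l v))) * v else 0 := by
    split_ifs with h
    · obtain ⟨k, rfl⟩ := Nat.exists_eq_add_of_le' h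
      rw [Nat.add_sub_cancel, coeff_mul, Finset.sum_eq_single (k, l)]
      · simp
      · rintro ⟨i, j⟩ hp hne
        rw [coeff_monomial, if_neg, mul_zero]
        rintro rfl
        rw [Finset.HasAntidiagonal.mem_antidiagonal] at hp
        exact hne (Prod.ext (by simp at hp; omega) rfl)
      · simp
    · rw [coeff_mul]
      refine Finset.sum_eq_zero fun p hp => ?_
      rw [coeff_monomial, if_neg, mul_zero]
      have := Finset.HasAntidiagonal.mem_antidiagonal.1 hp
      omega
  rw [hmul, hD]
  by_cases hdvd : l ∣ n
  · obtain ⟨m, rfl⟩ := hdvd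
    -- The cases are n = 0, the surviving term n = l, and n ≥ 2l, where the sum telescopes.
    rcases m with _ | _ | m
    · simp [hl.ne']
    · simp [hl, hl.ne', ← Nat.cast_smul_eq_nsmul ℚ]
    · have e1 : l * (m + 1 + 1) - l = l * (m + 1) := by
        rw [mul_add l (m + 1) 1, mul_one, Nat.add_sub_cancel]
      have e2 : l ≤ l * (m + 1 + 1) := Nat.le_mul_of_pos_right l (by omega)
      have e3 : l * (m + 1 + 1) ≠ l := by
        intro h
        have := Nat.eq_of_mul_eq_mul_left hl (h.trans (mul_one l).symm)
        omega
      have e4 : l * (m + 1 + 1) ≠ 0 := Nat.mul_ne_zero hl.ne' (by omega)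
      rw [if_neg e4, if_neg e3, if_pos ⟨Dvd.intro _ rfl, Nat.pos_of_ne_zero e4⟩, if_pos e2, e1,
        if_pos ⟨Dvd.intro _ rfl, Nat.mul_pos hl (by omega)⟩, Nat.mul_div_cancel_left _ hl,
        Nat.mul_div_cancel_left _ hl, smul_mul_assoc, ← pow_succ, sub_self, sub_self, smul_zero]
  · have h1 : n ≠ 0 := by rintro rfl; simp at hdvd
    have h2 : n ≠ l := by rintro rfl; simp at hdvd
    rw [if_neg h1, if_neg h2, if_neg (fun h => hdvd h.1)]
    split_ifs with h3 h4
    · exact absurd ((Nat.dvd_sub_iff_left h3 (dvd_refl l)).1 h4.1) hdvd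
    · simp
    · simp

/-- The series `T_l(log(1 - t^l v))`. -/
def logT (l : ℕ+) (v : RatExt R) : (GInfQ R)⟦X⟧ :=
  mk fun n => tElem R l (coeff n (logSeries (1 - monomial (l : ℕ) v)))

theorem coeff_logT (l : ℕ+) (v : RatExt R) (n : ℕ) : coeff n (logT l v)
    = if (l : ℕ) ∣ n ∧ 0 < n then (-((n / l : ℕ) : ℚ)⁻¹) • tElem R l (v ^ (n / l)) else 0 := by
  rw [logT, coeff_mk, coeff_logSeries _ l.pos]
  split_ifs
  · rw [map_smul]
  · rw [map_zero]

theorem coeff_zero_logT (l : ℕ+) (v : RatExt R) : coeff 0 (logT l v) = 0 := by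
  rw [coeff_logT, if_neg (by simp)]

theorem commute_coeff_logT (l : ℕ+) (v : RatExt R) (i j : ℕ) :
    Commute (coeff i (logT l v)) (coeff j (logT l v)) := by
  rw [coeff_logT, coeff_logT]
  split_ifs
  · refine (Commute.smul_right ?_ _).smul_left _
    have h := tElem_mul_sub R l (v ^ (i / l)) (v ^ (j / l))
    rw [((Commute.refl v).pow_pow _ _).eq, sub_self, map_zero] at h
    exact sub_eq_zero.1 h
  · exact Commute.zero_right _
  · exact Commute.zero_left _
  · exact Commute.zero_left _

theorem euler_theta (l : ℕ+) (v : RatExt R) :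
    euler (theta l (1 - monomial (l : ℕ) v))
      = euler (logT l v) * theta l (1 - monomial (l : ℕ) v) :=
  euler_expSeries (coeff_zero_logT l v) (commute_coeff_logT l v)

theorem coeff_zero_theta (l : ℕ+) (v : RatExt R) :
    coeff 0 (theta l (1 - monomial (l : ℕ) v)) = 1 := coeff_zero_expSeries

theorem map_theta {B : Type*} [Ring B] [Algebra ℚ B] (φ : GInfQ R →ₐ[ℚ] B) (l : ℕ+)
    (v : RatExt R) : euler (map φ.toRingHom (theta l (1 - monomial (l : ℕ) v)))
      = map φ.toRingHom (euler (logT l v)) * map φ.toRingHom (theta l (1 - monomial (l : ℕ) v)) := by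
  rw [euler_map, euler_theta, map_mul]

theorem map_theta_of_eq_zero {B : Type*} [Ring B] [Algebra ℚ B] (φ : GInfQ R →ₐ[ℚ] B) (l : ℕ+)
    (v : RatExt R) (h : ∀ a, φ (tElem R l a) = 0) :
    map φ.toRingHom (theta l (1 - monomial (l : ℕ) v)) = 1 := by
  have hG : map φ.toRingHom (euler (logT l v)) = 0 := by
    ext n
    rw [coeff_map, coeff_euler, map_nsmul, logT, coeff_mk]
    have : φ.toRingHom (tElem R l (coeff n (logSeries (1 - monomial (l : ℕ) v)))) = 0 := h _
    rw [this, smul_zero, map_zero]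
  refine eq_of_euler_eq_mul (G := 0) (map_zero _) ?_ ?_ ?_
  · rw [map_theta, hG]
  · rw [euler_one, zero_mul]
  · rw [coeff_map, coeff_zero_theta, map_one, coeff_zero_one]

/-- For l = m evaluation undoes T_l, so the image of Θ_l and 1 - t^l v solve the same differential
equation with constant term 1. This yields exp(log f) = f for the f in question without composing
power series. -/
theorem map_gEval_theta (l m : ℕ+) (v : RatExt R) :
    map (gEval R m).toRingHom (theta l (1 - monomial (l : ℕ) v))
      = if l = m then 1 - monomial (l : ℕ) v else 1 := by
  split_ifs with h
  · subst h
    refine eq_of_euler_eq_mul (G := euler (logSeries (1 - monomial (l : ℕ) v))) ?_ ?_ ?_ ?_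
    · rw [coeff_euler, zero_smul]
    · rw [map_theta]
      congr 1
      ext n
      rw [coeff_map, coeff_euler, map_nsmul, logT, coeff_mk, coeff_euler]
      congr 1
      exact (gEval_tElem R l l _).trans (if_pos rfl)
    · exact euler_logSeries _ l.pos v
    · rw [coeff_map, coeff_zero_theta, map_one, map_sub, coeff_zero_one, coeff_monomial,
        if_neg l.ne_zero.symm, sub_zero]
  · exact map_theta_of_eq_zero _ _ _ fun a => (gEval_tElem R m l a).trans (if_neg h)

theorem map_gCounit_theta (l : ℕ+) (v : RatExt R) :
    map (gCounit R).toRingHom (theta l (1 - monomial (l : ℕ) v)) = 1 :=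
  map_theta_of_eq_zero _ _ _ fun a => gCounit_tElem l a

/-- The two inclusions into the tensor square. -/
abbrev gInl (R : Type*) [Ring R] : GInfQ R →ₐ[ℚ] GInfQ R ⊗[ℚ] GInfQ R :=
  Algebra.TensorProduct.includeLeft

/-- The inclusion of the second factor of the tensor square. -/
abbrev gInr (R : Type*) [Ring R] : GInfQ R →ₐ[ℚ] GInfQ R ⊗[ℚ] GInfQ R :=
  Algebra.TensorProduct.includeRight

theorem commute_gInl_gInr (x y : GInfQ R) : Commute (gInl R x) (gInr R y) := by
  simp [Commute, SemiconjBy]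

/-- By primitivity of the T_l the logarithmic derivative of the image is the sum of those of the two
inclusions. As the inclusions commute, the product on the right solves the same equation. -/
theorem map_gComul_theta (l : ℕ+) (v : RatExt R) :
    map (gComul R).toRingHom (theta l (1 - monomial (l : ℕ) v))
      = map (gInl R).toRingHom (theta l (1 - monomial (l : ℕ) v))
        * map (gInr R).toRingHom (theta l (1 - monomial (l : ℕ) v)) := by
  have hcom : ∀ f g : (GInfQ R)⟦X⟧,
      Commute (map (gInl R).toRingHom f) (map (gInr R).toRingHom g) := fun f g =>
    commute_of_coeff fun i j => by
      rw [coeff_map, coeff_map]; exact commute_gInl_gInr _ _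
  have hG : map (gComul R).toRingHom (euler (logT l v))
      = map (gInl R).toRingHom (euler (logT l v)) + map (gInr R).toRingHom (euler (logT l v)) := by
    ext n
    rw [map_add, coeff_map, coeff_map, coeff_map, coeff_euler, map_nsmul, map_nsmul, map_nsmul,
      ← smul_add, logT, coeff_mk]
    congr 1
    exact gComul_tElem _ _
  refine eq_of_euler_eq_mul (G := map (gComul R).toRingHom (euler (logT l v))) ?_ ?_ ?_ ?_
  · rw [coeff_map, coeff_euler, zero_smul, map_zero]
  · exact map_theta _ _ _
  · rw [euler_mul, map_theta, map_theta, hG, add_mul, mul_assoc]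
    congr 1
    rw [← mul_assoc, ← mul_assoc, (hcom _ _).eq]
  · rw [coeff_map, coeff_zero_theta, map_one, coeff_mul]
    simp [coeff_zero_theta, Algebra.TensorProduct.one_def]

end Theta

/-! ### The elements e_n(U): evaluations, comultiplication and leading terms -/

section Elements
open PowerSeries
variable {R : Type*} [Ring R]

/-- The product of the first `N` factors of `E_U(t)`. -/
def partialE (N : ℕ) (U : R) : (GInfQ R)⟦X⟧ :=
  ((List.range N).map fun i => theta i.succPNat (1 - (-X) ^ (i + 1) * C (ratExtOf R U))).prod

/-- The coefficient `(-1)^l U` in the `l`-th factor of `E_U(t)`. -/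
def signed (l : ℕ) (U : R) : RatExt R := (-1) ^ l * ratExtOf R U

theorem partialE_eq (N : ℕ) (U : R) : partialE N U = ((List.range N).map fun i =>
    theta i.succPNat (1 - monomial (i.succPNat : ℕ) (signed (i + 1) U))).prod := by
  simp only [partialE, one_sub_neg_X_pow_mul_C]
  rfl

theorem partialE_succ (N : ℕ) (U : R) : partialE (N + 1) U = partialE N U *
    theta N.succPNat (1 - monomial (N.succPNat : ℕ) (signed (N + 1) U)) := by
  rw [partialE_eq, partialE_eq, List.range_succ]
  simp

theorem eElem_eq (n : ℕ) (U : R) : eElem n U = coeff n (partialE n U) := rfl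

/-- The coefficients of `Θ_l(1 - t^l v)` below `t^l` vanish, and that of `t^l` is `-T_l(v)`. -/
theorem coeff_theta_of_le (l : ℕ+) (v : RatExt R) {n : ℕ} (hn : 0 < n) (hnl : n ≤ l) :
    coeff n (theta l (1 - monomial (l : ℕ) v)) = if n = l then -tElem R l v else 0 := by
  have h : (n : ℚ) • coeff n (theta l (1 - monomial (l : ℕ) v))
      = (n : ℚ) • (if n = l then -tElem R l v else 0) := by
    rw [Nat.cast_smul_eq_nsmul, Nat.cast_smul_eq_nsmul, ← coeff_euler, euler_theta, coeff_mul,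
      Finset.sum_eq_single (n, 0)]
    · rw [coeff_zero_theta, mul_one, coeff_euler, coeff_logT]
      congr 1
      by_cases h : n = l
      · subst h
        simp [Nat.div_self l.pos]
      · rw [if_neg h, if_neg]
        rintro ⟨h1, -⟩
        exact h (le_antisymm hnl (Nat.le_of_dvd hn h1))
    · intro p hp hne
      have hp' := Finset.HasAntidiagonal.mem_antidiagonal.1 hp
      rw [coeff_euler, coeff_logT, if_neg, smul_zero, zero_mul]
      rintro ⟨h1, h2⟩
      have := Nat.le_of_dvd h2 h1
      exact hne (Prod.ext (by simp only; omega) (by simp only; omega))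
    · intro h
      exact absurd (Finset.HasAntidiagonal.mem_antidiagonal.2 (by simp)) h
  exact smul_right_injective _ (by exact_mod_cast hn.ne' : (n : ℚ) ≠ 0) h

/-- The new factor is 1 modulo t^(N+1), so lower coefficients are stable. This lets the infinite
product be handled through finite ones. -/
theorem coeff_partialE_succ_of_le {n N : ℕ} (h : n ≤ N) (U : R) :
    coeff n (partialE (N + 1) U) = coeff n (partialE N U) := by
  rw [partialE_succ, coeff_mul, Finset.sum_eq_single (n, 0)]
  · rw [coeff_zero_theta, mul_one]
  · intro p hp hne
    have hp' := Finset.HasAntidiagonal.mem_antidiagonal.1 hp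
    have h2 : 0 < p.2 := by
      by_contra h0
      exact hne (Prod.ext (by simp only; omega) (by simp only; omega))
    rw [coeff_theta_of_le _ _ h2 (by rw [Nat.succPNat_coe]; omega),
      if_neg (by rw [Nat.succPNat_coe]; omega), mul_zero]
  · intro h
    exact absurd (Finset.HasAntidiagonal.mem_antidiagonal.2 (by simp)) h

theorem coeff_partialE {n N : ℕ} (h : n ≤ N) (U : R) : coeff n (partialE N U) = eElem n U := by
  induction N, h using Nat.le_induction with
  | base => rfl
  | succ N hN ih => rw [coeff_partialE_succ_of_le hN, ih]

theorem eElem_zero (U : R) : eElem 0 U = 1 := by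
  rw [eElem_eq, partialE]
  simp

/-- `e_n(U)` is `± T_n(U)` up to terms from the first `n - 1` tensor factors. -/
theorem eElem_succ (n : ℕ) (U : R) : eElem (n + 1) U =
    coeff (n + 1) (partialE n U) - tElem R n.succPNat (signed (n + 1) U) := by
  rw [eElem_eq, partialE_succ, coeff_mul, Finset.sum_eq_add_of_mem (n + 1, 0) (0, n + 1)]
  · rw [coeff_zero_theta, mul_one, coeff_theta_of_le _ _ (Nat.succ_pos n) le_rfl,
      if_pos (show n.succ = (n.succPNat : ℕ) from rfl),
      coeff_partialE (Nat.zero_le n), eElem_zero, one_mul, sub_eq_add_neg]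
  · simp
  · simp
  · simp
  · rintro p hp ⟨h1, h2⟩
    have hp' := Finset.HasAntidiagonal.mem_antidiagonal.1 hp
    have h3 : 0 < p.2 := by
      by_contra h0
      exact h1 (Prod.ext (by simp only; omega) (by simp only; omega))
    have h4 : p.2 ≠ n + 1 := by
      intro h0
      exact h2 (Prod.ext (by simp only; omega) (by simp only; omega))
    rw [coeff_theta_of_le _ _ h3 (by rw [Nat.succPNat_coe]; omega),
      if_neg (by rw [Nat.succPNat_coe]; omega), mul_zero]

theorem map_partialE_eq_one {B : Type*} [Ring B] [Algebra ℚ B] (φ : GInfQ R →ₐ[ℚ] B)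
    (N : ℕ) (U : R) (h : ∀ i < N, map φ.toRingHom (theta i.succPNat
      (1 - monomial (i.succPNat : ℕ) (signed (i + 1) U))) = 1) :
    map φ.toRingHom (partialE N U) = 1 := by
  induction N with
  | zero => simp [partialE]
  | succ N ih =>
    rw [partialE_succ, map_mul, ih fun i hi => h i (hi.trans (Nat.lt_succ_self N)),
      h N (Nat.lt_succ_self N), mul_one]

/-- Every factor except the l-th is augmented to 1. -/
theorem map_gEval_partialE (l : ℕ+) {N : ℕ} (h : l ≤ N) (U : R) :
    map (gEval R l).toRingHom (partialE N U) = 1 - monomial (l : ℕ) (signed l U) := by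
  induction N, h using Nat.le_induction with
  | base =>
    obtain ⟨n, rfl⟩ : ∃ n : ℕ, n.succPNat = l := ⟨l.natPred, by simp⟩
    rw [Nat.succPNat_coe, Nat.succ_eq_add_one, partialE_succ, map_mul, map_partialE_eq_one,
      map_gEval_theta, if_pos rfl, one_mul]
    · rfl
    · intro i hi
      rw [map_gEval_theta, if_neg]
      intro h
      exact hi.ne (Nat.succPNat_injective h)
  | succ N hN ih =>
    rw [partialE_succ, map_mul, ih, map_gEval_theta, if_neg, mul_one]
    rintro rfl
    simp at hN

theorem gEval_eElem (l : ℕ+) (n : ℕ) (U : R) :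
    gEval R l (eElem n U) = if n = 0 then 1 else if n = l then -signed n U else 0 := by
  rw [← coeff_partialE (le_max_left n l) U]
  have h := congrArg (coeff n) (map_gEval_partialE l (le_max_right n l) U)
  rw [coeff_map, map_sub, coeff_one, coeff_monomial] at h
  refine Eq.trans h ?_
  by_cases h0 : n = 0
  · simp [h0, l.ne_zero.symm]
  · by_cases hl : n = l
    · simp [hl]
    · simp [h0, hl]

theorem gCounit_eElem (n : ℕ) (U : R) : gCounit R (eElem n U) = if n = 0 then 1 else 0 := by
  rw [eElem_eq]
  have h := congrArg (coeff n) (map_partialE_eq_one (gCounit R) n U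
    (fun i _ => map_gCounit_theta _ _))
  rwa [coeff_map, coeff_one] at h

theorem map_gComul_partialE (N : ℕ) (U : R) : map (gComul R).toRingHom (partialE N U)
    = map (gInl R).toRingHom (partialE N U) * map (gInr R).toRingHom (partialE N U) := by
  have hcom : ∀ f g : (GInfQ R)⟦X⟧,
      Commute (map (gInl R).toRingHom f) (map (gInr R).toRingHom g) := fun f g =>
    commute_of_coeff fun i j => by
      rw [coeff_map, coeff_map]; exact commute_gInl_gInr _ _
  induction N with
  | zero => simp [partialE]
  | succ N ih =>
    rw [partialE_succ, map_mul, map_mul, map_mul, ih, map_gComul_theta, mul_assoc, mul_assoc]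
    congr 1
    rw [← mul_assoc, ← mul_assoc, (hcom _ _).eq]

theorem gComul_eElem (n : ℕ) (U : R) : gComul R (eElem n U) =
    ∑ p ∈ Finset.HasAntidiagonal.antidiagonal n, eElem p.1 U ⊗ₜ[ℚ] eElem p.2 U := by
  have h := congrArg (coeff n) (map_gComul_partialE n U)
  rw [coeff_map, coeff_mul] at h
  refine Eq.trans h (Finset.sum_congr rfl fun p hp => ?_)
  have hp' := Finset.HasAntidiagonal.mem_antidiagonal.1 hp
  rw [coeff_map, coeff_map, coeff_partialE (by omega), coeff_partialE (by omega)]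
  change (eElem p.1 U ⊗ₜ[ℚ] (1 : GInfQ R)) * ((1 : GInfQ R) ⊗ₜ[ℚ] eElem p.2 U) = _
  rw [Algebra.TensorProduct.tmul_mul_tmul, mul_one, one_mul]

/-- The numbers of the first `k` tensor factors. -/
def firstIndex (k : ℕ) (j : Fin k) : ℕ+ := (j : ℕ).succPNat

theorem firstIndex_injective (k : ℕ) : Function.Injective (firstIndex k) := fun _ _ h =>
  Fin.ext (Nat.succPNat_injective h)

/-- With l = i + 1, the logarithm has a term T_l of weight l^2 at each exponent lm with m ≥ 1, that
is, weight at most l per power of t. The recursion given by the differential equation preserves this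
rate. -/
theorem coeff_theta_mem {k i : ℕ} (hi : i < k) (v : RatExt R) (n : ℕ) :
    coeff n (theta i.succPNat (1 - monomial (i.succPNat : ℕ) v)) ∈
      wordFil ℚ (tGen (R := R) (firstIndex k)) (sqWeight (firstIndex k)) ((i + 1) * n + 1) := by
  induction n using Nat.strong_induction_on with
  | _ n ih =>
    rcases Nat.eq_zero_or_pos n with rfl | hn
    · rw [coeff_zero_theta]
      exact one_mem_wordFil (by omega)
    have hn' : (n : ℚ) ≠ 0 := by exact_mod_cast hn.ne'
    refine (Submodule.smul_mem_iff _ hn').1 ?_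
    rw [Nat.cast_smul_eq_nsmul, ← coeff_euler, euler_theta, coeff_mul]
    refine sum_mem fun p hp => ?_
    have hp' := Finset.HasAntidiagonal.mem_antidiagonal.1 hp
    rw [coeff_euler, coeff_logT]
    split_ifs with h
    · obtain ⟨⟨m, hm⟩, h0⟩ := h
      rw [Nat.succPNat_coe, Nat.succ_eq_add_one] at hm
      have hm0 : 1 ≤ m := Nat.pos_of_ne_zero (by rintro rfl; simp at hm; omega)
      refine mul_mem_wordFil (d := (i + 1) * p.1 + 1) (e := (i + 1) * p.2 + 1) ?_ ?_ (ih _ (by omega))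
      · rw [← hp']; ring_nf; omega
      · have hw : sqWeight (firstIndex k)
            ((⟨i, hi⟩, v ^ (p.1 / (i.succPNat : ℕ))) : Fin k × RatExt R) < (i + 1) * p.1 + 1 := by
          change (i + 1) ^ 2 < (i + 1) * p.1 + 1
          have : (i + 1) * (i + 1) * 1 ≤ (i + 1) * (i + 1) * m := Nat.mul_le_mul_left _ hm0
          rw [hm, sq, ← mul_assoc]
          omega
        have hm := mem_wordFil (K := ℚ) (g := tGen (R := R) (firstIndex k)) _ hw
        exact nsmul_mem (Submodule.smul_mem _ _ hm) p.1
    · rw [smul_zero, zero_mul]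
      exact zero_mem _

/-- The l-th factor contributes weight at most l per power of t, and l ≤ N. -/
theorem coeff_partialE_mem {k N : ℕ} (hN : N ≤ k) (U : R) (n : ℕ) :
    coeff n (partialE N U) ∈
      wordFil ℚ (tGen (R := R) (firstIndex k)) (sqWeight (firstIndex k)) (N * n + 1) := by
  induction N generalizing n with
  | zero =>
    rw [partialE, List.range_zero, List.map_nil, List.prod_nil, coeff_one]
    split_ifs
    · exact one_mem_wordFil (by omega)
    · exact zero_mem _
  | succ N ih =>
    rw [partialE_succ, coeff_mul]
    refine sum_mem fun p hp => ?_
    have hp' := Finset.HasAntidiagonal.mem_antidiagonal.1 hp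
    refine mul_mem_wordFil ?_ (ih (by omega) p.1) (coeff_theta_mem (by omega) _ p.2)
    rw [← hp']
    nlinarith [Nat.zero_le p.1]

/-- `e_n(U)` is `± T_n(U)` up to terms of lower weight. -/
theorem eElem_add_tElem_mem {k n : ℕ} (hn : n < k) (U : R) :
    eElem (n + 1) U + tElem R n.succPNat (signed (n + 1) U) ∈
      wordFil ℚ (tGen (R := R) (firstIndex k)) (sqWeight (firstIndex k)) ((n + 1) ^ 2) := by
  rw [eElem_succ, sub_add_cancel]
  -- The first n factors contribute weight at most n(n + 1) to the coefficient of t^(n+1), which is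
  -- less than (n + 1)^2.
  exact wordFil_mono (by nlinarith) (coeff_partialE_mem hn.le U (n + 1))

end Elements

/-! ### Convolution sums along an injective map of exponents -/

section Antidiagonal

variable {M N Z : Type*} [AddCommMonoid M] [AddCommMonoid N] [Finset.HasAntidiagonal M]
  [Finset.HasAntidiagonal N] [AddCommMonoid Z]

theorem sum_antidiagonal_of_injective (φ : M →+ N) (hφ : Function.Injective φ) (h : N → N → Z)
    (h1 : ∀ a b, a ∉ Set.range φ → h a b = 0) (h2 : ∀ a b, b ∉ Set.range φ → h a b = 0) (m : M) :
    ∑ p ∈ Finset.HasAntidiagonal.antidiagonal (φ m), h p.1 p.2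
      = ∑ p ∈ Finset.HasAntidiagonal.antidiagonal m, h (φ p.1) (φ p.2) := by
  symm
  refine Finset.sum_of_injOn (Prod.map φ φ) (hφ.prodMap hφ).injOn ?_ ?_ fun _ _ => rfl
  · intro p hp
    rw [Finset.mem_coe, Finset.HasAntidiagonal.mem_antidiagonal] at hp ⊢
    rw [← hp, map_add]; rfl
  · rintro ⟨a, b⟩ hp hne
    by_cases ha : a ∈ Set.range φ
    · by_cases hb : b ∈ Set.range φ
      · obtain ⟨a, rfl⟩ := ha
        obtain ⟨b, rfl⟩ := hb
        rw [Finset.HasAntidiagonal.mem_antidiagonal, ← map_add] at hp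
        exact absurd ⟨(a, b), by simpa using hφ hp, rfl⟩ hne
      · exact h2 _ _ hb
    · exact h1 _ _ ha

omit [Finset.HasAntidiagonal M] in
theorem sum_antidiagonal_of_notMem_range (φ : M →+ N) (h : N → N → Z)
    (h1 : ∀ a b, a ∉ Set.range φ → h a b = 0) (h2 : ∀ a b, b ∉ Set.range φ → h a b = 0) {n : N}
    (hn : n ∉ Set.range φ) : ∑ p ∈ Finset.HasAntidiagonal.antidiagonal n, h p.1 p.2 = 0 := by
  refine Finset.sum_eq_zero fun p hp => ?_
  by_cases ha : p.1 ∈ Set.range φ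
  · refine h2 _ _ fun hb => hn ?_
    obtain ⟨a, ha⟩ := ha
    obtain ⟨b, hb⟩ := hb
    exact ⟨a + b, by rw [map_add, ha, hb, Finset.HasAntidiagonal.mem_antidiagonal.1 hp]⟩
  · exact h1 _ _ ha

end Antidiagonal

/-! ### Substitutions and factorizations of multivariate power series -/

section Series
open MvPowerSeries

variable {σ M A : Type*} [AddCommMonoid M] [Ring A]

/-- The power series with the coefficients `f m` at the exponents `φ m`. -/
def extendSeries (φ : M →+ (σ →₀ ℕ)) (f : M → A) : MvPowerSeries σ A := Function.extend φ f 0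

theorem coeff_extendSeries {φ : M →+ (σ →₀ ℕ)} (hφ : Function.Injective φ) (f : M → A) (m : M) :
    coeff (φ m) (extendSeries φ f) = f m := hφ.extend_apply f 0 m

theorem coeff_extendSeries_of_notMem {φ : M →+ (σ →₀ ℕ)} (f : M → A) {β : σ →₀ ℕ}
    (h : β ∉ Set.range φ) : coeff β (extendSeries φ f) = 0 :=
  Function.extend_apply' _ _ _ (by simpa using h)


theorem extendSeries_mul [Finset.HasAntidiagonal M] [DecidableEq σ] {φ : M →+ (σ →₀ ℕ)}
    (hφ : Function.Injective φ) {f g h : M → A}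
    (H : ∀ m, h m = ∑ p ∈ Finset.HasAntidiagonal.antidiagonal m, f p.1 * g p.2) :
    extendSeries φ h = extendSeries φ f * extendSeries φ g := by
  have h1 : ∀ a b, a ∉ Set.range φ → coeff a (extendSeries φ f) * coeff b (extendSeries φ g) = 0 :=
    fun a b ha => by rw [coeff_extendSeries_of_notMem f ha, zero_mul]
  have h2 : ∀ a b, b ∉ Set.range φ → coeff a (extendSeries φ f) * coeff b (extendSeries φ g) = 0 :=
    fun a b hb => by rw [coeff_extendSeries_of_notMem g hb, mul_zero]
  refine MvPowerSeries.ext fun β => ?_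
  rw [coeff_mul]
  by_cases hβ : β ∈ Set.range φ
  · obtain ⟨m, rfl⟩ := hβ
    rw [sum_antidiagonal_of_injective φ hφ
      (fun a b => coeff a (extendSeries φ f) * coeff b (extendSeries φ g)) h1 h2 m,
      coeff_extendSeries hφ, H]
    simp only [coeff_extendSeries hφ]
  · rw [sum_antidiagonal_of_notMem_range φ
      (fun a b => coeff a (extendSeries φ f) * coeff b (extendSeries φ g)) h1 h2 hβ,
      coeff_extendSeries_of_notMem _ hβ]

/-- Multiplication of the exponents by `l`. -/
abbrev dilate (σ : Type*) (l : ℕ+) : (σ →₀ ℕ) →+ (σ →₀ ℕ) := nsmulAddMonoidHom (l : ℕ)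

theorem dilate_injective (l : ℕ+) : Function.Injective (dilate σ l) := fun _ _ h =>
  smul_right_injective _ l.ne_zero h

/-- The substitution `t ↦ t^l` in all variables. -/
def expandHom [DecidableEq σ] (l : ℕ+) : MvPowerSeries σ A →+* MvPowerSeries σ A where
  toFun f := extendSeries (dilate σ l) fun m => coeff m f
  map_zero' := by
    refine MvPowerSeries.ext fun β => ?_
    by_cases hβ : β ∈ Set.range (dilate σ l)
    · obtain ⟨m, rfl⟩ := hβ
      rw [coeff_extendSeries (dilate_injective l)]; simp
    · rw [coeff_extendSeries_of_notMem _ hβ]; simp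
  map_one' := by
    refine MvPowerSeries.ext fun β => ?_
    by_cases hβ : β ∈ Set.range (dilate σ l)
    · obtain ⟨m, rfl⟩ := hβ
      rw [coeff_extendSeries (dilate_injective l), coeff_one, coeff_one]
      refine if_congr ?_ rfl rfl
      exact ⟨fun h => by rw [h, map_zero], fun h => dilate_injective l (h.trans (map_zero _).symm)⟩
    · rw [coeff_extendSeries_of_notMem _ hβ, coeff_one, if_neg]
      rintro rfl
      exact hβ ⟨0, map_zero _⟩
  map_add' f g := by
    refine MvPowerSeries.ext fun β => ?_
    by_cases hβ : β ∈ Set.range (dilate σ l)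
    · obtain ⟨m, rfl⟩ := hβ
      rw [map_add]
      simp only [coeff_extendSeries (dilate_injective l)]
      exact map_add _ _ _
    · rw [map_add]
      simp only [coeff_extendSeries_of_notMem _ hβ, add_zero]
  map_mul' f g := extendSeries_mul (dilate_injective l) fun m => coeff_mul _ _ _

theorem coeff_expandHom [DecidableEq σ] (l : ℕ+) (f : MvPowerSeries σ A) (m : σ →₀ ℕ) :
    coeff ((l : ℕ) • m) (expandHom l f) = coeff m f :=
  coeff_extendSeries (dilate_injective l) _ m

theorem coeff_expandHom_of_notMem [DecidableEq σ] (l : ℕ+) (f : MvPowerSeries σ A) {β : σ →₀ ℕ}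
    (h : β ∉ Set.range (dilate σ l)) : coeff β (expandHom l f) = 0 :=
  coeff_extendSeries_of_notMem _ h

theorem expandHom_monomial [DecidableEq σ] (l : ℕ+) (α : σ →₀ ℕ) (a : A) :
    expandHom l (monomial α a) = monomial ((l : ℕ) • α) a := by
  refine MvPowerSeries.ext fun β => ?_
  by_cases hβ : β ∈ Set.range (dilate σ l)
  · obtain ⟨m, rfl⟩ := hβ
    refine (coeff_expandHom l _ m).trans ?_
    rw [coeff_monomial, coeff_monomial]
    exact if_congr (dilate_injective l).eq_iff.symm rfl rfl
  · rw [coeff_expandHom_of_notMem _ _ hβ, coeff_monomial, if_neg]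
    rintro rfl
    exact hβ ⟨α, rfl⟩

/-- Substitution preserves congruence on sets of exponents closed under passing to smaller ones. -/
theorem coeff_expandHom_congr [DecidableEq σ] (l : ℕ+) {f g : MvPowerSeries σ A}
    {T : Set (σ →₀ ℕ)} (hT : IsLowerSet T) (h : ∀ β ∈ T, coeff β f = coeff β g)
    (β : σ →₀ ℕ) (hβ : β ∈ T) : coeff β (expandHom l f) = coeff β (expandHom l g) := by
  by_cases hr : β ∈ Set.range (dilate σ l)
  · obtain ⟨m, rfl⟩ := hr
    refine (coeff_expandHom l _ m).trans (Eq.trans ?_ (coeff_expandHom l _ m).symm)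
    refine h m (hT ?_ hβ)
    intro i
    exact Nat.le_mul_of_pos_left _ l.pos
  · rw [coeff_expandHom_of_notMem _ _ hr, coeff_expandHom_of_notMem _ _ hr]

/-- The product of the factors `1 - t^α W`. -/
def factorProd (L : List ((σ →₀ ℕ) × A)) : MvPowerSeries σ A :=
  (L.map fun p => 1 - monomial p.1 p.2).prod

theorem factorProd_append (L L' : List ((σ →₀ ℕ) × A)) :
    factorProd (L ++ L') = factorProd L * factorProd L' := by
  simp [factorProd]

theorem factorProd_singleton (α : σ →₀ ℕ) (a : A) :
    factorProd [(α, a)] = 1 - monomial α a := by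
  simp [factorProd]

/-- A power series with constant term `1` is, to any finite order, a product of factors `1 - t^α W`. -/
theorem exists_factorProd {𝒜 : Set (σ →₀ ℕ)} (h𝒜 : IsUpperSet 𝒜) (h0 : 0 ∉ 𝒜)
    {P f : MvPowerSeries σ A} (hP : coeff 0 P = 1) (hoff : ∀ β ∉ 𝒜, coeff β P = coeff β f)
    (T : Finset (σ →₀ ℕ)) (hT : IsLowerSet (T : Set (σ →₀ ℕ))) :
    ∃ L : List ((σ →₀ ℕ) × A), (∀ p ∈ L, p.1 ∈ 𝒜) ∧
      (∀ β ∉ 𝒜, coeff β (P * factorProd L) = coeff β f) ∧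
      ∀ β ∈ T, coeff β (P * factorProd L) = coeff β f := by
  classical
  induction T using Finset.strongInduction with
  | H T ih =>
    rcases T.eq_empty_or_nonempty with rfl | hne
    · exact ⟨[], by simp, by simpa [factorProd] using hoff, by simp⟩
    -- Removing a maximal exponent keeps the set lower, and a factor 1 - t^α W then affects no other
    -- exponent of T.
    obtain ⟨α, hα⟩ := Finset.exists_maximal hne
    have hlow : IsLowerSet ((T.erase α : Finset (σ →₀ ℕ)) : Set (σ →₀ ℕ)) := by
      intro a c hca ha
      rw [Finset.mem_coe, Finset.mem_erase] at ha ⊢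
      refine ⟨?_, hT hca ha.2⟩
      rintro rfl
      exact ha.1 (le_antisymm (hα.2 ha.2 hca) hca)
    obtain ⟨L, hL, hoffL, hTL⟩ := ih _ (Finset.erase_ssubset hα.1) hlow
    by_cases hα𝒜 : α ∈ 𝒜
    -- The constant term of the product so far is 1, so the new factor subtracts W from the
    -- coefficient at α; W is chosen as the excess there. Exponents outside 𝒜 are not above α and
    -- remain correct.
    · refine ⟨L ++ [(α, coeff α (P * factorProd L) - coeff α f)], ?_, ?_, ?_⟩
      · intro p hp
        rcases List.mem_append.1 hp with h | h
        · exact hL p h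
        · rw [List.mem_singleton.1 h]; exact hα𝒜
      · intro β hβ
        rw [factorProd_append, factorProd_singleton, ← mul_assoc, mul_sub, mul_one, map_sub,
          coeff_mul_monomial, if_neg fun h => hβ (h𝒜 h hα𝒜), sub_zero, hoffL β hβ]
      · intro β hβ
        rw [factorProd_append, factorProd_singleton, ← mul_assoc, mul_sub, mul_one, map_sub,
          coeff_mul_monomial]
        by_cases h : α ≤ β
        · obtain rfl : β = α := le_antisymm (hα.2 hβ h) h
          rw [if_pos h, tsub_self, hoffL 0 h0, ← hoff 0 h0, hP, one_mul, sub_sub_cancel]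
        · rw [if_neg h, sub_zero]
          refine hTL β (Finset.mem_erase.2 ⟨?_, hβ⟩)
          rintro rfl
          exact h le_rfl
    · refine ⟨L, hL, hoffL, fun β hβ => ?_⟩
      by_cases h : β = α
      · subst h; exact hoffL β hα𝒜
      · exact hTL β (Finset.mem_erase.2 ⟨h, hβ⟩)

end Series

/-! ### Grouplike series and their rigidity -/

section Grouplike
open MvPowerSeries

variable {σ : Type*} [DecidableEq σ] {R : Type*} [Ring R]

theorem commute_of_mv_coeff {A : Type*} [Ring A] {f g : MvPowerSeries σ A}
    (h : ∀ i j, Commute (coeff i f) (coeff j g)) : Commute f g := by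
  refine MvPowerSeries.ext fun n => ?_
  rw [coeff_mul, coeff_mul]
  conv_lhs => rw [← Finset.HasAntidiagonal.map_swap_antidiagonal, Finset.sum_map]
  exact Finset.sum_congr rfl fun p _ => (h _ _).eq

/-- A power series whose coefficients satisfy `Δ(G) = G ⊗ G` and which has constant term `1`. -/
structure IsGrouplikeSeries (G : MvPowerSeries σ (GInfQ R)) : Prop where
  coeff_zero : coeff 0 G = 1
  counit : map (gCounit R).toRingHom G = 1
  comul : map (gComul R).toRingHom G = map (gInl R).toRingHom G * map (gInr R).toRingHom G

omit [DecidableEq σ] in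
theorem IsGrouplikeSeries.one : IsGrouplikeSeries (1 : MvPowerSeries σ (GInfQ R)) where
  coeff_zero := by simp
  counit := map_one _
  comul := by rw [map_one, map_one, map_one, one_mul]

theorem IsGrouplikeSeries.mul {G G' : MvPowerSeries σ (GInfQ R)} (h : IsGrouplikeSeries G)
    (h' : IsGrouplikeSeries G') : IsGrouplikeSeries (G * G') where
  coeff_zero := by
    rw [coeff_mul, Finset.HasAntidiagonal.antidiagonal_zero, Finset.sum_singleton, h.coeff_zero, h'.coeff_zero,
      one_mul]
  counit := by rw [map_mul, h.counit, h'.counit, one_mul]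
  comul := by
    have hcom : Commute (map (gInl R).toRingHom G') (map (gInr R).toRingHom G) :=
      commute_of_mv_coeff fun i j => by
        rw [coeff_map, coeff_map]; exact commute_gInl_gInr _ _
    rw [map_mul, map_mul, map_mul, h.comul, h'.comul, mul_assoc, mul_assoc]
    congr 1
    rw [← mul_assoc, ← mul_assoc, hcom.eq]

theorem IsGrouplikeSeries.list_prod {L : List (MvPowerSeries σ (GInfQ R))}
    (h : ∀ G ∈ L, IsGrouplikeSeries G) : IsGrouplikeSeries L.prod := by
  induction L with
  | nil => exact .one
  | cons G L ih =>
    rw [List.prod_cons]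
    exact (h G (by simp)).mul (ih fun G' hG' => h G' (by simp [hG']))

theorem IsGrouplikeSeries.gComul_coeff {G : MvPowerSeries σ (GInfQ R)} (h : IsGrouplikeSeries G)
    (β : σ →₀ ℕ) : gComul R (coeff β G) = ∑ p ∈ Finset.HasAntidiagonal.antidiagonal β,
      coeff p.1 G ⊗ₜ[ℚ] coeff p.2 G := by
  have h1 := congrArg (coeff β) h.comul
  rw [coeff_map, coeff_mul] at h1
  refine Eq.trans h1 (Finset.sum_congr rfl fun p _ => ?_)
  rw [coeff_map, coeff_map]
  change (coeff p.1 G ⊗ₜ[ℚ] (1 : GInfQ R)) * ((1 : GInfQ R) ⊗ₜ[ℚ] coeff p.2 G) = _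
  rw [Algebra.TensorProduct.tmul_mul_tmul, mul_one, one_mul]

theorem IsGrouplikeSeries.gCounit_coeff {G : MvPowerSeries σ (GInfQ R)} (h : IsGrouplikeSeries G)
    (β : σ →₀ ℕ) : gCounit R (coeff β G) = if β = 0 then 1 else 0 := by
  have h1 := congrArg (coeff β) h.counit
  rwa [coeff_map, coeff_one] at h1

/-- A grouplike series is determined by its images in `ℚ ⊗ R`. -/
theorem IsGrouplikeSeries.coeff_congr [Module.Free ℤ R] [Finite σ]
    {G G' : MvPowerSeries σ (GInfQ R)}
    (h : IsGrouplikeSeries G) (h' : IsGrouplikeSeries G') {T : Set (σ →₀ ℕ)} (hT : IsLowerSet T)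
    (heq : ∀ l, ∀ β ∈ T, coeff β (map (gEval R l).toRingHom G)
      = coeff β (map (gEval R l).toRingHom G')) (β : σ →₀ ℕ) (hβ : β ∈ T) :
    coeff β G = coeff β G' := by
  induction β using WellFoundedLT.induction with
  | ind β ih =>
    by_cases h0 : β = 0
    · rw [h0, h.coeff_zero, h'.coeff_zero]
    rw [← sub_eq_zero]
    -- By induction the two series agree at all smaller exponents, so the mixed terms of the
    -- comultiplications cancel and the difference of the coefficients at β is primitive.
    refine eq_zero_of_gComul ?_ ?_ ?_
    · rw [map_sub, h.gComul_coeff, h'.gComul_coeff, ← Finset.sum_sub_distrib,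
        Finset.sum_eq_add_of_mem (β, 0) (0, β)]
      · simp only [h.coeff_zero, h'.coeff_zero, TensorProduct.sub_tmul, TensorProduct.tmul_sub]
      · simp
      · simp
      · intro e
        exact h0 (congrArg Prod.fst e)
      · rintro ⟨a, c⟩ hp ⟨h1, h2⟩
        rw [Finset.HasAntidiagonal.mem_antidiagonal] at hp
        simp only at hp
        have ha : a ≠ 0 := by rintro rfl; exact h2 (by rw [← hp, zero_add])
        have hc : c ≠ 0 := by rintro rfl; exact h1 (by rw [← hp, add_zero])
        have ha' : a < β := by
          rw [← hp]; exact lt_add_of_pos_right a (pos_iff_ne_zero.2 hc)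
        have hc' : c < β := by
          rw [← hp]; exact lt_add_of_pos_left c (pos_iff_ne_zero.2 ha)
        rw [ih a ha' (hT ha'.le hβ), ih c hc' (hT hc'.le hβ), sub_self]
    · rw [map_sub, h.gCounit_coeff, h'.gCounit_coeff, sub_self]
    · intro l
      have := heq l β hβ
      rw [coeff_map, coeff_map] at this
      rw [map_sub]
      exact sub_eq_zero.2 this

end Grouplike

/-! ### Products of the series E_W(-t^α), and their weights -/

section Rays
open MvPowerSeries

variable {R : Type*} [Ring R]

/-- The coefficient `(-1)^n e_n(U)` of `E_U(-t)`. -/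
def sElem (n : ℕ) (U : R) : GInfQ R := ((-1 : ℚ) ^ n) • eElem n U

theorem sElem_zero (U : R) : sElem 0 U = 1 := by
  rw [sElem, eElem_zero, pow_zero, one_smul]

theorem gComul_sElem (n : ℕ) (U : R) : gComul R (sElem n U) =
    ∑ p ∈ Finset.HasAntidiagonal.antidiagonal n, gInl R (sElem p.1 U) * gInr R (sElem p.2 U) := by
  rw [sElem, map_smul, gComul_eElem, Finset.smul_sum]
  refine Finset.sum_congr rfl fun p hp => ?_
  change _ = (sElem p.1 U ⊗ₜ[ℚ] (1 : GInfQ R)) * ((1 : GInfQ R) ⊗ₜ[ℚ] sElem p.2 U)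
  rw [Algebra.TensorProduct.tmul_mul_tmul, mul_one, one_mul, sElem, sElem, TensorProduct.tmul_smul,
    ← TensorProduct.smul_tmul', smul_smul, ← pow_add, add_comm p.2,
    Finset.HasAntidiagonal.mem_antidiagonal.1 hp]

theorem gCounit_sElem (n : ℕ) (U : R) : gCounit R (sElem n U) = if n = 0 then 1 else 0 := by
  rw [sElem, map_smul, gCounit_eElem]
  split_ifs with h
  · simp [h]
  · simp

/-- The sign of E_U(-t) cancels the sign (-1)^l in the l-th factor, so the evaluations become 1 -
t^l U. They differ only by the substitution t ↦ t^l, which is the reason for working with signed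
elements. -/
theorem gEval_sElem (l : ℕ+) (n : ℕ) (U : R) :
    gEval R l (sElem n U) = if n = 0 then 1 else if n = l then -ratExtOf R U else 0 := by
  rw [sElem, map_smul, gEval_eElem]
  split_ifs with h h'
  · simp [h]
  · have e : signed n U = ((-1 : ℚ) ^ n) • ratExtOf R U := by
      simp [signed, Algebra.smul_def]
    rw [e, smul_neg, smul_smul, ← mul_pow]
    simp
  · simp

variable {σ : Type*}

/-- The multiples of an exponent. -/
abbrev rayHom (α : σ →₀ ℕ) : ℕ →+ (σ →₀ ℕ) := multiplesHom _ α

theorem rayHom_injective {α : σ →₀ ℕ} (hα : α ≠ 0) : Function.Injective (rayHom α) := by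
  obtain ⟨i, hi⟩ := Finsupp.ne_iff.1 hα
  intro m n h
  have := DFunLike.congr_fun h i
  exact Nat.eq_of_mul_eq_mul_right (Nat.pos_of_ne_zero hi) this

/-- The series `E_U(-t^α)`. -/
def raySeries (α : σ →₀ ℕ) (U : R) : MvPowerSeries σ (GInfQ R) :=
  extendSeries (rayHom α) fun n => sElem n U

theorem coeff_raySeries {α : σ →₀ ℕ} (hα : α ≠ 0) (n : ℕ) (U : R) :
    coeff (n • α) (raySeries α U) = sElem n U :=
  coeff_extendSeries (rayHom_injective hα) _ n

theorem map_extendSeries {M A B : Type*} [AddCommMonoid M] [Ring A] [Ring B] (ψ : A →+* B)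
    {φ : M →+ (σ →₀ ℕ)} (hφ : Function.Injective φ) (f : M → A) :
    map ψ (extendSeries φ f) = extendSeries φ fun m => ψ (f m) := by
  refine MvPowerSeries.ext fun β => ?_
  rw [coeff_map]
  by_cases hβ : β ∈ Set.range φ
  · obtain ⟨m, rfl⟩ := hβ
    rw [coeff_extendSeries hφ, coeff_extendSeries hφ]
  · rw [coeff_extendSeries_of_notMem _ hβ, coeff_extendSeries_of_notMem _ hβ, map_zero]

theorem coeff_zero_raySeries {α : σ →₀ ℕ} (hα : α ≠ 0) (U : R) :
    coeff 0 (raySeries α U) = 1 := by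
  have := coeff_raySeries hα 0 U
  rwa [zero_smul, sElem_zero] at this

variable [DecidableEq σ]

theorem isGrouplikeSeries_raySeries {α : σ →₀ ℕ} (hα : α ≠ 0) (U : R) :
    IsGrouplikeSeries (raySeries α U) where
  coeff_zero := coeff_zero_raySeries hα U
  counit := by
    refine MvPowerSeries.ext fun β => ?_
    rw [raySeries, map_extendSeries _ (rayHom_injective hα), coeff_one]
    by_cases hβ : β ∈ Set.range (rayHom α)
    · obtain ⟨n, rfl⟩ := hβ
      rw [coeff_extendSeries (rayHom_injective hα)]
      refine (gCounit_sElem n U).trans (if_congr ?_ rfl rfl)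
      exact ⟨fun h => by rw [h, map_zero],
        fun h => rayHom_injective hα (h.trans (map_zero _).symm)⟩
    · rw [coeff_extendSeries_of_notMem _ hβ, if_neg]
      rintro rfl
      exact hβ ⟨0, map_zero _⟩
  comul := by
    rw [raySeries, map_extendSeries _ (rayHom_injective hα), map_extendSeries _ (rayHom_injective hα),
      map_extendSeries _ (rayHom_injective hα)]
    exact extendSeries_mul (rayHom_injective hα) fun n => gComul_sElem n U

theorem map_gEval_raySeries (l : ℕ+) {α : σ →₀ ℕ} (hα : α ≠ 0) (U : R) :
    map (gEval R l).toRingHom (raySeries α U) = 1 - monomial ((l : ℕ) • α) (ratExtOf R U) := by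
  refine MvPowerSeries.ext fun β => ?_
  rw [raySeries, map_extendSeries _ (rayHom_injective hα), map_sub, coeff_one, coeff_monomial]
  have hinj := rayHom_injective hα
  by_cases hβ : β ∈ Set.range (rayHom α)
  · obtain ⟨n, rfl⟩ := hβ
    rw [coeff_extendSeries hinj]
    refine (gEval_sElem l n U).trans ?_
    have e0 : rayHom α n = 0 ↔ n = 0 :=
      ⟨fun h => hinj (h.trans (map_zero _).symm), fun h => by rw [h, map_zero]⟩
    have el : rayHom α n = (l : ℕ) • α ↔ n = l := ⟨fun h => hinj h, fun h => by rw [h]; rfl⟩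
    simp only [e0, el]
    by_cases h : n = 0
    · simp [h, l.ne_zero.symm]
    · by_cases h' : n = l
      · simp [h']
      · simp [h, h']
  · rw [coeff_extendSeries_of_notMem _ hβ, if_neg, if_neg, sub_zero]
    · rintro rfl
      exact hβ ⟨l, rfl⟩
    · rintro rfl
      exact hβ ⟨0, map_zero _⟩

/-- The product of the series `E_W(-t^α)`. -/
def rayProd (L : List ((σ →₀ ℕ) × R)) : MvPowerSeries σ (GInfQ R) :=
  (L.map fun p => raySeries p.1 p.2).prod

theorem isGrouplikeSeries_rayProd {L : List ((σ →₀ ℕ) × R)} (hL : ∀ p ∈ L, p.1 ≠ 0) :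
    IsGrouplikeSeries (rayProd L) := by
  refine .list_prod fun G hG => ?_
  obtain ⟨p, hp, rfl⟩ := List.mem_map.1 hG
  exact isGrouplikeSeries_raySeries (hL p hp) _

/-- All evaluations come from one product over R by substituting t ↦ t^l. So one identity over R
controls them all at once. -/
theorem map_gEval_rayProd (l : ℕ+) {L : List ((σ →₀ ℕ) × R)} (hL : ∀ p ∈ L, p.1 ≠ 0) :
    map (gEval R l).toRingHom (rayProd L) = expandHom l (map (ratExtOf R) (factorProd L)) := by
  induction L with
  | nil => simp [rayProd, factorProd]
  | cons p L ih =>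
    have h1 : rayProd (p :: L) = raySeries p.1 p.2 * rayProd L := by simp [rayProd]
    have h2 : factorProd (p :: L) = (1 - monomial p.1 p.2) * factorProd L := by simp [factorProd]
    rw [h1, h2, map_mul, map_mul, map_mul, ih fun q hq => hL q (by simp [hq]),
      map_gEval_raySeries l (hL p (by simp)), map_sub, map_sub, map_one, map_one, map_monomial,
      expandHom_monomial]

/-- Two products of factors which agree up to terms with exponents in an upper set give rise to products of
grouplike series which agree up to factors with exponents in this set. -/
theorem exists_rayProd [Module.Free ℤ R] [Finite σ] {𝒜 : Set (σ →₀ ℕ)} (h𝒜 : IsUpperSet 𝒜)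
    (h0 : 0 ∉ 𝒜) {L L' : List ((σ →₀ ℕ) × R)} (hL : ∀ p ∈ L, p.1 ≠ 0) (hL' : ∀ p ∈ L', p.1 ≠ 0)
    (h1 : coeff 0 (factorProd L') = 1)
    (hoff : ∀ β ∉ 𝒜, coeff β (factorProd L') = coeff β (factorProd L))
    (T : Finset (σ →₀ ℕ)) (hT : IsLowerSet (T : Set (σ →₀ ℕ))) :
    ∃ M : List ((σ →₀ ℕ) × R), (∀ p ∈ M, p.1 ∈ 𝒜) ∧
      ∀ β ∈ T, coeff β (rayProd L) = coeff β (rayProd L' * rayProd M) := by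
  obtain ⟨M, hM, -, hMT⟩ := exists_factorProd h𝒜 h0 h1 hoff T hT
  have hM0 : ∀ p ∈ M, p.1 ≠ 0 := fun p hp h => h0 (h ▸ hM p hp)
  have hLM : ∀ p ∈ L' ++ M, p.1 ≠ 0 := fun p hp =>
    (List.mem_append.1 hp).elim (hL' p) (hM0 p)
  have happ : rayProd L' * rayProd M = rayProd (L' ++ M) := by simp [rayProd]
  refine ⟨M, hM, fun β hβ => ?_⟩
  rw [happ]
  refine (isGrouplikeSeries_rayProd hL).coeff_congr (isGrouplikeSeries_rayProd hLM) hT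
    (fun l β hβ => ?_) β hβ
  rw [map_gEval_rayProd l hL, map_gEval_rayProd l hLM]
  refine coeff_expandHom_congr l hT (fun γ hγ => ?_) β hβ
  rw [coeff_map, coeff_map, factorProd_append]
  exact congrArg _ (hMT γ hγ).symm

/-- The generators `e_1(U), …, e_k(U)`. -/
def eGen (k : ℕ) (p : Fin k × R) : GInfQ R := eElem (firstIndex k p.1 : ℕ) p.2

/-- The weight filtration on `𝒢_k^ℤ(R)`. -/
abbrev eFil (R : Type*) [Ring R] (k d : ℕ) : Submodule ℤ (GInfQ R) :=
  wordFil ℤ (eGen (R := R) k) (sqWeight (firstIndex k)) d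

omit [DecidableEq σ] in
theorem sElem_eq_or (n : ℕ) : (∀ U : R, sElem n U = eElem n U) ∨ ∀ U : R, sElem n U = -eElem n U := by
  rcases neg_one_pow_eq_or ℚ n with h | h
  · exact Or.inl fun U => by rw [sElem, h, one_smul]
  · exact Or.inr fun U => by rw [sElem, h, neg_smul, one_smul]

theorem eElem_mem_eFil {k n : ℕ} (hn : n ≤ k) (U : R) {d : ℕ} (hd : n ^ 2 < d) :
    eElem n U ∈ eFil R k d := by
  rcases n with _ | n
  · rw [eElem_zero]
    exact one_mem_wordFil (by omega)
  · exact mem_wordFil (g := eGen (R := R) k) (w := sqWeight (firstIndex k)) (⟨n, hn⟩, U) hd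

theorem sElem_mem_eFil {k n : ℕ} (hn : n ≤ k) (U : R) {d : ℕ} (hd : n ^ 2 < d) :
    sElem n U ∈ eFil R k d := by
  rcases sElem_eq_or (R := R) n with h | h
  · rw [h]; exact eElem_mem_eFil hn U hd
  · rw [h]; exact neg_mem (eElem_mem_eFil hn U hd)

omit [DecidableEq σ] in
-- The only nonzero coefficients are the ± e_n(U) at n • α, of weight n^2. The function q bounds
-- these weights, and D is the range of exponents in which only n ≤ k occur.
theorem coeff_raySeries_mem {k : ℕ} {D : Set (σ →₀ ℕ)} {q : (σ →₀ ℕ) → ℕ} {α : σ →₀ ℕ} (hα : α ≠ 0)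
    (hq : ∀ n : ℕ, n ^ 2 ≤ q (n • α)) (hk : ∀ n : ℕ, n • α ∈ D → n ≤ k) (U : R) (β : σ →₀ ℕ)
    (hβ : β ∈ D) : coeff β (raySeries α U) ∈ eFil R k (q β + 1) := by
  by_cases h : β ∈ Set.range (rayHom α)
  · obtain ⟨n, rfl⟩ := h
    have : rayHom α n = n • α := rfl
    rw [this] at hβ ⊢
    rw [coeff_raySeries hα]
    exact sElem_mem_eFil (hk n hβ) U (Nat.lt_succ_of_le (hq n))
  · rw [raySeries, coeff_extendSeries_of_notMem _ h]
    exact zero_mem _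

/-- Superadditivity of q makes the bound for single rays pass to products. -/
theorem coeff_rayProd_mem {k : ℕ} {D : Set (σ →₀ ℕ)} (hD : IsLowerSet D) {q : (σ →₀ ℕ) → ℕ}
    (hq : ∀ β γ, q β + q γ ≤ q (β + γ)) {L : List ((σ →₀ ℕ) × R)}
    (hL : ∀ p ∈ L, p.1 ≠ 0 ∧ (∀ n : ℕ, n ^ 2 ≤ q (n • p.1)) ∧ ∀ n : ℕ, n • p.1 ∈ D → n ≤ k)
    (β : σ →₀ ℕ) (hβ : β ∈ D) : coeff β (rayProd L) ∈ eFil R k (q β + 1) := by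
  induction L generalizing β with
  | nil =>
    rw [rayProd, List.map_nil, List.prod_nil, coeff_one]
    split_ifs
    · exact one_mem_wordFil (Nat.succ_pos _)
    · exact zero_mem _
  | cons p L ih =>
    have h1 : rayProd (p :: L) = raySeries p.1 p.2 * rayProd L := by simp [rayProd]
    rw [h1, coeff_mul]
    refine sum_mem fun x hx => ?_
    rw [Finset.HasAntidiagonal.mem_antidiagonal] at hx
    have hp := hL p (by simp)
    refine mul_mem_wordFil ?_ (coeff_raySeries_mem hp.1 hp.2.1 hp.2.2 p.2 x.1
        (hD (hx ▸ le_self_add) hβ))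
      (ih (fun p hp => hL p (by simp [hp])) x.2 (hD (hx ▸ le_add_self) hβ))
    have := hq x.1 x.2
    rw [hx] at this
    omega

end Rays

/-! ### Additivity and commutation of the e_n modulo lower weight -/

section Relations
open MvPowerSeries

variable {R : Type*} [Ring R]

theorem sum_sub_mem {ι K H : Type*} [Ring K] [AddCommGroup H] [Module K H]
    (F : Submodule K H) {s : Finset ι} {f : ι → H} {a : ι} (ha : a ∈ s)
    (h : ∀ p ∈ s, p ≠ a → f p ∈ F) : ∑ p ∈ s, f p - f a ∈ F := by
  classical
  rw [← Finset.add_sum_erase s f ha, add_sub_cancel_left]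
  exact sum_mem fun p hp => h p (Finset.mem_of_mem_erase hp) (Finset.ne_of_mem_erase hp)

theorem coeff_zero_factorProd {σ : Type*} {L : List ((σ →₀ ℕ) × R)} (hL : ∀ p ∈ L, p.1 ≠ 0) :
    coeff 0 (factorProd L) = 1 := by
  classical
  rw [coeff_zero_eq_constantCoeff_apply, factorProd, map_list_prod, List.map_map]
  refine List.prod_eq_one fun x hx => ?_
  obtain ⟨p, hp, rfl⟩ := List.mem_map.1 hx
  rw [Function.comp_apply, map_sub, map_one, ← coeff_zero_eq_constantCoeff_apply,
    coeff_monomial, if_neg (hL p hp).symm, sub_zero]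

/-- The exponent of a variable. -/
abbrev varExp (i : Fin 2) : Fin 2 →₀ ℕ := Finsupp.single i 1

theorem varExp_ne_zero (i : Fin 2) : varExp i ≠ 0 := by simp

theorem smul_varExp_apply (n : ℕ) (i : Fin 2) : (n • varExp i) i = n := by simp

theorem smul_varExp_apply_of_ne (n : ℕ) {i j : Fin 2} (h : i ≠ j) : (n • varExp i) j = 0 := by
  simp [Finsupp.single_eq_of_ne h.symm]

variable [Module.Free ℤ R]

/-- `e_n` is additive up to terms of lower weight. -/
theorem sElem_add_mem {k n : ℕ} (hn : 0 < n) (hnk : n ≤ k) (U V : R) :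
    sElem n (U + V) - sElem n U - sElem n V ∈ eFil R k (n ^ 2) := by
  -- With t the variable 0, (1 - tU)(1 - tV) and 1 - t(U + V) differ only in t^2, so the correcting
  -- factors have order at least 2 in t. The variable 1 plays no role here.
  let 𝒜 : Set (Fin 2 →₀ ℕ) := {β | 2 ≤ β 0}
  have h𝒜 : IsUpperSet 𝒜 := fun a b hab (ha : 2 ≤ a 0) => ha.trans (hab 0)
  have h0 : (0 : Fin 2 →₀ ℕ) ∉ 𝒜 := by simp [𝒜]
  have e1 : factorProd [(varExp 0, U), (varExp 0, V)] =
      1 - monomial (varExp 0) (U + V) + monomial (varExp 0 + varExp 0) (U * V) := by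
    simp only [factorProd, List.map_cons, List.map_nil, List.prod_cons, List.prod_nil, mul_one,
      sub_mul, mul_sub, one_mul, monomial_mul_monomial, map_add]
    abel
  obtain ⟨M, hM, hMT⟩ := exists_rayProd (R := R) h𝒜 h0
    (L := [(varExp 0, U), (varExp 0, V)]) (L' := [(varExp 0, U + V)])
    (by simp) (by simp)
    (coeff_zero_factorProd (by simp))
    (by
      intro β hβ
      rw [e1, factorProd_singleton, map_add (coeff β), coeff_monomial _ (varExp 0 + varExp 0), if_neg,
        add_zero]
      rintro rfl
      exact hβ (by simp [𝒜]))
    (Finset.Iic (n • varExp 0)) (by simpa using isLowerSet_Iic _)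
  have h := hMT (n • varExp 0) (Finset.mem_Iic.2 le_rfl)
  have hl : coeff (n • varExp 0) (rayProd [(varExp 0, U), (varExp 0, V)])
      = ∑ p ∈ Finset.HasAntidiagonal.antidiagonal n, sElem p.1 U * sElem p.2 V := by
    have : rayProd [(varExp 0, U), (varExp 0, V)]
        = raySeries (varExp 0) U * raySeries (varExp 0) V := by simp [rayProd]
    rw [this, raySeries, raySeries, ← extendSeries_mul (rayHom_injective (varExp_ne_zero 0))
      (fun m => rfl)]
    exact coeff_extendSeries (rayHom_injective (varExp_ne_zero 0)) _ n
  have hr : rayProd [((varExp 0 : Fin 2 →₀ ℕ), U + V)] = raySeries (varExp 0) (U + V) := by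
    simp [rayProd]
  rw [hl, hr, coeff_mul] at h
  -- Apart from the two end terms, i + j = n with i, j > 0, and i^2 + j^2 < n^2.
  have hl2 : ∑ p ∈ Finset.HasAntidiagonal.antidiagonal n, sElem p.1 U * sElem p.2 V
      - (sElem n U + sElem n V) ∈ eFil R k (n ^ 2) := by
    have ha : (n, 0) ∈ Finset.HasAntidiagonal.antidiagonal n := by simp
    rw [← Finset.add_sum_erase _ _ ha]
    have hb : (0, n) ∈ (Finset.HasAntidiagonal.antidiagonal n).erase (n, 0) := by
      simp [hn.ne]
    have := sum_sub_mem (eFil R k (n ^ 2)) (f := fun p => sElem p.1 U * sElem p.2 V) hb (by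
      rintro ⟨i, j⟩ hp hne
      simp only [Finset.mem_erase, Finset.HasAntidiagonal.mem_antidiagonal, ne_eq, Prod.mk.injEq] at hp hne
      have hi : 0 < i := by omega
      have hj : 0 < j := by omega
      refine mul_mem_wordFil (d := i ^ 2 + 1) (e := j ^ 2 + 1) ?_
        (sElem_mem_eFil (by omega) _ (Nat.lt_succ_self _))
        (sElem_mem_eFil (by omega) _ (Nat.lt_succ_self _))
      rw [← hp.2]
      nlinarith [Nat.mul_le_mul hi hj])
    rw [sElem_zero, mul_one]
    rw [sElem_zero, one_mul] at this
    rwa [add_sub_add_left_eq_sub]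
  have hr2 : ∑ p ∈ Finset.HasAntidiagonal.antidiagonal (n • varExp 0 : Fin 2 →₀ ℕ),
      coeff p.1 (raySeries (varExp 0) (U + V)) * coeff p.2 (rayProd M) - sElem n (U + V)
      ∈ eFil R k (n ^ 2) := by
    have hM0 : ∀ p ∈ M, p.1 ≠ 0 := fun p hp h => h0 (h ▸ hM p hp)
    have := sum_sub_mem (eFil R k (n ^ 2))
      (s := Finset.HasAntidiagonal.antidiagonal (n • varExp 0 : Fin 2 →₀ ℕ))
      (f := fun p => coeff p.1 (raySeries (varExp 0) (U + V)) * coeff p.2 (rayProd M))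
      (a := (n • varExp 0, 0)) (by simp) (by
      rintro ⟨γ, β⟩ hp hne
      rw [Finset.HasAntidiagonal.mem_antidiagonal] at hp
      simp only at hp ⊢
      have hp0 : γ 0 + β 0 = n := by
        have := DFunLike.congr_fun hp 0
        simpa using this
      have hp1 : γ 1 + β 1 = 0 := by
        have := DFunLike.congr_fun hp 1
        simpa using this
      have hβ0 : 0 < β 0 := by
        by_contra h
        have hβ : β = 0 := by
          ext i
          fin_cases i
          · simp; omega
          · simp; omega
        exact hne (by rw [hβ] at hp ⊢; rw [← hp, add_zero])
      -- In a correcting factor of order at least 2, e_m first occurs at order 2m in t, so its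
      -- weight m^2 is at most a quarter of the square of the order. The total weight is therefore
      -- below n^2 once β is nonzero.
      refine mul_mem_wordFil (d := (γ 0) ^ 2 + 1) (e := (β 0) ^ 2 / 4 + 1) ?_
        (coeff_raySeries_mem (D := {β | β 0 ≤ k}) (q := fun β => (β 0) ^ 2) (varExp_ne_zero 0)
          (fun m => by simp) (fun m (hm : (m • varExp 0) 0 ≤ k) => by simpa using hm) _ _
          (show γ 0 ≤ k by omega))
        (coeff_rayProd_mem (D := {β | β 0 ≤ k}) (q := fun β => (β 0) ^ 2 / 4)
          (fun a b hab (ha : a 0 ≤ k) => (hab 0).trans ha) ?_ ?_ β (show β 0 ≤ k by omega))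
      · have h1 : (β 0) ^ 2 / 4 ≤ (β 0) ^ 2 := Nat.div_le_self _ _
        rcases Nat.eq_zero_or_pos (γ 0) with h2 | h2
        · have h3 : β 0 = n := by omega
          rw [h2, h3]
          have h4 : n ^ 2 / 4 < n ^ 2 := Nat.div_lt_self (by positivity) (by norm_num)
          omega
        · have h3 : n ^ 2 = (γ 0) ^ 2 + (β 0) ^ 2 + 2 * (γ 0 * β 0) := by rw [← hp0]; ring
          have h4 : 0 < γ 0 * β 0 := Nat.mul_pos h2 hβ0
          omega
      · intro a b
        simp only [Finsupp.add_apply]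
        rw [Nat.le_div_iff_mul_le (by norm_num)]
        have h1 := Nat.div_mul_le_self ((a 0) ^ 2) 4
        have h2 := Nat.div_mul_le_self ((b 0) ^ 2) 4
        nlinarith [Nat.zero_le (a 0 * b 0)]
      · intro p hp
        have hp2 : 2 ≤ p.1 0 := hM p hp
        refine ⟨hM0 p hp, fun m => ?_, fun m (hm : (m • p.1) 0 ≤ k) => ?_⟩
        · rw [Nat.le_div_iff_mul_le (by norm_num)]
          simp only [Finsupp.smul_apply, smul_eq_mul]
          calc m ^ 2 * 4 = (m * 2) ^ 2 := by ring
            _ ≤ _ := Nat.pow_le_pow_left (Nat.mul_le_mul_left m hp2) 2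
        · simp only [Finsupp.smul_apply, smul_eq_mul] at hm
          exact (Nat.le_mul_of_pos_right m (by omega)).trans hm)
    simp only [coeff_raySeries (varExp_ne_zero 0), (isGrouplikeSeries_rayProd hM0).coeff_zero,
      mul_one] at this
    exact this
  rw [h] at hl2
  have := sub_mem hl2 hr2
  rwa [sub_sub_sub_cancel_left, ← sub_sub] at this

omit [Module.Free ℤ R] in
-- For distinct variables an exponent splits in only one way along the two rays.
theorem coeff_raySeries_mul {i j : Fin 2} (hij : i ≠ j) (γ : Fin 2 →₀ ℕ) (U V : R) :
    coeff γ (raySeries (varExp i) U * raySeries (varExp j) V) = sElem (γ i) U * sElem (γ j) V := by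
  have hγ : γ i • varExp i + γ j • varExp j = γ := by
    ext l
    have hl : l = i ∨ l = j := by omega
    rcases hl with rfl | rfl
    · rw [Finsupp.add_apply, smul_varExp_apply, smul_varExp_apply_of_ne _ hij.symm, add_zero]
    · rw [Finsupp.add_apply, smul_varExp_apply, smul_varExp_apply_of_ne _ hij, zero_add]
  rw [coeff_mul, Finset.sum_eq_single (γ i • varExp i, γ j • varExp j)]
  · rw [coeff_raySeries (varExp_ne_zero i), coeff_raySeries (varExp_ne_zero j)]
  · rintro ⟨a, b⟩ hp hne
    rw [Finset.HasAntidiagonal.mem_antidiagonal] at hp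
    by_cases ha : a ∈ Set.range (rayHom (varExp i))
    · by_cases hb : b ∈ Set.range (rayHom (varExp j))
      · obtain ⟨m, rfl⟩ := ha
        obtain ⟨n, rfl⟩ := hb
        change m • varExp i + n • varExp j = γ at hp
        refine absurd ?_ hne
        have h1 := DFunLike.congr_fun hp i
        have h2 := DFunLike.congr_fun hp j
        rw [Finsupp.add_apply, smul_varExp_apply, smul_varExp_apply_of_ne _ hij.symm, add_zero] at h1
        rw [Finsupp.add_apply, smul_varExp_apply, smul_varExp_apply_of_ne _ hij, zero_add] at h2
        rw [h1, h2]; rfl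
      · rw [raySeries, raySeries, coeff_extendSeries_of_notMem _ hb, mul_zero]
    · rw [raySeries, raySeries, coeff_extendSeries_of_notMem _ ha, zero_mul]
  · intro h
    exact absurd (Finset.HasAntidiagonal.mem_antidiagonal.2 hγ) h

/-- The elements `e_m(U)` and `e_n(V)` commute up to terms of lower weight. -/
theorem sElem_commutator_mem {k m n : ℕ} (hmk : m ≤ k) (hnk : n ≤ k) (U V : R) :
    sElem m U * sElem n V - sElem n V * sElem m U ∈ eFil R k (m ^ 2 + n ^ 2) := by
  -- The two orders of multiplying 1 - sU and 1 - tV differ only in the coefficient of st, so every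
  -- correcting factor involves both variables.
  let 𝒜 : Set (Fin 2 →₀ ℕ) := {β | 1 ≤ β 0 ∧ 1 ≤ β 1}
  have h𝒜 : IsUpperSet 𝒜 := fun a b hab ha => ⟨ha.1.trans (hab 0), ha.2.trans (hab 1)⟩
  have h0 : (0 : Fin 2 →₀ ℕ) ∉ 𝒜 := by simp [𝒜]
  have h01 : varExp 0 + varExp 1 ∈ 𝒜 := by simp [𝒜]
  have e1 : ∀ (α β : Fin 2 →₀ ℕ) (A B : R), factorProd [(α, A), (β, B)] =
      1 - monomial α A - monomial β B + monomial (α + β) (A * B) := by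
    intro α β A B
    simp only [factorProd, List.map_cons, List.map_nil, List.prod_cons, List.prod_nil, mul_one,
      sub_mul, mul_sub, one_mul, monomial_mul_monomial]
    abel
  have e2 : ∀ (α β : Fin 2 →₀ ℕ) (A B : R),
      rayProd [(α, A), (β, B)] = raySeries α A * raySeries β B := by
    intro α β A B
    simp [rayProd]
  let γ : Fin 2 →₀ ℕ := m • varExp 0 + n • varExp 1
  have hγ0 : γ 0 = m := by simp [γ]
  have hγ1 : γ 1 = n := by simp [γ]
  obtain ⟨M, hM, hMT⟩ := exists_rayProd (R := R) h𝒜 h0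
    (L := [(varExp 0, U), (varExp 1, V)]) (L' := [(varExp 1, V), (varExp 0, U)])
    (by simp) (by simp)
    (coeff_zero_factorProd (by simp))
    (by
      intro β hβ
      have h1 : β ≠ varExp 1 + varExp 0 := by
        rintro rfl
        rw [add_comm] at hβ
        exact hβ h01
      have h2 : β ≠ varExp 0 + varExp 1 := by
        rintro rfl
        exact hβ h01
      rw [e1, e1, map_add, map_add, coeff_monomial _ (varExp 1 + varExp 0), if_neg h1,
        coeff_monomial _ (varExp 0 + varExp 1), if_neg h2, sub_right_comm])
    (Finset.Iic γ) (by simpa using isLowerSet_Iic _)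
  have h := hMT γ (Finset.mem_Iic.2 le_rfl)
  have hM0 : ∀ p ∈ M, p.1 ≠ 0 := fun p hp h => h0 (h ▸ hM p hp)
  rw [e2, e2, coeff_raySeries_mul (by decide), coeff_mul, hγ0, hγ1] at h
  rw [h]
  have := sum_sub_mem (eFil R k (m ^ 2 + n ^ 2))
    (s := Finset.HasAntidiagonal.antidiagonal γ)
    (f := fun p => coeff p.1 (raySeries (varExp 1) V * raySeries (varExp 0) U)
      * coeff p.2 (rayProd M))
    (a := (γ, 0)) (by simp) (by
    rintro ⟨δ, β⟩ hp hne
    rw [Finset.HasAntidiagonal.mem_antidiagonal] at hp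
    simp only at hp ⊢
    have hp0 : δ 0 + β 0 = m := by rw [← hγ0, ← hp]; rfl
    have hp1 : δ 1 + β 1 = n := by rw [← hγ1, ← hp]; rfl
    have hβ : 0 < β 0 ∨ 0 < β 1 := by
      by_contra h
      have hβ : β = 0 := by
        ext i
        fin_cases i
        · simp; omega
        · simp; omega
      exact hne (by rw [hβ] at hp ⊢; rw [← hp, add_zero])
    rw [coeff_raySeries_mul (by decide)]
    -- At the exponent l • α with both entries of α positive, e_l has weight l^2 ≤ (l α 0)(l α 1).
    -- This bound is superadditive, and β 0 * β 1 < (β 0)^2 + (β 1)^2 for nonzero β gives the strict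
    -- drop.
    refine mul_mem_wordFil (d := (δ 1) ^ 2 + (δ 0) ^ 2 + 1) (e := β 0 * β 1 + 1) ?_
      (mul_mem_wordFil (d := (δ 1) ^ 2 + 1) (e := (δ 0) ^ 2 + 1) (by omega)
        (sElem_mem_eFil (by omega) _ (Nat.lt_succ_self _))
        (sElem_mem_eFil (by omega) _ (Nat.lt_succ_self _)))
      (coeff_rayProd_mem (D := {β | β 0 ≤ k}) (q := fun β => β 0 * β 1)
        (fun a b hab (ha : a 0 ≤ k) => (hab 0).trans ha) ?_ ?_ β (show β 0 ≤ k by omega))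
    · rw [← hp0, ← hp1]
      have h1 : β 0 * β 1 < β 0 ^ 2 + β 1 ^ 2 := by
        rcases Nat.eq_zero_or_pos (β 0) with h | h
        · have : 0 < β 1 := by omega
          have h5 := Nat.pow_pos (n := 2) this
          rw [h]; simpa using h5
        · nlinarith [sq_nonneg ((β 0 : ℤ) - β 1), sq_nonneg (β 0 - β 1), Nat.zero_le (β 0 * β 1),
            two_mul_le_add_sq (β 0) (β 1), Nat.pow_pos (n := 2) h]
      nlinarith [Nat.zero_le (δ 0 * β 0), Nat.zero_le (δ 1 * β 1)]
    · intro a b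
      simp only [Finsupp.add_apply]
      nlinarith [Nat.zero_le (a 0 * b 1), Nat.zero_le (b 0 * a 1)]
    · intro p hp
      have hp2 := hM p hp
      refine ⟨hM0 p hp, fun l => ?_, fun l (hl : (l • p.1) 0 ≤ k) => ?_⟩
      · simp only [Finsupp.smul_apply, smul_eq_mul, sq]
        exact Nat.mul_le_mul (Nat.le_mul_of_pos_right l hp2.1) (Nat.le_mul_of_pos_right l hp2.2)
      · simp only [Finsupp.smul_apply, smul_eq_mul] at hl
        exact (Nat.le_mul_of_pos_right l hp2.1).trans hl)
  simpa only [coeff_raySeries_mul (show (1 : Fin 2) ≠ 0 by decide), hγ0, hγ1,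
    (isGrouplikeSeries_rayProd hM0).coeff_zero, mul_one] using this

theorem eElem_add_mem {k n : ℕ} (hn : 0 < n) (hnk : n ≤ k) (U V : R) :
    eElem n (U + V) - eElem n U - eElem n V ∈ eFil R k (n ^ 2) := by
  have h := sElem_add_mem hn hnk U V
  rcases sElem_eq_or (R := R) n with h' | h'
  · rwa [h', h', h'] at h
  · rw [h', h', h'] at h
    have h2 := neg_mem h
    have e : -(-eElem n (U + V) - -eElem n U - -eElem n V)
      = eElem n (U + V) - eElem n U - eElem n V := by abel
    rwa [e] at h2

theorem eElem_commutator_mem {k m n : ℕ} (hmk : m ≤ k) (hnk : n ≤ k) (U V : R) :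
    eElem m U * eElem n V - eElem n V * eElem m U ∈ eFil R k (m ^ 2 + n ^ 2) := by
  have h := sElem_commutator_mem hmk hnk U V
  rcases sElem_eq_or (R := R) m with h1 | h1 <;> rcases sElem_eq_or (R := R) n with h2 | h2 <;>
    rw [h1, h2] at h
  · exact h
  · have h' := neg_mem h
    rwa [mul_neg, neg_mul, neg_sub_neg, neg_sub] at h'
  · have h' := neg_mem h
    rwa [mul_neg, neg_mul, neg_sub_neg, neg_sub] at h'
  · rwa [neg_mul_neg, neg_mul_neg] at h

end Relations

/-! ### Triangular changes of independent families and of words -/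

section Triangular

/-- A family that is triangular, with nonzero diagonal, over an independent family is independent. -/
theorem LinearIndependent.of_triangular {K M S : Type*} [Field K] [AddCommGroup M] [Module K M]
    {v u : S → M} (hv : LinearIndependent K v) (w : S → ℕ) (c : S → K) (hc : ∀ s, c s ≠ 0)
    (hu : ∀ s, u s - c s • v s ∈ Submodule.span K (v '' {t | w t < w s})) :
    LinearIndependent K u := by
  obtain ⟨g, hg⟩ := LinearMap.exists_leftInverse_of_injective (Finsupp.linearCombination K v)
    (LinearMap.ker_eq_bot.2 hv)
  have hgv : ∀ s, g (v s) = Finsupp.single s 1 := fun s => by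
    have := DFunLike.congr_fun hg (Finsupp.single s 1)
    simpa using this
  have hcoord : ∀ s s', w s' ≤ w s → ∀ x ∈ Submodule.span K (v '' {t | w t < w s'}),
      g x s = 0 := by
    intro s s' hs x hx
    induction hx using Submodule.span_induction with
    | mem x hx =>
      obtain ⟨t, ht, rfl⟩ := hx
      rw [hgv, Finsupp.single_eq_of_ne]
      rintro rfl
      exact absurd (lt_of_lt_of_le ht hs) (lt_irrefl _)
    | zero => simp
    | add x y _ _ hx hy => simp [hx, hy]
    | smul a x _ hx => simp [hx]
  rw [linearIndependent_iff]
  intro l hl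
  by_contra hne
  -- At an index s of maximal weight in the support, no other u t has a component along v s: its
  -- correction has weight below w t ≤ w s. The coordinate at s is therefore l s * c s.
  obtain ⟨s, hs, hmax⟩ := l.support.exists_max_image w (Finsupp.support_nonempty_iff.2 hne)
  have h1 : g (Finsupp.linearCombination K u l) s = l s * c s := by
    rw [Finsupp.linearCombination_apply, Finsupp.sum, map_sum, Finsupp.finsetSum_apply,
      Finset.sum_eq_single s]
    · have h2 := hcoord s s le_rfl _ (hu s)
      rw [map_sub, Finsupp.sub_apply, sub_eq_zero] at h2
      simp [h2, hgv]
    · intro t ht hts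
      have h2 := hcoord s t (hmax t ht) _ (hu t)
      rw [map_sub, Finsupp.sub_apply, sub_eq_zero] at h2
      simp [h2, hgv, Finsupp.single_eq_of_ne hts.symm]
    · exact fun h => absurd hs h
  rw [hl, map_zero] at h1
  exact mul_ne_zero (Finsupp.mem_support_iff.1 hs) (hc s) h1.symm

/-- Replacing each generator in a word by another with the same leading term. -/
theorem list_prod_sub_smul_mem_wordFil {K H X I : Type*} [CommRing K] [Ring H] [Algebra K H]
    {g : X → H} {w : X → ℕ} (ξ : I → X) (e : I → H) (c : I → K)
    (he : ∀ i, e i - c i • g (ξ i) ∈ wordFil K g w (w (ξ i))) (L : List I) :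
    (L.map e).prod - (L.map c).prod • (L.map (g ∘ ξ)).prod ∈
      wordFil K g w (L.map (w ∘ ξ)).sum := by
  induction L with
  | nil => simp
  | cons i L ih =>
    have hg : (L.map (g ∘ ξ)).prod ∈ wordFil K g w ((L.map (w ∘ ξ)).sum + 1) := by
      rw [← List.map_map, ← List.map_map]
      exact list_prod_mem_wordFil (L.map ξ) (Nat.lt_succ_self _)
    have hi : e i ∈ wordFil K g w (w (ξ i) + 1) := by
      have h1 : e i = (e i - c i • g (ξ i)) + c i • g (ξ i) := by abel
      rw [h1]
      exact add_mem (wordFil_mono (Nat.le_succ _) (he i))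
        (Submodule.smul_mem _ _ (mem_wordFil (K := K) (g := g) (w := w) (ξ i) (Nat.lt_succ_self _)))
    simp only [List.map_cons, List.prod_cons, List.sum_cons, Function.comp_apply]
    have h2 : e i * (L.map e).prod - (c i * (L.map c).prod) • (g (ξ i) * (L.map (g ∘ ξ)).prod)
        = e i * ((L.map e).prod - (L.map c).prod • (L.map (g ∘ ξ)).prod)
          + (e i - c i • g (ξ i)) * ((L.map c).prod • (L.map (g ∘ ξ)).prod) := by
      simp only [mul_sub, sub_mul, mul_smul_comm, smul_mul_assoc, smul_sub]
      rw [mul_comm (c i), mul_smul]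
      abel
    rw [h2]
    exact add_mem
      (mul_mem_wordFil (d := w (ξ i) + 1) (e := (L.map (w ∘ ξ)).sum) (by omega) hi ih)
      (mul_mem_wordFil (d := w (ξ i)) (e := (L.map (w ∘ ξ)).sum + 1) (by omega) (he i)
        (Submodule.smul_mem _ _ hg))

end Triangular

/-! ### The ℤ-basis of ordered monomials in the e_l(b_i) -/

section IntegralBasis
variable {R : Type*} [Ring R]

theorem GZ_eq_adjoin (k : ℕ) : GZ R (k : ℕ∞) = Algebra.adjoin ℤ (Set.range (eGen (R := R) k)) := by
  refine le_antisymm (Algebra.adjoin_le ?_) (Algebra.adjoin_mono ?_)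
  · rintro _ ⟨i, U, hi, rfl⟩
    rcases i with _ | i
    · rw [eElem_zero]; exact one_mem _
    · exact Algebra.subset_adjoin ⟨(⟨i, by exact_mod_cast hi⟩, U), rfl⟩
  · rintro _ ⟨⟨j, U⟩, rfl⟩
    refine ⟨_, U, ?_, rfl⟩
    have : (firstIndex k j : ℕ) ≤ k := j.2
    exact_mod_cast this

theorem eGen_mem {k : ℕ} (p : Fin k × R) : eGen k p ∈ GZ R (k : ℕ∞) := by
  rw [GZ_eq_adjoin]
  exact Algebra.subset_adjoin ⟨p, rfl⟩

theorem firstIndex_le {k : ℕ} (j : Fin k) : (firstIndex k j : ℕ) ≤ k := j.2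

theorem firstIndex_pos {k : ℕ} (j : Fin k) : 0 < (firstIndex k j : ℕ) := (firstIndex k j).pos

variable [Module.Free ℤ R]

theorem eGen_commutator {k : ℕ} (x y : Fin k × R) :
    eGen k x * eGen k y - eGen k y * eGen k x ∈
      eFil R k (sqWeight (firstIndex k) x + sqWeight (firstIndex k) y) :=
  eElem_commutator_mem (firstIndex_le _) (firstIndex_le _) _ _

variable {ι I : Type*} (b : Module.Basis ι ℤ R) {k : ℕ} (jj : I → Fin k) (β : I → ι)

/-- The generators `e_l(b_i)` attached to a basis of `R`. -/
def eIndex (i : I) : Fin k × R := (jj i, b (β i))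

/-- By additivity modulo lower weight, the U for which this holds form an additive subgroup of R,
and it contains the basis. -/
theorem eGen_mem_span (hsurj : ∀ j i, ∃ k, jj k = j ∧ β k = i) (y : Fin k × R) :
    eGen k y ∈ Submodule.span ℤ (eGen k '' {z | ∃ i, z = eIndex b jj β i ∧
      sqWeight (firstIndex k) z = sqWeight (firstIndex k) y}) ⊔
      eFil R k (sqWeight (firstIndex k) y) := by
  obtain ⟨l, a⟩ := y
  set N := Submodule.span ℤ (eGen k '' {z | ∃ i, z = eIndex b jj β i ∧
      sqWeight (firstIndex k) z = sqWeight (firstIndex k) (l, a)}) ⊔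
      eFil R k (sqWeight (firstIndex k) (l, a)) with hN
  have hadd : ∀ U V : R, eGen k (l, U + V) - eGen k (l, U) - eGen k (l, V) ∈ N := fun U V =>
    Submodule.mem_sup_right (eElem_add_mem (firstIndex_pos l) (firstIndex_le l) U V)
  have h0 : eGen k (l, (0 : R)) ∈ N := by
    have h := neg_mem (hadd 0 0)
    rwa [add_zero, sub_self, zero_sub, neg_neg] at h
  let S : AddSubgroup R :=
    { carrier := {U | eGen k (l, U) ∈ N}
      zero_mem' := h0
      add_mem' := fun {U V} hU hV => by
        have h := add_mem (add_mem (hadd U V) hV) hU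
        rwa [sub_add_cancel, sub_add_cancel] at h
      neg_mem' := fun {U} hU => by
        have h := hadd U (-U)
        rw [add_neg_cancel] at h
        have h' := sub_mem (sub_mem h0 hU) h
        rwa [sub_sub_cancel] at h' }
  have hS : Submodule.span ℤ (Set.range b) ≤ AddSubgroup.toIntSubmodule S := by
    refine Submodule.span_le.2 ?_
    rintro _ ⟨i, rfl⟩
    obtain ⟨m, rfl, rfl⟩ := hsurj l i
    exact Submodule.mem_sup_left (Submodule.subset_span ⟨_, ⟨m, rfl, rfl⟩, rfl⟩)
  rw [b.span_eq] at hS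
  exact hS (Submodule.mem_top (x := a))

theorem eFil_le [LinearOrder I] (hsurj : ∀ j i, ∃ k, jj k = j ∧ β k = i) (d : ℕ) :
    eFil R k d ≤ Submodule.span ℤ (orderedMonomial (eGen k ∘ eIndex b jj β) ''
        {s | (s.map (sqWeight (firstIndex k) ∘ eIndex b jj β)).sum < d}) :=
  wordFil_le_span_orderedMonomial _ eGen_commutator (eGen_mem_span b jj β hsurj) d

omit [Module.Free ℤ R] in
-- With l = jj i + 1, the diagonal entry comes from the leading term of e_l(b), which is T_l applied
-- to -(-1)^l b.
theorem eGen_sub_smul_mem (i : I) :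
    (eGen k ∘ eIndex b jj β) i - (-(-1 : ℚ) ^ ((jj i : ℕ) + 1)) •
      tGen (firstIndex k) (tIndex b jj β i) ∈
      wordFil ℚ (tGen (R := R) (firstIndex k)) (sqWeight (firstIndex k))
        (sqWeight (firstIndex k) (tIndex b jj β i)) := by
  have h := eElem_add_tElem_mem (jj i).2 (b (β i))
  have e1 : (-(-1 : ℚ) ^ ((jj i : ℕ) + 1)) • tGen (firstIndex k) (tIndex b jj β i)
      = -tElem R (jj i : ℕ).succPNat (signed ((jj i : ℕ) + 1) (b (β i))) := by
    have e2 : signed ((jj i : ℕ) + 1) (b (β i))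
        = ((-1 : ℚ) ^ ((jj i : ℕ) + 1)) • ratBasis b (β i) := by
      rw [ratBasis_apply, signed]
      rcases neg_one_pow_eq_or ℚ ((jj i : ℕ) + 1) with h | h
      · have h' : (-1 : RatExt R) ^ ((jj i : ℕ) + 1) = 1 := by
          have := congrArg (algebraMap ℚ (RatExt R)) h
          simpa using this
        rw [h, h', one_mul, one_smul]
      · have h' : (-1 : RatExt R) ^ ((jj i : ℕ) + 1) = -1 := by
          have := congrArg (algebraMap ℚ (RatExt R)) h
          simpa using this
        rw [h, h', neg_one_mul, neg_smul, one_smul]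
    rw [e2, map_smul, neg_smul]
    rfl
  rw [e1, sub_neg_eq_add]
  exact h

omit [Module.Free ℤ R] in
-- Each ordered monomial is a sign times the corresponding monomial in the T_l(b_i), plus words of
-- lower weight. These are combinations of T-monomials of lower weight, so the family is triangular.
theorem linearIndependent_eGen [LinearOrder I]
    (hinj : ∀ k k', jj k = jj k' → β k = β k' → k = k')
    (hsurj : ∀ j i, ∃ k, jj k = j ∧ β k = i) :
    LinearIndependent ℚ (orderedMonomial (eGen k ∘ eIndex b jj β)) := by
  refine (linearIndependent_tGen b jj β (firstIndex_injective k) hinj).of_triangular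
    (fun s => (s.map (sqWeight (firstIndex k) ∘ tIndex b jj β)).sum)
    (fun s => ((s.sort (· ≤ ·)).map fun i => -(-1 : ℚ) ^ ((jj i : ℕ) + 1)).prod)
    (fun s => ?_) (fun s => wordFil_tGen_le b jj β (firstIndex_injective k) hsurj _ ?_)
  · refine List.prod_ne_zero fun h => ?_
    obtain ⟨i, -, hi⟩ := List.mem_map.1 h
    exact (neg_ne_zero.2 (pow_ne_zero _ (by norm_num))) hi
  · have h := list_prod_sub_smul_mem_wordFil (tIndex b jj β) _ _ (eGen_sub_smul_mem b jj β)
      (s.sort (· ≤ ·))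
    rw [sort_weight] at h
    exact h

theorem coe_orderedMonomial {K A J : Type*} [CommRing K] [Ring A] [Algebra K A] [LinearOrder J]
    (B : Subalgebra K A) (x : J → B) (s : Multiset J) :
    ((orderedMonomial x s : B) : A) = orderedMonomial (fun i => (x i : A)) s := by
  rw [orderedMonomial, orderedMonomial, ← Subalgebra.coe_val, map_list_prod, List.map_map]
  rfl

/-- The generators `e_l(b_i)` as elements of `𝒢_k^ℤ(R)`. -/
def eGenZ (i : I) : GZ R (k : ℕ∞) := ⟨eGen k (eIndex b jj β i), eGen_mem _⟩

omit [Module.Free ℤ R] in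
theorem coe_orderedMonomial_eGenZ [LinearOrder I] (s : Multiset I) :
    ((orderedMonomial (eGenZ b jj β) s : GZ R (k : ℕ∞)) : GInfQ R)
      = orderedMonomial (eGen k ∘ eIndex b jj β) s :=
  coe_orderedMonomial _ _ _

/-- The ordered monomials in the `e_l(b_i)` form a `ℤ`-basis of `𝒢_k^ℤ(R)`. -/
def gzBasis [LinearOrder I] (hinj : ∀ k k', jj k = jj k' → β k = β k' → k = k')
    (hsurj : ∀ j i, ∃ k, jj k = j ∧ β k = i) : Module.Basis (Multiset I) ℤ (GZ R (k : ℕ∞)) :=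
  Module.Basis.mk (v := orderedMonomial (eGenZ b jj β))
    (by
      refine LinearIndependent.of_comp (GZ R (k : ℕ∞)).val.toLinearMap ?_
      have h := (linearIndependent_eGen b jj β hinj hsurj).restrict_scalars
        (R := ℤ) (fun x y h => by simpa using h)
      convert h using 1
      swap
      · exact Subsingleton.elim _ _
      ext s
      exact congrArg Subtype.val (coe_orderedMonomial_eGenZ b jj β s))
    (by
      intro x _
      have hx := x.2
      have hx' : (x : GInfQ R) ∈ Algebra.adjoin ℤ (Set.range (eGen (R := R) k)) := by
        rw [← GZ_eq_adjoin]; exact hx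
      obtain ⟨d, hd⟩ := exists_mem_wordFil (w := sqWeight (firstIndex k)) hx'
      have h := Submodule.span_mono (Set.image_subset_range _ _) (eFil_le b jj β hsurj d hd)
      have e : Set.range (orderedMonomial (eGen k ∘ eIndex b jj β))
          = (GZ R (k : ℕ∞)).val.toLinearMap '' Set.range (orderedMonomial (eGenZ b jj β)) := by
        rw [← Set.range_comp]
        congr 1
        ext s
        exact congrArg Subtype.val (coe_orderedMonomial_eGenZ b jj β s).symm
      rw [e, Submodule.span_image] at h
      obtain ⟨y, hy, hyx⟩ := h
      rwa [← Subtype.ext hyx])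

theorem coe_gzBasis [LinearOrder I] (hinj : ∀ k k', jj k = jj k' → β k = β k' → k = k')
    (hsurj : ∀ j i, ∃ k, jj k = j ∧ β k = i) (s : Multiset I) :
    ((gzBasis b jj β hinj hsurj s : GZ R (k : ℕ∞)) : GInfQ R)
      = orderedMonomial (eGen k ∘ eIndex b jj β) s := by
  rw [gzBasis, Module.Basis.mk_apply, coe_orderedMonomial_eGenZ]

theorem free_GZ (k : ℕ) : Module.Free ℤ (GZ R (k : ℕ∞)) := by
  let b := Module.Free.chooseBasis ℤ R
  let _ : LinearOrder (Module.Free.ChooseBasisIndex ℤ R) := IsWellOrder.linearOrder WellOrderingRel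
  exact Module.Free.of_basis (gzBasis (I := Fin k ×ₗ Module.Free.ChooseBasisIndex ℤ R) b
    (fun i => (ofLex i).1) (fun i => (ofLex i).2)
    (fun _ _ h h' => ofLex.injective (Prod.ext h h')) (fun j i => ⟨toLex (j, i), rfl, rfl⟩))

end IntegralBasis

/-! ### The case k = 1: PBW monomials -/

section PBW
variable {R : Type*} [Ring R]

theorem eElem_one (U : R) : eElem 1 U = tElem R 1 (ratExtOf R U) := by
  have h := eElem_succ 0 U
  rw [h]
  simp [partialE, signed, PowerSeries.coeff_one]
  rfl

theorem orderedMonomial_toMultiset {H I : Type*} [Ring H] [LinearOrder I] (x : I → H)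
    (n : I →₀ ℕ) : orderedMonomial x (Finsupp.toMultiset n)
      = ((n.support.sort (· ≤ ·)).map fun i => x i ^ n i).prod := by
  have hs := Finset.pairwise_sort n.support (· ≤ ·)
  have h1 : ((n.support.sort (· ≤ ·)).flatMap fun i => List.replicate (n i) i).Pairwise (· ≤ ·) := by
    rw [List.pairwise_flatMap]
    refine ⟨fun i _ => List.pairwise_replicate.2 (Or.inr le_rfl), hs.imp fun {i j} hij a ha c hc => ?_⟩
    rw [List.eq_of_mem_replicate ha, List.eq_of_mem_replicate hc]
    exact hij
  have h2 : (((n.support.sort (· ≤ ·)).flatMap fun i => List.replicate (n i) i : List I)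
      : Multiset I) = Finsupp.toMultiset n := by
    rw [Finsupp.toMultiset_apply, Finsupp.sum, ← Multiset.coe_bind, Finset.sort_eq]
    simp only [Multiset.coe_replicate, Multiset.nsmul_singleton]
    rfl
  rw [← h2, orderedMonomial_coe x h1, List.flatMap_def, List.map_flatten, List.prod_flatten,
    List.map_map, List.map_map]
  congr 1
  refine List.map_congr_left fun i _ => ?_
  simp

theorem factor_pbwMonomial {ι : Type*} [LinearOrder ι] (b : Module.Basis ι ℤ R) (n : ι →₀ ℕ) :
    factor R 1 (pbwMonomial b n) = ((n.support.sort (· ≤ ·)).map fun i =>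
      tElem R 1 (ratExtOf R (b i)) ^ n i).prod := by
  rw [pbwMonomial, map_list_prod, List.map_map]
  simp only [Function.comp_def, map_pow]
  rfl

/-- Since e_1(U) = T_1(U), the general basis for k = 1 already consists of PBW monomials; only its
indexing changes, from multisets to exponent vectors. -/
theorem exists_pbwBasis [Module.Free ℤ R] {ι : Type*} [LinearOrder ι] (b : Module.Basis ι ℤ R) :
    ∃ B : Module.Basis (ι →₀ ℕ) ℤ (GZ R (1 : ℕ)), ∀ n,
      (B n : GInfQ R) = factor R 1 (pbwMonomial b n) := by
  classical
  refine ⟨(gzBasis (k := 1) (I := ι) b (fun _ => 0) id (fun _ _ _ h => h)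
    (fun j i => ⟨i, Subsingleton.elim _ _, rfl⟩)).reindex Multiset.toFinsupp.toEquiv,
    fun n => ?_⟩
  rw [Module.Basis.reindex_apply, coe_gzBasis, factor_pbwMonomial]
  have h : (eGen 1 ∘ eIndex (k := 1) b (fun _ : ι => 0) id) =
      fun i => tElem R 1 (ratExtOf R (b i)) := by
    ext i
    exact congrArg _ (eElem_one (b i))
  rw [h]
  exact orderedMonomial_toMultiset _ n

end PBW

/-! ### Noetherianity of algebras that are commutative modulo lower weight -/

section FilteredNoetherian

variable {K H X I : Type*} [CommRing K] [Ring H] [Algebra K H] [LinearOrder I]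

/-- The linear map that takes a monomial to the ordered monomial in the given elements. -/
def orderedMonomialMap (K : Type*) [CommRing K] [Algebra K H] (x : I → H) :
    MvPolynomial I K →ₗ[K] H :=
  (MvPolynomial.basisMonomials I K).constr K fun s => orderedMonomial x (Finsupp.toMultiset s)

theorem orderedMonomialMap_monomial (x : I → H) (s : I →₀ ℕ) (r : K) :
    orderedMonomialMap K x (MvPolynomial.monomial s r)
      = r • orderedMonomial x (Finsupp.toMultiset s) := by
  have h1 : (MvPolynomial.monomial s r : MvPolynomial I K)
      = r • MvPolynomial.basisMonomials I K s := by
    rw [MvPolynomial.coe_basisMonomials, MvPolynomial.smul_monomial, smul_eq_mul, mul_one]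
  rw [h1, map_smul, orderedMonomialMap, Module.Basis.constr_basis]

omit [LinearOrder I] in
theorem weight_eq_sum_toMultiset (w : I → ℕ) (s : I →₀ ℕ) :
    Finsupp.weight w s = ((Finsupp.toMultiset s).map w).sum := by
  induction s using Finsupp.induction_linear with
  | zero => simp
  | add s t hs ht => rw [map_add, map_add, Multiset.map_add, Multiset.sum_add, hs, ht]
  | single i n => simp [Finsupp.weight_single, Multiset.map_nsmul, Multiset.sum_nsmul]

theorem orderedMonomial_add_sub_mem {g : X → H} {w : X → ℕ} (ξ : I → X)
    (hcomm : ∀ x y, g x * g y - g y * g x ∈ wordFil K g w (w x + w y)) (s t : Multiset I) :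
    orderedMonomial (g ∘ ξ) (s + t) - orderedMonomial (g ∘ ξ) s * orderedMonomial (g ∘ ξ) t ∈
      wordFil K g w ((s.map (w ∘ ξ)).sum + (t.map (w ∘ ξ)).sum) := by
  have hp : ((s + t).sort (· ≤ ·)).Perm (s.sort (· ≤ ·) ++ t.sort (· ≤ ·)) := by
    rw [← Multiset.coe_eq_coe, Multiset.sort_eq, ← Multiset.coe_add, Multiset.sort_eq,
      Multiset.sort_eq]
  have h := list_prod_sub_mem_wordFil_of_perm (K := K) hcomm (hp.map ξ)
  rw [List.map_map, List.map_map, List.map_map, List.map_append, List.prod_append, sort_weight,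
    Multiset.map_add, Multiset.sum_add] at h
  exact h

variable {g : X → H} {w : X → ℕ} (ξ : I → X)
    (hcomm : ∀ x y, g x * g y - g y * g x ∈ wordFil K g w (w x + w y))
    (hspan : ∀ y, g y ∈ Submodule.span K (g '' {z | ∃ i, z = ξ i ∧ w z = w y}) ⊔ wordFil K g w (w y))
    (hgen : Algebra.adjoin K (Set.range g) = ⊤)

theorem orderedMonomialMap_mem (d : ℕ) (p : MvPolynomial I K)
    (hp : p.IsWeightedHomogeneous (w ∘ ξ) d) :
    orderedMonomialMap K (g ∘ ξ) p ∈ wordFil K g w (d + 1) := by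
  induction hp using MvPolynomial.IsWeightedHomogeneous.induction_on with
  | zero => rw [map_zero]; exact zero_mem _
  | add p q _ _ hp hq => rw [map_add]; exact add_mem hp hq
  | monomial s r hs =>
    rw [orderedMonomialMap_monomial]
    refine Submodule.smul_mem _ _ (orderedMonomial_mem_wordFil ξ _ ?_)
    rw [← weight_eq_sum_toMultiset, hs]
    exact Nat.lt_succ_self _

include hcomm in
theorem orderedMonomialMap_mul_sub_mem (d e : ℕ) (p q : MvPolynomial I K)
    (hp : p.IsWeightedHomogeneous (w ∘ ξ) d) (hq : q.IsWeightedHomogeneous (w ∘ ξ) e) :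
    orderedMonomialMap K (g ∘ ξ) (p * q)
      - orderedMonomialMap K (g ∘ ξ) p * orderedMonomialMap K (g ∘ ξ) q ∈
      wordFil K g w (d + e) := by
  induction hp using MvPolynomial.IsWeightedHomogeneous.induction_on with
  | zero => simp
  | add p p' _ _ hp hp' =>
    rw [add_mul, map_add, map_add, add_mul, add_sub_add_comm]
    exact add_mem hp hp'
  | monomial s r hs =>
    induction hq using MvPolynomial.IsWeightedHomogeneous.induction_on with
    | zero => simp
    | add p p' _ _ hp hp' =>
      rw [mul_add, map_add, map_add, mul_add, add_sub_add_comm]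
      exact add_mem hp hp'
    | monomial t u ht =>
      rw [MvPolynomial.monomial_mul]
      simp only [orderedMonomialMap_monomial]
      rw [smul_mul_smul_comm, ← smul_sub, Finsupp.toMultiset_add]
      have h := orderedMonomial_add_sub_mem (K := K) ξ hcomm (Finsupp.toMultiset s)
        (Finsupp.toMultiset t)
      rw [← weight_eq_sum_toMultiset, ← weight_eq_sum_toMultiset, hs, ht] at h
      exact Submodule.smul_mem _ _ h

include hcomm hspan in
-- This is surjectivity of the symbol map from the weighted polynomial ring onto the associated
-- graded ring.
theorem exists_sub_orderedMonomialMap_mem (d : ℕ) (x : H) (hx : x ∈ wordFil K g w (d + 1)) :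
    ∃ p : MvPolynomial I K, p.IsWeightedHomogeneous (w ∘ ξ) d ∧
      x - orderedMonomialMap K (g ∘ ξ) p ∈ wordFil K g w d := by
  have hx' := wordFil_le_span_orderedMonomial ξ hcomm hspan (d + 1) hx
  clear hx
  induction hx' using Submodule.span_induction with
  | mem x hx =>
    obtain ⟨s, hs, rfl⟩ := hx
    rcases Nat.lt_succ_iff_lt_or_eq.1 hs with hs | hs
    · refine ⟨0, MvPolynomial.isWeightedHomogeneous_zero _ _ _, ?_⟩
      rw [map_zero, sub_zero]
      exact orderedMonomial_mem_wordFil ξ _ hs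
    · classical
      refine ⟨MvPolynomial.monomial (Multiset.toFinsupp s) 1,
        MvPolynomial.isWeightedHomogeneous_monomial _ _ _ ?_, ?_⟩
      · rw [weight_eq_sum_toMultiset, Multiset.toFinsupp_toMultiset, hs]
      · rw [orderedMonomialMap_monomial, one_smul, Multiset.toFinsupp_toMultiset, sub_self]
        exact zero_mem _
  | zero => exact ⟨0, MvPolynomial.isWeightedHomogeneous_zero _ _ _, by simp⟩
  | add x y _ _ hx hy =>
    obtain ⟨p, hp, hx⟩ := hx
    obtain ⟨q, hq, hy⟩ := hy
    refine ⟨p + q, hp.add hq, ?_⟩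
    rw [map_add, add_sub_add_comm]
    exact add_mem hx hy
  | smul a x _ hx =>
    obtain ⟨p, hp, hx⟩ := hx
    refine ⟨a • p, (MvPolynomial.weightedHomogeneousSubmodule K (w ∘ ξ) d).smul_mem a hp, ?_⟩
    rw [map_smul, ← smul_sub]
    exact Submodule.smul_mem _ _ hx

attribute [local instance] MvPolynomial.weightedGradedAlgebra

include hcomm hspan hgen in
/-- An algebra with finitely many generators that commute up to terms of lower weight is left and
right noetherian. -/
theorem isNoetherianRing_of_commutators [Finite I] [IsNoetherianRing K] :
    IsNoetherianRing H ∧ IsNoetherianRing Hᵐᵒᵖ := by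
  constructor
  · refine isNoetherianRing_of_filtration
      (MvPolynomial.weightedHomogeneousSubmodule K (w ∘ ξ))
      (orderedMonomialMap K (g ∘ ξ)).toAddMonoidHom (fun d => (wordFil K g w d).toAddSubgroup)
      ?_ (fun a b c x y h hx hy => mul_mem_wordFil h hx hy)
      (fun x => exists_mem_wordFil (by rw [hgen]; exact Algebra.mem_top))
      (orderedMonomialMap_mem ξ) (exists_sub_orderedMonomialMap_mem ξ hcomm hspan)
      (fun d e p hp q hq => orderedMonomialMap_mul_sub_mem ξ hcomm d e p q hp hq)
    rw [wordFil_zero]; rfl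
  -- The same filtration and symbol map serve for the opposite ring: reversing products is harmless
  -- because the polynomial ring is commutative.
  · refine isNoetherianRing_of_filtration
      (MvPolynomial.weightedHomogeneousSubmodule K (w ∘ ξ))
      (MulOpposite.opAddEquiv.toAddMonoidHom.comp (orderedMonomialMap K (g ∘ ξ)).toAddMonoidHom)
      (fun d => (wordFil K g w d).toAddSubgroup.comap MulOpposite.opAddEquiv.symm.toAddMonoidHom)
      ?_ (fun a b c x y h hx hy => ?_)
      (fun x => exists_mem_wordFil (by rw [hgen]; exact Algebra.mem_top))
      (orderedMonomialMap_mem ξ) (fun d x hx => ?_) (fun d e p hp q hq => ?_)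
    · ext x
      change MulOpposite.unop x ∈ wordFil K g w 0 ↔ _
      rw [wordFil_zero, Submodule.mem_bot, MulOpposite.unop_eq_zero_iff, AddSubgroup.mem_bot]
    · exact mul_mem_wordFil (d := b) (e := a) (by omega) hy hx
    · exact exists_sub_orderedMonomialMap_mem ξ hcomm hspan d _ hx
    · have h := orderedMonomialMap_mul_sub_mem ξ hcomm e d q p hq hp
      rw [mul_comm, add_comm] at h
      exact h

end FilteredNoetherian

/-! ### Weight filtrations inside a subalgebra -/

section Subalgebras

variable {K A X : Type*} [CommRing K] [Ring A] [Algebra K A] (B : Subalgebra K A)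

theorem map_val_wordFil (g : X → B) (w : X → ℕ) (d : ℕ) :
    (wordFil K g w d).map B.val.toLinearMap = wordFil K (fun x => (g x : A)) w d := by
  rw [wordFil, wordFil, Submodule.map_span]
  congr 1
  ext y
  have h : ∀ L : List X, B.val.toLinearMap (L.map g).prod = (L.map fun x => (g x : A)).prod := by
    intro L
    rw [AlgHom.toLinearMap_apply, map_list_prod, List.map_map]
    rfl
  constructor
  · rintro ⟨_, ⟨L, hL, rfl⟩, rfl⟩
    exact ⟨L, hL, h L⟩
  · rintro ⟨L, hL, rfl⟩
    exact ⟨_, ⟨L, hL, rfl⟩, h L⟩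

theorem mem_of_coe_mem_map {N : Submodule K B} {x : B} (h : (x : A) ∈ N.map B.val.toLinearMap) :
    x ∈ N := by
  obtain ⟨y, hy, hyx⟩ := h
  rwa [← Subtype.ext hyx]

end Subalgebras

/-! ### Noetherianity of 𝒢_k^ℤ(R) -/

section NoetherianGZ
variable {R : Type*} [Ring R] [Module.Free ℤ R]

theorem isNoetherianRing_GZ [Module.Finite ℤ R] (k : ℕ) :
    IsNoetherianRing (GZ R (k : ℕ∞)) ∧ IsNoetherianRing (GZ R (k : ℕ∞))ᵐᵒᵖ := by
  let b := Module.Free.chooseBasis ℤ R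
  let _ : LinearOrder (Module.Free.ChooseBasisIndex ℤ R) := IsWellOrder.linearOrder WellOrderingRel
  let I := Fin k ×ₗ Module.Free.ChooseBasisIndex ℤ R
  have : Finite I := Finite.of_equiv _ (toLex (α := Fin k × Module.Free.ChooseBasisIndex ℤ R))
  let jj : I → Fin k := fun i => (ofLex i).1
  let β : I → Module.Free.ChooseBasisIndex ℤ R := fun i => (ofLex i).2
  let B := GZ R (k : ℕ∞)
  let g : Fin k × R → B := fun p => ⟨eGen k p, eGen_mem p⟩
  have hfil := map_val_wordFil B g (sqWeight (firstIndex k))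
  refine isNoetherianRing_of_commutators (K := ℤ) (I := I) (g := g) (w := sqWeight (firstIndex k))
    (eIndex b jj β) (fun x y => ?_) (fun y => ?_) ?_
  · refine mem_of_coe_mem_map B ?_
    rw [hfil]
    exact eGen_commutator x y
  · refine mem_of_coe_mem_map B ?_
    rw [Submodule.map_sup, hfil, Submodule.map_span, ← Set.image_comp]
    exact eGen_mem_span b jj β (fun j i => ⟨toLex (j, i), rfl, rfl⟩) y
  · have h : B = Algebra.adjoin ℤ (B.val '' Set.range g) := by
      rw [← Set.range_comp]; exact GZ_eq_adjoin k
    rw [← AlgHom.map_adjoin] at h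
    refine Algebra.eq_top_iff.2 fun x => ?_
    have hx := h.le x.2
    obtain ⟨y, hy, hyx⟩ := hx
    rwa [← Subtype.ext hyx]

end NoetherianGZ

/-! ### Tensor products over a Dedekind domain and over its fraction field -/

section FractionTensor

variable {K F : Type*} [CommRing K] [IsDedekindDomain K] [Field F] [Algebra K F] [IsFractionRing K F]
variable {M N V W : Type*} [AddCommGroup M] [AddCommGroup N] [AddCommGroup V] [AddCommGroup W]
  [Module K M] [Module K N] [Module F V] [Module F W] [Module K V] [Module K W]
  [IsScalarTower K F V] [IsScalarTower K F W]

variable (F) in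
/-- The map `m ⊗ n ↦ f m ⊗ g n` from a tensor product over a ring to a tensor product over its
field of fractions. -/
def fractionTensor (f : M →ₗ[K] V) (g : N →ₗ[K] W) : M ⊗[K] N →ₗ[K] V ⊗[F] W :=
  TensorProduct.mapOfCompatibleSMul F K K V W ∘ₗ TensorProduct.map f g

omit [IsDedekindDomain K] [IsFractionRing K F] in
@[simp]
theorem fractionTensor_tmul (f : M →ₗ[K] V) (g : N →ₗ[K] W) (m : M) (n : N) :
    fractionTensor F f g (m ⊗ₜ n) = f m ⊗ₜ g n := rfl

/-- The modules involved are torsion-free, hence flat over the Dedekind domain, so f ⊗ g is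
injective over K. For vector spaces over F the tensor products over K and over F agree. -/
theorem fractionTensor_injective {f : M →ₗ[K] V} {g : N →ₗ[K] W} (hf : Function.Injective f)
    (hg : Function.Injective g) : Function.Injective (fractionTensor F f g) := by
  have : Module.IsTorsionFree K W := .trans_faithfulSMul K F W
  have : Module.IsTorsionFree K V := .trans_faithfulSMul K F V
  have : Module.IsTorsionFree K N := hg.moduleIsTorsionFree g (fun r x => map_smul g r x)
  have : TensorProduct.CompatibleSMul K F V W :=
    IsLocalization.tensorProduct_compatibleSMul (nonZeroDivisors K) F V W
  have h1 : Function.Injective (TensorProduct.map f g) :=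
    TensorProduct.map_injective_of_flat_flat _ _ hf hg
  exact (TensorProduct.equivOfCompatibleSMul F K K V W).injective.comp h1

end FractionTensor

/-! ### Restriction of a Hopf structure to an integral subalgebra -/

section RestrictHopf

variable {K F : Type*} [CommRing K] [IsDedekindDomain K] [Field F] [Algebra K F] [IsFractionRing K F]
  {A : Type*} [Ring A] [Algebra F A] [Algebra K A] [IsScalarTower K F A] (B : Subalgebra K A)

variable (F) in
/-- The comparison map from the tensor square of an integral subalgebra. -/
def ratSquare : B ⊗[K] B →ₐ[K] A ⊗[F] A :=
  AlgHom.ofLinearMap (fractionTensor F B.val.toLinearMap B.val.toLinearMap) rfl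
    (by
      intro x y
      induction x using TensorProduct.induction_on with
      | zero => simp
      | add a b ha hb => rw [add_mul, map_add, map_add, ha, hb, add_mul]
      | tmul a b =>
        induction y using TensorProduct.induction_on with
        | zero => simp
        | add c d hc hd => rw [mul_add, map_add, map_add, hc, hd, mul_add]
        | tmul c d => simp)

omit [IsDedekindDomain K] [IsFractionRing K F] in
@[simp]
theorem ratSquare_tmul (x y : B) : ratSquare F B (x ⊗ₜ y) = (x : A) ⊗ₜ (y : A) := rfl

theorem ratSquare_injective : Function.Injective (ratSquare F B) :=
  fractionTensor_injective Subtype.val_injective Subtype.val_injective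

variable (HA : HopfStructure F A)

/-- An integral subalgebra that is stable under the structure maps of a rational Hopf algebra. -/
structure IsHopfStable : Prop where
  comul_mem : ∀ x ∈ B, HA.comul x ∈ (ratSquare F B).range
  counit_mem : ∀ x ∈ B, HA.counit x ∈ (Algebra.ofId K F).range
  antipode_mem : ∀ x ∈ B, HA.antipode x ∈ B

variable {B HA} (h : IsHopfStable B HA)

namespace IsHopfStable

/-- The restricted comultiplication. -/
def comul : B →ₐ[K] B ⊗[K] B :=
  (AlgEquiv.ofInjective (ratSquare F B) (ratSquare_injective B)).symm.toAlgHom.comp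
    (((HA.comul.restrictScalars K).comp B.val).codRestrict (ratSquare F B).range
      fun x => h.comul_mem x x.2)

theorem ratSquare_comul (x : B) : ratSquare F B (h.comul x) = HA.comul (x : A) :=
  congrArg Subtype.val (AlgEquiv.apply_symm_apply
    (AlgEquiv.ofInjective (ratSquare F B) (ratSquare_injective B))
    (((HA.comul.restrictScalars K).comp B.val).codRestrict (ratSquare F B).range
      (fun x => h.comul_mem x x.2) x))

/-- The restricted counit. -/
def counit : B →ₐ[K] K :=
  (AlgEquiv.ofInjective (Algebra.ofId K F) (IsFractionRing.injective K F)).symm.toAlgHom.comp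
    (((HA.counit.restrictScalars K).comp B.val).codRestrict (Algebra.ofId K F).range
      fun x => h.counit_mem x x.2)

omit [IsDedekindDomain K] in
theorem algebraMap_counit (x : B) : algebraMap K F (h.counit x) = HA.counit (x : A) :=
  congrArg Subtype.val (AlgEquiv.apply_symm_apply
    (AlgEquiv.ofInjective (Algebra.ofId K F) (IsFractionRing.injective K F))
    (((HA.counit.restrictScalars K).comp B.val).codRestrict (Algebra.ofId K F).range
      (fun x => h.counit_mem x x.2) x))

/-- The restricted antipode. -/
def antipode : B →ₗ[K] B :=
  ((HA.antipode.restrictScalars K) ∘ₗ B.val.toLinearMap).codRestrict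
    (Subalgebra.toSubmodule B) fun x => h.antipode_mem x x.2

omit [IsDedekindDomain K] [IsFractionRing K F] in
theorem coe_antipode (x : B) : (h.antipode x : A) = HA.antipode (x : A) := rfl

/-- The Hopf algebra structure on a stable integral subalgebra. -/
def hopfStructure : HopfStructure K B where
  comul := h.comul
  counit := h.counit
  antipode := h.antipode
  coassoc := by
    -- The triple tensor power also embeds in the rational one, so coassociativity can be tested
    -- there. The other axioms are tested in A in the same manner.
    let κ : B ⊗[K] (B ⊗[K] B) →ₗ[K] A ⊗[F] (A ⊗[F] A) :=
      fractionTensor F B.val.toLinearMap (ratSquare F B).toLinearMap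
    have hκ : Function.Injective κ :=
      fractionTensor_injective Subtype.val_injective (ratSquare_injective B)
    have h1 : ∀ (w : B ⊗[K] B) (b : B), κ (Algebra.TensorProduct.assoc K K K B B B (w ⊗ₜ b))
        = Algebra.TensorProduct.assoc F F F A A A (ratSquare F B w ⊗ₜ (b : A)) := by
      intro w b
      induction w using TensorProduct.induction_on with
      | zero => simp
      | add x y hx hy => simp only [TensorProduct.add_tmul, map_add, hx, hy]
      | tmul x y => rfl
    have h2 : ∀ z : B ⊗[K] B, κ (Algebra.TensorProduct.assoc K K K B B B
        (Algebra.TensorProduct.map h.comul (.id K B) z)) = Algebra.TensorProduct.assoc F F F A A A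
          (Algebra.TensorProduct.map HA.comul (.id F A) (ratSquare F B z)) := by
      intro z
      induction z using TensorProduct.induction_on with
      | zero => simp
      | add x y hx hy => simp only [map_add, hx, hy]
      | tmul x y =>
        rw [Algebra.TensorProduct.map_tmul, h1, ratSquare_comul]
        rfl
    have h3 : ∀ z : B ⊗[K] B, κ (Algebra.TensorProduct.map (.id K B) h.comul z)
        = Algebra.TensorProduct.map (.id F A) HA.comul (ratSquare F B z) := by
      intro z
      induction z using TensorProduct.induction_on with
      | zero => simp
      | add x y hx hy => simp only [map_add, hx, hy]
      | tmul x y =>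
        change (x : A) ⊗ₜ[F] ratSquare F B (h.comul y) = _
        rw [ratSquare_comul]
        rfl
    refine AlgHom.ext fun x => hκ ?_
    have h4 := DFunLike.congr_fun HA.coassoc (x : A)
    refine (h2 (h.comul x)).trans (Eq.trans ?_ (h3 (h.comul x)).symm)
    rw [ratSquare_comul]
    exact h4
  rTensor_counit := by
    have h2 : ∀ z : B ⊗[K] B, ((Algebra.TensorProduct.lid K B
        (Algebra.TensorProduct.map h.counit (.id K B) z) : B) : A) = Algebra.TensorProduct.lid F A
          (Algebra.TensorProduct.map HA.counit (.id F A) (ratSquare F B z)) := by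
      intro z
      induction z using TensorProduct.induction_on with
      | zero => simp
      | add x y hx hy => simp only [map_add, Subalgebra.coe_add, hx, hy]
      | tmul x y =>
        simp only [Algebra.TensorProduct.map_tmul, Algebra.TensorProduct.lid_tmul, ratSquare_tmul,
          AlgHom.id_apply]
        rw [← algebraMap_counit h, algebraMap_smul]
        rfl
    refine AlgHom.ext fun x => (Algebra.TensorProduct.lid K B).injective (Subtype.ext ?_)
    refine (h2 (h.comul x)).trans ?_
    have h4 := DFunLike.congr_fun HA.rTensor_counit (x : A)
    rw [ratSquare_comul]
    refine (congrArg (Algebra.TensorProduct.lid F A) h4).trans ?_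
    simp
  lTensor_counit := by
    have h2 : ∀ z : B ⊗[K] B, ((Algebra.TensorProduct.rid K K B
        (Algebra.TensorProduct.map (.id K B) h.counit z) : B) : A) =
          Algebra.TensorProduct.rid F F A
          (Algebra.TensorProduct.map (.id F A) HA.counit (ratSquare F B z)) := by
      intro z
      induction z using TensorProduct.induction_on with
      | zero => simp
      | add x y hx hy => simp only [map_add, Subalgebra.coe_add, hx, hy]
      | tmul x y =>
        simp only [Algebra.TensorProduct.map_tmul, Algebra.TensorProduct.rid_tmul, ratSquare_tmul,
          AlgHom.id_apply]
        rw [← algebraMap_counit h, algebraMap_smul]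
        rfl
    refine AlgHom.ext fun x => (Algebra.TensorProduct.rid K K B).injective (Subtype.ext ?_)
    refine (h2 (h.comul x)).trans ?_
    have h4 := DFunLike.congr_fun HA.lTensor_counit (x : A)
    rw [ratSquare_comul]
    refine (congrArg (Algebra.TensorProduct.rid F F A) h4).trans ?_
    simp
  antipode_rTensor := by
    have h2 : ∀ z : B ⊗[K] B, ((LinearMap.mul' K B (h.antipode.rTensor B z) : B) : A)
        = LinearMap.mul' F A (HA.antipode.rTensor A (ratSquare F B z)) := by
      intro z
      induction z using TensorProduct.induction_on with
      | zero => simp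
      | add x y hx hy => simp only [map_add, Subalgebra.coe_add, hx, hy]
      | tmul x y => simp [coe_antipode]
    refine LinearMap.ext fun x => Subtype.ext ((h2 (h.comul x)).trans ?_)
    have h4 := DFunLike.congr_fun HA.antipode_rTensor (x : A)
    rw [ratSquare_comul]
    refine Eq.trans h4 ?_
    change algebraMap F A (HA.counit x) = ((algebraMap K B (h.counit x) : B) : A)
    rw [← algebraMap_counit]
    exact (IsScalarTower.algebraMap_apply K F A _).symm
  antipode_lTensor := by
    have h2 : ∀ z : B ⊗[K] B, ((LinearMap.mul' K B (h.antipode.lTensor B z) : B) : A)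
        = LinearMap.mul' F A (HA.antipode.lTensor A (ratSquare F B z)) := by
      intro z
      induction z using TensorProduct.induction_on with
      | zero => simp
      | add x y hx hy => simp only [map_add, Subalgebra.coe_add, hx, hy]
      | tmul x y => simp [coe_antipode]
    refine LinearMap.ext fun x => Subtype.ext ((h2 (h.comul x)).trans ?_)
    have h4 := DFunLike.congr_fun HA.antipode_lTensor (x : A)
    rw [ratSquare_comul]
    refine Eq.trans h4 ?_
    change algebraMap F A (HA.counit x) = ((algebraMap K B (h.counit x) : B) : A)
    rw [← algebraMap_counit]
    exact (IsScalarTower.algebraMap_apply K F A _).symm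

end IsHopfStable

end RestrictHopf

/-! ### Integral forms as Hopf algebras -/

section IntegralForm

variable {K F : Type*} [CommRing K] [IsDedekindDomain K] [Field F] [Algebra K F] [IsFractionRing K F]
  {A : Type*} [Ring A] [Algebra F A] [Algebra K A] [IsScalarTower K F A] (B : Subalgebra K A)

omit [IsDedekindDomain K] [Algebra K F] [IsFractionRing K F] [IsScalarTower K F A] in
theorem commute_ofId_val (q : F) (x : B) : Commute (Algebra.ofId F A q) (B.val x) :=
  Algebra.commutes q (x : A)

omit [IsDedekindDomain K] [IsFractionRing K F] in
theorem algHom_baseChange_ext {S D : Type*} [Ring S] [Algebra K S] [Ring D] [Algebra F D]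
    {f g : F ⊗[K] S →ₐ[F] D} (h : ∀ x, f (1 ⊗ₜ x) = g (1 ⊗ₜ x)) : f = g := by
  refine AlgHom.ext fun z => ?_
  induction z using TensorProduct.induction_on with
  | zero => simp
  | add x y hx hy => simp only [map_add, hx, hy]
  | tmul q x =>
    have h1 : q ⊗ₜ[K] x = q • ((1 : F) ⊗ₜ[K] x) := by
      rw [TensorProduct.smul_tmul', smul_eq_mul, mul_one]
    rw [h1, map_smul, map_smul, h]

variable (F) in
/-- The extension of the inclusion of an integral subalgebra. -/
def baseChangeVal : F ⊗[K] B →ₐ[F] A :=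
  Algebra.TensorProduct.lift (Algebra.ofId F A) B.val (commute_ofId_val B)

omit [IsDedekindDomain K] [IsFractionRing K F] in
theorem baseChangeVal_tmul (q : F) (x : B) : baseChangeVal F B (q ⊗ₜ x) = q • (x : A) := by
  rw [baseChangeVal, Algebra.TensorProduct.lift_tmul, Algebra.ofId_apply, Algebra.smul_def]
  rfl

/-- The map factors through F ⊗ A over F, which is A, and F ⊗ B over K embeds there by flatness. -/
theorem baseChangeVal_injective : Function.Injective (baseChangeVal F B) := by
  have h1 : Function.Injective (fractionTensor F (LinearMap.id : F →ₗ[K] F) B.val.toLinearMap) :=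
    fractionTensor_injective Function.injective_id Subtype.val_injective
  have h2 : ∀ z, baseChangeVal F B z = TensorProduct.lid F A
      (fractionTensor F (LinearMap.id : F →ₗ[K] F) B.val.toLinearMap z) := by
    intro z
    induction z using TensorProduct.induction_on with
    | zero => simp
    | add x y hx hy => simp only [map_add, hx, hy]
    | tmul q x => rw [baseChangeVal_tmul, fractionTensor_tmul, TensorProduct.lid_tmul]; rfl
  intro x y hxy
  rw [h2, h2] at hxy
  exact h1 ((TensorProduct.lid F A).injective hxy)

omit [IsDedekindDomain K] [IsFractionRing K F] in
theorem range_baseChangeVal : (baseChangeVal F B).range = Algebra.adjoin F (B : Set A) := by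
  refine le_antisymm ?_ (Algebra.adjoin_le ?_)
  · rintro _ ⟨z, rfl⟩
    change baseChangeVal F B z ∈ _
    induction z using TensorProduct.induction_on with
    | zero => rw [map_zero]; exact zero_mem _
    | add x y hx hy => rw [map_add]; exact add_mem hx hy
    | tmul q x =>
      rw [baseChangeVal_tmul]
      exact Subalgebra.smul_mem _ (Algebra.subset_adjoin x.2) q
  · intro x hx
    exact ⟨1 ⊗ₜ ⟨x, hx⟩, (baseChangeVal_tmul B 1 ⟨x, hx⟩).trans (one_smul _ _)⟩

variable {B} {HA : HopfStructure F A}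

/-- A stable integral subalgebra is an integral form of the rational Hopf subalgebra that it spans. -/
theorem IsHopfStable.exists_bialgEquiv (h : IsHopfStable B HA) {C : Type*} [Ring C] [HopfAlgebra F C]
    (j : C →ₐ[F] A) (hj : Function.Injective j)
    (hΔ : ∀ x, HA.comul (j x) = Algebra.TensorProduct.map j j (Coalgebra.comul (R := F) x))
    (hε : ∀ x, HA.counit (j x) = Coalgebra.counit (R := F) x)
    (hS : ∀ x, HA.antipode (j x) = j (HopfAlgebra.antipode F x))
    (hrange : j.range = Algebra.adjoin F (B : Set A)) :
    letI := h.hopfStructure.toHopfAlgebra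
    ∃ Φ : (F ⊗[K] B) ≃ₐc[F] C,
      (∀ x, Φ (HopfAlgebra.antipode F x) = HopfAlgebra.antipode F (Φ x)) ∧
      ∀ (q : F) (x : B), j (Φ (q ⊗ₜ x)) = q • (x : A) := by
  let _ := h.hopfStructure.toHopfAlgebra
  -- Both algebras embed in A with the same image. The compatibilities with counit, comultiplication
  -- and antipode are then compared through these embeddings.
  let Φ : F ⊗[K] B ≃ₐ[F] C := (AlgEquiv.ofInjective _ (baseChangeVal_injective B)).trans
    ((Subalgebra.equivOfEq _ _ ((range_baseChangeVal B).trans hrange.symm)).trans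
      (AlgEquiv.ofInjective j hj).symm)
  have hΦ : ∀ z, j (Φ z) = baseChangeVal F B z := by
    intro z
    have h1 := AlgEquiv.apply_symm_apply (AlgEquiv.ofInjective j hj)
      ((Subalgebra.equivOfEq _ _ ((range_baseChangeVal B).trans hrange.symm))
        ((AlgEquiv.ofInjective _ (baseChangeVal_injective B)) z))
    exact congrArg Subtype.val h1
  have hjj : Function.Injective (Algebra.TensorProduct.map j j) :=
    TensorProduct.map_injective_of_flat_flat j.toLinearMap j.toLinearMap hj hj
  refine ⟨BialgEquiv.ofAlgEquiv Φ ?_ ?_, ?_, ?_⟩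
  · refine algHom_baseChange_ext fun x => ?_
    change Coalgebra.counit (R := F) (Φ (1 ⊗ₜ x)) = Coalgebra.counit (R := F) ((1 : F) ⊗ₜ[K] x)
    rw [← hε, hΦ, baseChangeVal_tmul, one_smul, TensorProduct.counit_tmul,
      ← h.algebraMap_counit x]
    change _ = h.counit x • (1 : F)
    rw [Algebra.algebraMap_eq_smul_one]
  · refine algHom_baseChange_ext fun x => hjj ?_
    change Algebra.TensorProduct.map j j (Algebra.TensorProduct.map Φ.toAlgHom Φ.toAlgHom
        (Coalgebra.comul (R := F) ((1 : F) ⊗ₜ[K] x))) = Algebra.TensorProduct.map j j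
        (Coalgebra.comul (R := F) (Φ ((1 : F) ⊗ₜ[K] x)))
    rw [← hΔ, hΦ, baseChangeVal_tmul, one_smul, ← h.ratSquare_comul, TensorProduct.comul_tmul]
    change _ = ratSquare F B (Coalgebra.comul (R := K) x)
    induction Coalgebra.comul (R := K) x using TensorProduct.induction_on with
    | zero => rw [TensorProduct.tmul_zero, LinearEquiv.map_zero, map_zero, map_zero, map_zero]
    | add a b ha hb =>
      rw [TensorProduct.tmul_add, LinearEquiv.map_add, map_add, map_add, map_add, ha, hb]
    | tmul a b =>
      rw [CommSemiring.comul_apply, TensorProduct.AlgebraTensorModule.tensorTensorTensorComm_tmul]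
      change j (Φ _) ⊗ₜ j (Φ _) = (a : A) ⊗ₜ[F] (b : A)
      rw [hΦ, hΦ, baseChangeVal_tmul, baseChangeVal_tmul, one_smul, one_smul]
  · intro z
    apply hj
    change j (Φ _) = j (HopfAlgebra.antipode F (Φ z))
    rw [← hS, hΦ, hΦ]
    induction z using TensorProduct.induction_on with
    | zero => simp
    | add a b ha hb => simp only [map_add, ha, hb]
    | tmul q x =>
      change baseChangeVal F B (q ⊗ₜ h.antipode x) = _
      rw [baseChangeVal_tmul, baseChangeVal_tmul, map_smul, h.coe_antipode]
  · intro q x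
    exact (hΦ _).trans (baseChangeVal_tmul B q x)

omit [IsDedekindDomain K] [IsFractionRing K F] in
theorem ratSquare_map_inclusion {B' : Subalgebra K A} (hB : B ≤ B') (z : B ⊗[K] B) :
    ratSquare F B' (Algebra.TensorProduct.map (Subalgebra.inclusion hB) (Subalgebra.inclusion hB) z)
      = ratSquare F B z := by
  induction z using TensorProduct.induction_on with
  | zero => simp
  | add a b ha hb => simp only [map_add, ha, hb]
  | tmul a b => rfl

/-- The inclusion of stable integral subalgebras is a morphism of Hopf algebras. -/
theorem IsHopfStable.inclusion (h : IsHopfStable B HA) {B' : Subalgebra K A} (h' : IsHopfStable B' HA)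
    (hB : B ≤ B') :
    h'.hopfStructure.comul.comp (Subalgebra.inclusion hB) = (Algebra.TensorProduct.map
      (Subalgebra.inclusion hB) (Subalgebra.inclusion hB)).comp h.hopfStructure.comul ∧
    h'.hopfStructure.counit.comp (Subalgebra.inclusion hB) = h.hopfStructure.counit ∧
    h'.hopfStructure.antipode ∘ₗ (Subalgebra.inclusion hB).toLinearMap
      = (Subalgebra.inclusion hB).toLinearMap ∘ₗ h.hopfStructure.antipode := by
  refine ⟨AlgHom.ext fun x => ratSquare_injective (F := F) B' ?_,
    AlgHom.ext fun x => IsFractionRing.injective K F ?_, LinearMap.ext fun x => Subtype.ext rfl⟩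
  · refine (h'.ratSquare_comul _).trans (Eq.trans ?_ (ratSquare_map_inclusion hB (h.comul x)).symm)
    exact (h.ratSquare_comul x).symm
  · exact (h'.algebraMap_counit _).trans (h.algebraMap_counit x).symm

end IntegralForm

/-! ### The Hopf structure of 𝒢_k^ℤ(R) -/

section HopfGZ
variable {R : Type*} [Ring R]

local instance : IsScalarTower ℤ ℚ (GInfQ R) where
  smul_assoc n q x := by
    have h1 := map_intCast_smul ((LinearMap.toSpanSingleton ℚ (GInfQ R) x).toAddMonoidHom) ℤ ℤ n q
    rw [Int.cast_id] at h1
    exact h1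

/-- Applied to a grouplike series, the antipode axiom says that S(E_U(t)) is a left inverse of
E_U(t). -/
theorem sum_antipode_mul_eElem (n : ℕ) (U : R) :
    ∑ p ∈ Finset.HasAntidiagonal.antidiagonal n,
      (gHopf R).antipode (eElem p.1 U) * eElem p.2 U = if n = 0 then 1 else 0 := by
  have h1 : LinearMap.mul' ℚ (GInfQ R) ((gHopf R).antipode.rTensor (GInfQ R)
      (gComul R (eElem n U))) = algebraMap ℚ (GInfQ R) (gCounit R (eElem n U)) :=
    DFunLike.congr_fun (gHopf R).antipode_rTensor (eElem n U)
  rw [gComul_eElem, gCounit_eElem, map_sum, map_sum] at h1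
  simp only [LinearMap.rTensor_tmul, LinearMap.mul'_apply] at h1
  rw [h1]
  split_ifs <;> simp

theorem sum_eElem_mul_antipode (n : ℕ) (U : R) :
    ∑ p ∈ Finset.HasAntidiagonal.antidiagonal n,
      eElem p.1 U * (gHopf R).antipode (eElem p.2 U) = if n = 0 then 1 else 0 := by
  have h1 : LinearMap.mul' ℚ (GInfQ R) ((gHopf R).antipode.lTensor (GInfQ R)
      (gComul R (eElem n U))) = algebraMap ℚ (GInfQ R) (gCounit R (eElem n U)) :=
    DFunLike.congr_fun (gHopf R).antipode_lTensor (eElem n U)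
  rw [gComul_eElem, gCounit_eElem, map_sum, map_sum] at h1
  simp only [LinearMap.lTensor_tmul, LinearMap.mul'_apply] at h1
  rw [h1]
  split_ifs <;> simp

/-- Solving S(E)E = 1 for the coefficient of t^n expresses S(e_n) by products of S(e_i) and e_(n-i)
with i < n, with integral coefficients and no index above n. -/
theorem antipode_eElem_mem {k : ℕ∞} {n : ℕ} (hn : (n : ℕ∞) ≤ k) (U : R) :
    (gHopf R).antipode (eElem n U) ∈ GZ R k := by
  induction n using Nat.strong_induction_on with
  | _ n ih =>
    have h := sum_antipode_mul_eElem n U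
    have ha : (n, 0) ∈ Finset.HasAntidiagonal.antidiagonal n := by simp
    rw [← Finset.add_sum_erase _ _ ha, eElem_zero, mul_one] at h
    rw [eq_sub_of_add_eq h]
    refine sub_mem ?_ (sum_mem fun p hp => ?_)
    · split_ifs
      · exact one_mem _
      · exact zero_mem _
    · obtain ⟨hne, hp⟩ := Finset.mem_erase.1 hp
      rw [Finset.HasAntidiagonal.mem_antidiagonal] at hp
      have h1 : p.1 < n := by
        rcases Nat.eq_zero_or_pos p.2 with h0 | h0
        · exact absurd (Prod.ext (by omega) h0) hne
        · omega
      refine mul_mem (ih _ h1 (le_trans (by exact_mod_cast h1.le) hn)) (eElem_mem (le_trans ?_ hn) U)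
      exact_mod_cast (by omega : p.2 ≤ n)

theorem gHopf_antipode (x : GInfQ R) :
    (gHopf R).antipode x = MulOpposite.unop (gAntipode R x) := rfl

/-- The structure maps are homomorphisms or anti-homomorphisms, so the generators suffice. Their
images involve only e_j with j at most the given index, which is why each 𝒢_k^ℤ(R) is stable. -/
theorem isHopfStable_GZ (k : ℕ∞) : IsHopfStable (K := ℤ) (F := ℚ) (GZ R k) (gHopf R) where
  comul_mem x hx := by
    change gComul R x ∈ _
    induction hx using Algebra.adjoin_induction with
    | mem x hx =>
      obtain ⟨i, U, hi, rfl⟩ := hx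
      rw [gComul_eElem]
      refine sum_mem fun p hp => ?_
      rw [Finset.HasAntidiagonal.mem_antidiagonal] at hp
      have h1 : (p.1 : ℕ∞) ≤ k := le_trans (by exact_mod_cast (by omega : p.1 ≤ i)) hi
      have h2 : (p.2 : ℕ∞) ≤ k := le_trans (by exact_mod_cast (by omega : p.2 ≤ i)) hi
      exact ⟨eZ k p.1 h1 U ⊗ₜ eZ k p.2 h2 U, rfl⟩
    | algebraMap r =>
      have h1 : gComul R (algebraMap ℤ (GInfQ R) r) = (r : GInfQ R ⊗[ℚ] GInfQ R) := by simp
      rw [h1]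
      exact intCast_mem _ r
    | add x y _ _ hx hy => rw [map_add]; exact add_mem hx hy
    | mul x y _ _ hx hy => rw [map_mul]; exact mul_mem hx hy
  counit_mem x hx := by
    change gCounit R x ∈ _
    induction hx using Algebra.adjoin_induction with
    | mem x hx =>
      obtain ⟨i, U, hi, rfl⟩ := hx
      rw [gCounit_eElem]
      split_ifs
      · exact one_mem _
      · exact zero_mem _
    | algebraMap r =>
      have h1 : gCounit R (algebraMap ℤ (GInfQ R) r) = (r : ℚ) := by simp
      rw [h1]
      exact intCast_mem _ r
    | add x y _ _ hx hy => rw [map_add]; exact add_mem hx hy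
    | mul x y _ _ hx hy => rw [map_mul]; exact mul_mem hx hy
  antipode_mem x hx := by
    induction hx using Algebra.adjoin_induction with
    | mem x hx =>
      obtain ⟨i, U, hi, rfl⟩ := hx
      exact antipode_eElem_mem hi U
    | algebraMap r =>
      have h1 : (gHopf R).antipode (algebraMap ℤ (GInfQ R) r) = (r : GInfQ R) := by
        rw [gHopf_antipode]; simp
      rw [h1]
      exact intCast_mem _ r
    | add x y _ _ hx hy => rw [map_add]; exact add_mem hx hy
    | mul x y _ _ hx hy =>
      rw [gHopf_antipode, map_mul, MulOpposite.unop_mul]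
      exact mul_mem hy hx

/-- The Hopf algebra structure on `𝒢_k^ℤ(R)`. -/
def gzHopf (R : Type*) [Ring R] (k : ℕ∞) : HopfStructure ℤ (GZ R k) :=
  (isHopfStable_GZ (R := R) k).hopfStructure

theorem ratSquare_gzHopf_comul (k : ℕ∞) (x : GZ R k) :
    ratSquare ℚ (GZ R k) ((gzHopf R k).comul x) = gComul R (x : GInfQ R) :=
  (isHopfStable_GZ (R := R) k).ratSquare_comul x

theorem algebraMap_gzHopf_counit (k : ℕ∞) (x : GZ R k) :
    algebraMap ℤ ℚ ((gzHopf R k).counit x) = gCounit R (x : GInfQ R) :=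
  (isHopfStable_GZ (R := R) k).algebraMap_counit x

theorem isGrouplikeHopf_gzHopf : IsGrouplikeHopf (gzHopf R ⊤) := by
  intro U
  refine ⟨fun n => ratSquare_injective (F := ℚ) (GZ R ⊤) ?_,
    fun n => IsFractionRing.injective ℤ ℚ ?_, ?_, ?_⟩
  · rw [ratSquare_gzHopf_comul, map_sum]
    exact gComul_eElem n U
  · rw [algebraMap_gzHopf_counit]
    refine (gCounit_eElem n U).trans ?_
    split_ifs <;> simp
  · refine PowerSeries.ext fun n => Subtype.ext ?_
    rw [PowerSeries.coeff_mul, PowerSeries.coeff_one, AddSubmonoidClass.coe_finsetSum]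
    simp only [EZ, PowerSeries.coeff_mk]
    refine (sum_antipode_mul_eElem n U).trans ?_
    split_ifs <;> rfl
  · refine PowerSeries.ext fun n => Subtype.ext ?_
    rw [PowerSeries.coeff_mul, PowerSeries.coeff_one, AddSubmonoidClass.coe_finsetSum]
    simp only [EZ, PowerSeries.coeff_mk]
    refine (sum_eElem_mul_antipode n U).trans ?_
    split_ifs <;> rfl

theorem isSubHopf_gzHopf (k : ℕ∞) : IsSubHopf (gzHopf R ⊤) (gzHopf R k) :=
  (isHopfStable_GZ (R := R) k).inclusion (isHopfStable_GZ ⊤) (GZ_mono le_top)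

end HopfGZ

/-! ### The rational span of 𝒢_k^ℤ(R) -/

section Generators

theorem wordFil_le_adjoin {K H X : Type*} [CommRing K] [Ring H] [Algebra K H] (g : X → H) (w : X → ℕ)
    (d : ℕ) : wordFil K g w d ≤ Subalgebra.toSubmodule (Algebra.adjoin K (Set.range g)) := by
  refine Submodule.span_le.2 ?_
  rintro _ ⟨L, -, rfl⟩
  change (L.map g).prod ∈ Algebra.adjoin K (Set.range g)
  refine list_prod_mem fun x hx => ?_
  obtain ⟨y, -, rfl⟩ := List.mem_map.1 hx
  exact Algebra.subset_adjoin ⟨y, rfl⟩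

variable {R : Type*} [Ring R]

theorem range_eGen_mono {k m : ℕ} (h : k ≤ m) :
    Set.range (eGen (R := R) k) ⊆ Set.range (eGen m) := by
  rintro _ ⟨⟨j, U⟩, rfl⟩
  exact ⟨(⟨j, j.2.trans_le h⟩, U), rfl⟩

theorem signed_eq_smul (n : ℕ) (U : R) : signed n U = ((-1 : ℚ) ^ n) • ratExtOf R U := by
  rw [signed]
  rcases Nat.even_or_odd n with h | h
  · rw [h.neg_one_pow, h.neg_one_pow, one_mul, one_smul]
  · rw [h.neg_one_pow, h.neg_one_pow, neg_one_mul, neg_smul, one_smul]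

theorem eGen_mem_adjoin_tGen {k : ℕ} (p : Fin k × R) :
    eGen k p ∈ Algebra.adjoin ℚ (Set.range (tGen (R := R) (firstIndex k))) := by
  have h := wordFil_le_adjoin _ _ _ (eElem_add_tElem_mem p.1.2 p.2)
  have h' : tElem R (p.1 : ℕ).succPNat (signed ((p.1 : ℕ) + 1) p.2)
      ∈ Algebra.adjoin ℚ (Set.range (tGen (R := R) (firstIndex k))) :=
    Algebra.subset_adjoin ⟨(p.1, signed ((p.1 : ℕ) + 1) p.2), rfl⟩
  have h2 := sub_mem h h'
  rw [add_sub_cancel_right] at h2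
  exact h2

theorem ratExt_mem_span (a : RatExt R) : a ∈ Submodule.span ℚ (Set.range (ratExtOf R)) := by
  induction a using TensorProduct.induction_on with
  | zero => exact zero_mem _
  | add x y hx hy => exact add_mem hx hy
  | tmul q U =>
    have h : (q ⊗ₜ[ℤ] U : RatExt R) = q • ratExtOf R U :=
      (congrArg (· ⊗ₜ[ℤ] U) (mul_one q)).symm
    rw [h]
    exact Submodule.smul_mem _ _ (Submodule.subset_span ⟨U, rfl⟩)

/-- The leading-term formula can be solved for T_n(U): it is ± e_n(U) up to a polynomial in the T_l
with l < n, which induction covers. Linearity passes from R to ℚ ⊗ R. -/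
theorem tGen_mem_adjoin_eGen {k : ℕ} (p : Fin k × RatExt R) :
    tGen (firstIndex k) p ∈ Algebra.adjoin ℚ (Set.range (eGen (R := R) k)) := by
  induction k using Nat.strong_induction_on with
  | _ k ih =>
    obtain ⟨⟨n, hn⟩, a⟩ := p
    have hlow : Algebra.adjoin ℚ (Set.range (tGen (R := R) (firstIndex n))) ≤
        Algebra.adjoin ℚ (Set.range (eGen (R := R) k)) := by
      refine Algebra.adjoin_le ?_
      rintro _ ⟨q, rfl⟩
      exact Algebra.adjoin_mono (range_eGen_mono hn.le) (ih n hn q)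
    have hU : ∀ U : R, tElem R n.succPNat (ratExtOf R U) ∈
        Algebra.adjoin ℚ (Set.range (eGen (R := R) k)) := by
      intro U
      have h1 := hlow (wordFil_le_adjoin _ _ _ (coeff_partialE_mem (le_refl n) U (n + 1)))
      have h2 : eElem (n + 1) U ∈ Algebra.adjoin ℚ (Set.range (eGen (R := R) k)) :=
        Algebra.subset_adjoin ⟨(⟨n, hn⟩, U), rfl⟩
      have h3 := sub_mem h1 h2
      rw [eElem_succ, sub_sub_cancel, signed_eq_smul, map_smul] at h3
      have h4 := Subalgebra.smul_mem _ h3 ((-1 : ℚ) ^ (n + 1))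
      rwa [smul_smul, ← mul_pow, neg_one_mul, neg_neg, one_pow, one_smul] at h4
    change tElem R n.succPNat a ∈ _
    have ha := ratExt_mem_span a
    induction ha using Submodule.span_induction with
    | mem x hx => obtain ⟨U, rfl⟩ := hx; exact hU U
    | zero => rw [map_zero]; exact zero_mem _
    | add x y _ _ hx hy => rw [map_add]; exact add_mem hx hy
    | smul q x _ hx => rw [map_smul]; exact Subalgebra.smul_mem _ hx q

theorem adjoin_tGen (k : ℕ) : Algebra.adjoin ℚ (Set.range (tGen (R := R) (firstIndex k)))
    = Algebra.adjoin ℚ (GZ R (k : ℕ∞) : Set (GInfQ R)) := by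
  refine le_antisymm (Algebra.adjoin_le ?_) (Algebra.adjoin_le ?_)
  · rintro _ ⟨p, rfl⟩
    refine Algebra.adjoin_mono ?_ (tGen_mem_adjoin_eGen p)
    rintro _ ⟨q, rfl⟩
    exact eGen_mem q
  · intro x hx
    have hx' : x ∈ Algebra.adjoin ℤ (Set.range (eGen (R := R) k)) := GZ_eq_adjoin (R := R) k ▸ hx
    clear hx
    induction hx' using Algebra.adjoin_induction with
    | mem x hx => obtain ⟨q, rfl⟩ := hx; exact eGen_mem_adjoin_tGen q
    | algebraMap r =>
      have h1 : algebraMap ℤ (GInfQ R) r = (r : GInfQ R) := by simp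
      rw [h1]
      exact intCast_mem _ r
    | add x y _ _ h1 h2 => exact add_mem h1 h2
    | mul x y _ _ h1 h2 => exact mul_mem h1 h2

end Generators

/-! ### Comparison with the tensor powers of U(ℚ ⊗ R) -/

section TensorPowers
variable (R : Type*) [Ring R]

theorem firstFactors_ι (k : ℕ) (i : Fin k) (a : RatExt R) :
    firstFactors R k (ueaSingle i (UniversalEnvelopingAlgebra.ι ℚ a)) = tGen (firstIndex k) (i, a) :=
  firstFactors_single R k i _

theorem range_firstFactors (k : ℕ) : (firstFactors R k).range =
    Algebra.adjoin ℚ (Set.range (tGen (R := R) (firstIndex k))) := by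
  rw [← Algebra.map_top, ← tensorPower_adjoin ℚ (RatExt R) k, AlgHom.map_adjoin, ← Set.range_comp]
  congr 1
  exact congrArg Set.range (funext fun p => firstFactors_ι R k p.1 p.2)

theorem range_factor_one : (factor R 1).range =
    Algebra.adjoin ℚ (Set.range (tGen (R := R) (firstIndex 1))) := by
  rw [← Algebra.map_top, ← uea_adjoin_range_ι ℚ (RatExt R), AlgHom.map_adjoin]
  congr 1
  ext x
  constructor
  · rintro ⟨_, ⟨a, rfl⟩, rfl⟩
    exact ⟨(0, a), rfl⟩
  · rintro ⟨⟨i, a⟩, rfl⟩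
    refine ⟨_, ⟨a, rfl⟩, ?_⟩
    rw [Subsingleton.elim i 0]
    rfl

/-- Both sides are algebra maps and agree on the generators, which are primitive on either side.
Counit and antipode are compared by the same argument. -/
theorem gComul_comp_firstFactors (k : ℕ) : (gComul R).comp (firstFactors R k) =
    (Algebra.TensorProduct.map (firstFactors R k) (firstFactors R k)).comp
      (tensorPowerComul ℚ (RatExt R) k) := by
  refine AlgHom.ext_of_adjoin_eq_top (tensorPower_adjoin ℚ (RatExt R) k) ?_
  rintro _ ⟨⟨i, a⟩, rfl⟩
  have h : tensorPowerComul ℚ (RatExt R) k (ueaSingle i (UniversalEnvelopingAlgebra.ι ℚ a))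
      = ueaSingle i (UniversalEnvelopingAlgebra.ι ℚ a) ⊗ₜ 1
        + 1 ⊗ₜ ueaSingle i (UniversalEnvelopingAlgebra.ι ℚ a) := by
    simp only [tensorPowerComul]
    erw [piLift_single]
    simp [ueaComul, -PiTensorProduct.singleAlgHom_apply]
  rw [AlgHom.comp_apply, AlgHom.comp_apply, h, map_add, Algebra.TensorProduct.map_tmul,
    Algebra.TensorProduct.map_tmul, map_one, firstFactors_ι]
  exact gComul_tElem _ _

theorem gCounit_comp_firstFactors (k : ℕ) : (gCounit R).comp (firstFactors R k) =
    tensorPowerCounit ℚ (RatExt R) k := by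
  refine AlgHom.ext_of_adjoin_eq_top (tensorPower_adjoin ℚ (RatExt R) k) ?_
  rintro _ ⟨⟨i, a⟩, rfl⟩
  have h : tensorPowerCounit ℚ (RatExt R) k (ueaSingle i (UniversalEnvelopingAlgebra.ι ℚ a)) = 0 := by
    simp only [tensorPowerCounit]
    erw [piLift_single]
    simp [ueaCounit]
  rw [AlgHom.comp_apply, h, firstFactors_ι]
  exact gCounit_tElem _ _

theorem gAntipode_comp_firstFactors (k : ℕ) : (gAntipode R).comp (firstFactors R k) =
    (AlgHom.op (firstFactors R k)).comp (tensorPowerAntipode ℚ (RatExt R) k) := by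
  refine AlgHom.ext_of_adjoin_eq_top (tensorPower_adjoin ℚ (RatExt R) k) ?_
  rintro _ ⟨⟨i, a⟩, rfl⟩
  have h : tensorPowerAntipode ℚ (RatExt R) k (ueaSingle i (UniversalEnvelopingAlgebra.ι ℚ a))
      = MulOpposite.op (-ueaSingle i (UniversalEnvelopingAlgebra.ι ℚ a)) := by
    simp only [tensorPowerAntipode]
    erw [piLift_single]
    simp [ueaAntipode, -PiTensorProduct.singleAlgHom_apply]
  rw [AlgHom.comp_apply, AlgHom.comp_apply, h, AlgHom.op_apply_apply, MulOpposite.unop_op, map_neg,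
    firstFactors_ι]
  exact gAntipode_tElem _ _

theorem gComul_comp_factor (l : ℕ+) : (gComul R).comp (factor R l) =
    (Algebra.TensorProduct.map (factor R l) (factor R l)).comp (ueaComul ℚ (RatExt R)) :=
  AlgHom.ext fun u => gLift_factor _ _ l u

theorem gCounit_comp_factor (l : ℕ+) :
    (gCounit R).comp (factor R l) = ueaCounit ℚ (RatExt R) :=
  AlgHom.ext fun u => gLift_factor _ _ l u

theorem gAntipode_comp_factor (l : ℕ+) : (gAntipode R).comp (factor R l) =
    (AlgHom.op (factor R l)).comp (ueaAntipode ℚ (RatExt R)) :=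
  AlgHom.ext fun u => gLift_factor _ _ l u

variable [Module.Free ℤ R]

theorem isHopfIntegralForm_firstFactors (k : ℕ) :
    IsHopfIntegralForm (gzHopf R k) (firstFactors R k) := by
  refine ⟨?_, (isHopfStable_GZ (R := R) k).exists_bialgEquiv (firstFactors R k)
    (firstFactors_injective R k)
    (fun x => DFunLike.congr_fun (gComul_comp_firstFactors R k) x)
    (fun x => DFunLike.congr_fun (gCounit_comp_firstFactors R k) x)
    (fun x => congrArg MulOpposite.unop (DFunLike.congr_fun (gAntipode_comp_firstFactors R k) x))
    ((range_firstFactors R k).trans (adjoin_tGen k))⟩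
  convert free_GZ (R := R) k using 1

theorem isHopfIntegralForm_factor_one :
    IsHopfIntegralForm (gzHopf R (1 : ℕ)) (factor R 1) := by
  refine ⟨?_, (isHopfStable_GZ (R := R) (1 : ℕ)).exists_bialgEquiv (factor R 1)
    (factor_one_injective R)
    (fun x => DFunLike.congr_fun (gComul_comp_factor R 1) x)
    (fun x => DFunLike.congr_fun (gCounit_comp_factor R 1) x)
    (fun x => congrArg MulOpposite.unop (DFunLike.congr_fun (gAntipode_comp_factor R 1) x))
    ((range_factor_one R).trans (adjoin_tGen 1))⟩
  convert free_GZ (R := R) 1 using 1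

end TensorPowers

end

theorem proposition8p7 (R : Type*) [Ring R] [Module.Free ℤ R] :
    -- the Hopf algebra structures; integral forms of the tensor powers and, for `k = 1`, of `U(ℚ ⊗ R)`
    (∃ (H : HopfStructure ℤ (GZ R ⊤)) (Hk : ∀ k : ℕ, HopfStructure ℤ (GZ R k)),
      IsGrouplikeHopf H ∧
      (∀ k : ℕ, IsSubHopf H (Hk k)) ∧
      (∀ k : ℕ, IsHopfIntegralForm (Hk k) (firstFactors R k)) ∧
      IsHopfIntegralForm (Hk 1) (factor R 1)) ∧
    -- the PBW monomials in any ordered basis of `R` are a `ℤ`-basis for `k = 1`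
    (∀ (ι : Type*) [LinearOrder ι] (b : Module.Basis ι ℤ R),
      ∃ B : Module.Basis (ι →₀ ℕ) ℤ (GZ R (1 : ℕ)), ∀ n, (B n : GInfQ R) = factor R 1 (pbwMonomial b n)) ∧
    -- the algebras are left and right noetherian for `R` of finite rank
    (Module.Finite ℤ R → ∀ k : ℕ, IsNoetherianRing (GZ R k) ∧ IsNoetherianRing (GZ R k)ᵐᵒᵖ) :=
  ⟨⟨gzHopf R ⊤, fun k => gzHopf R k, isGrouplikeHopf_gzHopf, fun k => isSubHopf_gzHopf k,
    isHopfIntegralForm_firstFactors R, isHopfIntegralForm_factor_one R⟩,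
    fun _ _ b => exists_pbwBasis b, fun _ k => isNoetherianRing_GZ k⟩
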